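/- Let $X$ be a compact Riemann surface (connected), $L$ a holomorphic line bundle on $X$ and $d=\deg L$. Let $p\ge 1$, let $V,W$ be holomorphic vector bundles of rank $p$ on $X$ and let $\beta\colon W\to V\otimes L$, $\gamma\colon V\to W\otimes L$ be holomorphic maps, so that $E=(V,W,\beta,\gamma)$ is an $L$-twisted $\mathrm U(p,p)$-Higgs bundle. Write $\mu(V)=\deg V/p$, $\mu(W)=\deg W/p$. For $\alpha\in\mathbb R$, $E$ is $\alpha$-semistable (resp. $\alpha$-stable) if for all holomorphic subbundles $V'\subseteq V$, $W'\subseteq W$ with $\beta(W')\subseteq V'\otimes L$, $\gamma(V')\subseteq W'\otimes L$ and $(V',W')\ne(0,0),(V,W)$, $$\frac{\deg V'+\deg W'}{\operatorname{rk}V'+\operatorname{rk}W'}+\alpha\frac{\operatorname{rk}V'}{\operatorname{rk}V'+\operatorname{rk}W'}\ \le\ (\text{resp. }<)\ \frac{\deg V+\deg W}{2p}+\frac{\alpha}{2}.$$ The associated $L$-twisted $\mathrm{GL}(2p,\mathbb C)$-Higgs bundle is $(\widetilde E,\phi)$ with $\widetilde E=V\oplus W$ and $\phi=\begin{pmatrix}0&\beta\\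 \gamma&0\end{pmatrix}\colon\widetilde E\to\widetilde E\otimes L$. An $L$-twisted Higgs bundle is semistable (resp. stable) if $\mu(E')\le\mu$ (resp. $<\mu$) for every non-zero proper invariant holomorphic subbundle $E'$, where $\mu$ is the slope of the whole bundle, and polystable if it is a direct sum of stable Higgs bundles of the same slope. Put $$\alpha_0=p\big(\mu(W)-\mu(V)-d\big)+d,\qquad \alpha_0'=p\big(\mu(W)-\mu(V)+d\big)-d .$$ (A) Suppose that (1) $\mu(V)-\mu(W)>-d$ and $0\le\alpha<\alpha_0$, or (2) $\mu(V)-\mu(W)<d$ and $\alpha_0'<\alpha\le 0$. If $E$ is $\alpha$-semistable, then $(\widetilde E,\phi)$ is semistable. If $E$ is $\alpha$-stable, then $(\widetilde E,\phi)$ is stable unless there is an isomorphism $f\colon V\to W$ of holomorphic vector bundles with $\beta f=f^{-1}\gamma$ (where $f^{-1}$ stands for $f^{-1}\otimes 1_L$). (B) Let $\alpha\in\mathbb R$ be arbitrary. If $E$ is $\alpha$-stable and $f\colon V\to W$ is an isomorphism with $\beta f=f^{-1}\gamma$, then $(\widetilde E,\phi)$ is polystable and decomposes as $(\widetilde E,\phi)=(\widetilde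 E_1,\phi_1)\oplus(\widetilde E_2,\phi_2)$ into invariant holomorphic subbundles of rank $p$ and of the same slope as $\widetilde E$, each of which is a stable $\mathrm{GL}(p,\mathbb C)$-Higgs bundle, with $(\widetilde E_1,\phi_1)\cong(V,\beta f)$ and $(\widetilde E_2,\phi_2)\cong(V,-\beta f)$. -/

import Mathlib

open scoped Manifold ContDiff TensorProduct Bundle

noncomputable section

/-! Throughout, a compact Riemann surface is a nonempty connected compact Hausdorff complex manifold
`X` modelled on `ℂ`, and a holomorphic vector bundle on it is a Mathlib vector bundle `E` with a
finite-dimensional model fibre `F` and complex-analytic transition functions. -/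

namespace Higgs

section Realification

variable {X : Type*} [TopologicalSpace X] [ChartedSpace ℂ X]

/-- A Riemann surface is a smooth real surface. -/
theorem isManifold_real [IsManifold 𝓘(ℂ) ω X] : IsManifold 𝓘(ℝ, ℂ) ∞ X := by
  refine isManifold_of_contDiffOn _ _ _ fun e e' he he' => ?_
  have h := (contDiffGroupoid ω 𝓘(ℂ)).compatible he he'
  rw [contDiffGroupoid, mem_groupoid_of_pregroupoid] at h
  have h1 : ContDiffOn ℂ ω (𝓘(ℂ) ∘ (e.symm ≫ₕ e') ∘ 𝓘(ℂ).symm)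
    (𝓘(ℂ).symm ⁻¹' (e.symm ≫ₕ e').source ∩ Set.range 𝓘(ℂ)) := h.1
  exact (h1.restrict_scalars ℝ).of_le le_top

/-- A holomorphic function is smooth over the reals. -/
theorem contMDiffAt_real {f : X → ℂ} {x : X} (hf : ContMDiffAt 𝓘(ℂ) 𝓘(ℂ) ω f x) :
    ContMDiffAt 𝓘(ℝ, ℂ) 𝓘(ℝ, ℂ) ∞ f x := by
  rw [contMDiffAt_iff] at hf ⊢
  exact ⟨hf.1, (hf.2.restrict_scalars ℝ).of_le le_top⟩

/-- A smooth partition of unity subordinate to the charts of a compact Riemann surface exists. -/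
theorem exists_partition [IsManifold 𝓘(ℂ) ω X] [CompactSpace X] [T2Space X] :
    ∃ ρ : SmoothPartitionOfUnity X 𝓘(ℝ, ℂ) X Set.univ,
      ρ.IsSubordinate fun p => (chartAt ℂ p).source := by
  have := isManifold_real (X := X)
  exact SmoothPartitionOfUnity.exists_isSubordinate_chartAt_source 𝓘(ℝ, ℂ) X

end Realification

section Bundles

variable {X : Type*} [TopologicalSpace X] [ChartedSpace ℂ X]
  {F : Type*} [NormedAddCommGroup F] [NormedSpace ℂ F]
  {E : X → Type*} [TopologicalSpace (Bundle.TotalSpace F E)] [∀ x, TopologicalSpace (E x)]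
  [∀ x, AddCommGroup (E x)] [∀ x, Module ℂ (E x)]
  [FiberBundle F E]

variable (F) in
/-- `s` is a holomorphic section of the bundle `E` over `U` (its values outside `U` are
irrelevant). -/
def IsHolSection (U : Set X) (s : ∀ x, E x) : Prop :=
  ContMDiffOn 𝓘(ℂ) (𝓘(ℂ).prod 𝓘(ℂ, F)) ω (fun x => Bundle.TotalSpace.mk' F x (s x)) U

variable (F E) in
/-- A smooth Hermitian metric on a holomorphic vector bundle. Smoothness (over the reals) is tested
on holomorphic local sections, which include local frames. -/
structure HermitianMetric where
  form : ∀ x, E x →ₗ⋆[ℂ] E x →ₗ[ℂ] ℂ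
  conj_symm : ∀ x v w, starRingEnd ℂ (form x v w) = form x w v
  pos : ∀ x v, v ≠ 0 → 0 < (form x v v).re
  smooth : ∀ (U : Set X) (s t : ∀ x, E x), IsOpen U → IsHolSection F U s → IsHolSection F U t →
    ContMDiffOn 𝓘(ℝ, ℂ) 𝓘(ℝ, ℂ) ∞ (fun x => form x (s x) (t x)) U

variable (F E) in
/-- A holomorphic subbundle of `E`: a family of subspaces of the fibres which is locally spanned by
a holomorphic frame. -/
structure HolSubbundle where
  fiber : ∀ x, Submodule ℂ (E x)
  rank : ℕ
  exists_frame : ∀ x, ∃ U : Set X, IsOpen U ∧ x ∈ U ∧ ∃ e : Fin rank → ∀ y, E y,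
    (∀ i, IsHolSection F U (e i)) ∧
    ∀ y ∈ U, LinearIndependent ℂ (fun i => e i y) ∧
      Submodule.span ℂ (Set.range fun i => e i y) = fiber y

/-- A local holomorphic frame of the subbundle `S` near `x`. -/
def HolSubbundle.frameAt (S : HolSubbundle F E) (x : X) : Fin S.rank → ∀ y, E y :=
  (S.exists_frame x).choose_spec.2.2.choose

/-- The Gram determinant of a local frame `e`, that is, the squared norm of `e₁ ∧ ⋯ ∧ eᵣ`. -/
def HermitianMetric.gramDet (h : HermitianMetric F E) {r : ℕ} (e : Fin r → ∀ y, E y) (y : X) : ℝ :=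
  (Matrix.of fun i j => h.form y (e i y) (e j y)).det.re

/-- The first Chern form `(i/2π) tr F_h` of the Chern connection of the metric induced by `h` on
the subbundle `S`, in the chart `c`. As `tr F_h = ∂̄∂ log det (h(eᵢ,eⱼ))` for any holomorphic frame
`e` and `∂̄∂ u = -(1/4) Δu dz ∧ dz̄`, `dz ∧ dz̄ = -2i dx ∧ dy`, this form is
`-(1/4π) Δ(log det (h(eᵢ,eⱼ))) dx ∧ dy`. The definition is the coefficient of `dx ∧ dy`. -/
def HolSubbundle.chernDensity (S : HolSubbundle F E) (h : HermitianMetric F E)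
    (c : OpenPartialHomeomorph X ℂ) (z : ℂ) : ℝ :=
  -(1 / (4 * Real.pi)) * Laplacian.laplacian
    (fun w : ℂ => Real.log (h.gramDet (S.frameAt (c.symm z)) (c.symm w))) z

/-- The integral over `X` of the first Chern form of `S`, computed with a partition of unity
subordinate to the charts. -/
def HolSubbundle.chernIntegral (S : HolSubbundle F E) (h : HermitianMetric F E)
    (ρ : SmoothPartitionOfUnity X 𝓘(ℝ, ℂ) X Set.univ) : ℝ :=
  ∑ᶠ p : X, ∫ z in (chartAt ℂ p).target,
    ρ p ((chartAt ℂ p).symm z) * S.chernDensity h (chartAt ℂ p) z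

end Bundles

section Existence

variable {X : Type*} [TopologicalSpace X] [ChartedSpace ℂ X] [IsManifold 𝓘(ℂ) ω X]
  [CompactSpace X] [T2Space X]
  {F : Type*} [NormedAddCommGroup F] [NormedSpace ℂ F] [FiniteDimensional ℂ F]
  {E : X → Type*} [TopologicalSpace (Bundle.TotalSpace F E)] [∀ x, TopologicalSpace (E x)]
  [∀ x, AddCommGroup (E x)] [∀ x, Module ℂ (E x)]
  [FiberBundle F E] [VectorBundle ℂ F E] [ContMDiffVectorBundle ω F E 𝓘(ℂ)]

theorem nonempty_hermitianMetric : Nonempty (HermitianMetric F E) := by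
  have := isManifold_real (X := X)
  obtain ⟨ρ, hρ⟩ := SmoothPartitionOfUnity.exists_isSubordinate 𝓘(ℝ, ℂ) (M := X) isClosed_univ
    (fun p : X => (trivializationAt F E p).baseSet)
    (fun p => (trivializationAt F E p).open_baseSet)
    (fun x _ => Set.mem_iUnion_of_mem x (FiberBundle.mem_baseSet_trivializationAt' x))
  have : ContMDiffVectorBundle 1 F E 𝓘(ℂ) := ContMDiffVectorBundle.of_le le_top
  let b := Module.finBasis ℂ F
  let c : X → Fin (Module.finrank ℂ F) → ∀ x, E x →ₗ[ℂ] ℂ := fun p k =>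
    (trivializationAt F E p).localFrameCoeff 𝓘(ℂ) b k
  let B : X → ∀ x, E x → E x → ℂ := fun p x v w => ∑ k, starRingEnd ℂ (c p k x v) * c p k x w
  refine ⟨⟨fun x => LinearMap.mk₂'ₛₗ (starRingEnd ℂ) (RingHom.id ℂ)
    (fun v w => ∑ p ∈ ρ.finsupport x, ρ p x • B p x v w) ?_ ?_ ?_ ?_, ?_, ?_, ?_⟩⟩
  · intro v v' w
    simp only [B, map_add, add_mul, Finset.sum_add_distrib, smul_add]
  · intro a v w
    simp only [B, map_smul, smul_eq_mul, map_mul, Finset.mul_sum, Finset.smul_sum, mul_assoc,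
      mul_smul_comm]
  · intro v w w'
    simp only [B, map_add, mul_add, Finset.sum_add_distrib, smul_add]
  · intro a v w
    simp only [B, map_smul, smul_eq_mul, Finset.mul_sum, Finset.smul_sum, RingHom.id_apply,
      mul_smul_comm, mul_left_comm]
  · intro x v w
    simp [B, mul_comm]
  · intro x v hv
    have hB : ∀ p, 0 ≤ (B p x v v).re := fun p => by
      simp only [B, Complex.re_sum]
      refine Finset.sum_nonneg fun k _ => ?_
      rw [← Complex.normSq_eq_conj_mul_self, Complex.ofReal_re]
      exact Complex.normSq_nonneg _
    obtain ⟨p, hp⟩ := ρ.exists_pos_of_mem (Set.mem_univ x)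
    have hpx : x ∈ (trivializationAt F E p).baseSet :=
      hρ p (subset_tsupport _ (Function.mem_support.2 hp.ne'))
    simp only [LinearMap.mk₂'ₛₗ_apply, Complex.re_sum, Complex.smul_re, smul_eq_mul]
    refine Finset.sum_pos' (fun q _ => mul_nonneg (ρ.nonneg q x) (hB q))
      ⟨p, (ρ.mem_finsupport x).2 (Function.mem_support.2 hp.ne'), mul_pos hp ?_⟩
    refine lt_of_le_of_ne (hB p) fun h0 => hv ?_
    have h1 : ∀ k, c p k x v = 0 := by
      have h2 := h0.symm
      simp only [B, Complex.re_sum] at h2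
      rw [Finset.sum_eq_zero_iff_of_nonneg] at h2
      · intro k
        have := h2 k (Finset.mem_univ k)
        rw [← Complex.normSq_eq_conj_mul_self, Complex.ofReal_re] at this
        exact Complex.normSq_eq_zero.1 this
      · intro k _
        rw [← Complex.normSq_eq_conj_mul_self, Complex.ofReal_re]
        exact Complex.normSq_nonneg _
    classical
    have h3 : ∀ k, ((trivializationAt F E p).basisAt b hpx).repr v k = 0 := fun k => by
      have := (trivializationAt F E p).localFrameCoeff_apply_of_mem_baseSet (I := 𝓘(ℂ)) b hpx
        (fun y => if h : y = x then h ▸ v else 0) k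
      simp only [dite_true] at this
      rw [← this]
      exact h1 k
    exact ((trivializationAt F E p).basisAt b hpx).repr.map_eq_zero_iff.1 (Finsupp.ext h3)
  · intro U s t hU hs ht x hx
    refine ContMDiffAt.contMDiffWithinAt ?_
    simp only [LinearMap.mk₂'ₛₗ_apply]
    have key : (fun x => ∑ p ∈ ρ.finsupport x, ρ p x • B p x (s x) (t x)) =
        fun x => ∑ᶠ p, ρ p x • B p x (s x) (t x) := by
      funext y
      exact ρ.sum_finsupport_smul_eq_finsum y (fun p y => B p y (s y) (t y))
    rw [key]
    refine ρ.contMDiffAt_finsum fun p hp => ?_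
    have hpx : x ∈ (trivializationAt F E p).baseSet := hρ p hp
    have hc : ∀ (u : ∀ x, E x), IsHolSection F U u → ∀ k,
        ContMDiffAt 𝓘(ℝ, ℂ) 𝓘(ℝ, ℂ) ∞ (fun y => c p k y (u y)) x := fun u hu k =>
      contMDiffAt_real (contMDiffAt_localFrameCoeff b hpx (hu.contMDiffAt (hU.mem_nhds hx)) k)
    have hconj : ContMDiff 𝓘(ℝ, ℂ) 𝓘(ℝ, ℂ) ∞ (starRingEnd ℂ) :=
      Complex.conjCLE.contDiff.contMDiff
    have hmul : ContMDiff 𝓘(ℝ, ℂ × ℂ) 𝓘(ℝ, ℂ) ∞ (fun z : ℂ × ℂ => z.1 * z.2) :=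
      (contDiff_fst.mul contDiff_snd).contMDiff
    have hsum := ContMDiffAt.sum (I := 𝓘(ℝ, ℂ)) (t := Finset.univ) (n := ∞) (x₀ := x)
      (f := fun k y => starRingEnd ℂ (c p k y (s y)) * c p k y (t y)) fun k _ =>
        hmul.contMDiffAt.comp x ((hconj.contMDiffAt.comp x (hc s hs k)).prodMk_space (hc t ht k))
    exact hsum

variable (F E) in
/-- A Hermitian metric on `E` (the degree does not depend on the choice). -/
def hermitianMetric : HermitianMetric F E := Classical.choice nonempty_hermitianMetric

/-- The degree of a holomorphic subbundle `S`: the integral of its first Chern form. -/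
def HolSubbundle.degree (S : HolSubbundle F E) : ℝ :=
  S.chernIntegral (hermitianMetric F E) (exists_partition (X := X)).choose

/-- The slope `deg S / rk S`. -/
def HolSubbundle.slope (S : HolSubbundle F E) : ℝ := S.degree / S.rank

variable (F E) in
/-- The whole bundle, as a subbundle of itself. -/
def whole : HolSubbundle F E where
  fiber _ := ⊤
  rank := Module.finrank ℂ F
  exists_frame x := by
    refine ⟨(trivializationAt F E x).baseSet, (trivializationAt F E x).open_baseSet,
      FiberBundle.mem_baseSet_trivializationAt' x,
      (trivializationAt F E x).localFrame (Module.finBasis ℂ F), fun i => ?_, fun y hy => ?_⟩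
    · exact (trivializationAt F E x).contMDiffOn_localFrame_baseSet ω (Module.finBasis ℂ F) i
    · have h := (trivializationAt F E x).isLocalFrameOn_localFrame_baseSet 𝓘(ℂ) ω
        (Module.finBasis ℂ F)
      exact ⟨h.linearIndependent hy, top_le_iff.1 (h.generating hy)⟩

end Existence
section HolomorphicMaps

variable {X : Type*} [TopologicalSpace X] [ChartedSpace ℂ X]
  {F : Type*} [NormedAddCommGroup F] [NormedSpace ℂ F]
  {E : X → Type*} [TopologicalSpace (Bundle.TotalSpace F E)] [∀ x, TopologicalSpace (E x)]
  [∀ x, AddCommGroup (E x)] [∀ x, Module ℂ (E x)] [FiberBundle F E]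
  {F' : Type*} [NormedAddCommGroup F'] [NormedSpace ℂ F']
  {E' : X → Type*} [TopologicalSpace (Bundle.TotalSpace F' E')] [∀ x, TopologicalSpace (E' x)]
  [∀ x, AddCommGroup (E' x)] [∀ x, Module ℂ (E' x)] [FiberBundle F' E']
  {FL : Type*} [NormedAddCommGroup FL] [NormedSpace ℂ FL]
  {L : X → Type*} [TopologicalSpace (Bundle.TotalSpace FL L)] [∀ x, TopologicalSpace (L x)]
  [∀ x, AddCommGroup (L x)] [∀ x, Module ℂ (L x)] [FiberBundle FL L]

variable (F F') in
/-- A fibrewise linear map `E → E'` is holomorphic: it sends holomorphic local sections to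
holomorphic local sections. -/
def IsHolMap (f : ∀ x, E x →ₗ[ℂ] E' x) : Prop :=
  ∀ (U : Set X) (s : ∀ x, E x), IsOpen U → IsHolSection F U s →
    IsHolSection F' U fun x => f x (s x)

variable (F FL) in
/-- `t` is a holomorphic section over `U` of the tensor product bundle `E ⊗ L`: it is locally a
finite sum of tensors of holomorphic sections. -/
def IsHolTensorSection (U : Set X) (t : ∀ x, E x ⊗[ℂ] L x) : Prop :=
  ∀ x ∈ U, ∃ U' : Set X, IsOpen U' ∧ x ∈ U' ∧ ∃ (n : ℕ) (a : Fin n → ∀ y, E y)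
    (l : Fin n → ∀ y, L y), (∀ i, IsHolSection F U' (a i)) ∧ (∀ i, IsHolSection FL U' (l i)) ∧
      ∀ y ∈ U', t y = ∑ i, a i y ⊗ₜ[ℂ] l i y

variable (F F' FL) in
/-- A fibrewise linear map `E → E' ⊗ L` is holomorphic. -/
def IsHolTwistedMap (f : ∀ x, E x →ₗ[ℂ] E' x ⊗[ℂ] L x) : Prop :=
  ∀ (U : Set X) (s : ∀ x, E x), IsOpen U → IsHolSection F U s →
    IsHolTensorSection F' FL U fun x => f x (s x)

variable (F F' E E') in
/-- An isomorphism of holomorphic vector bundles. -/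
structure HolIso where
  equiv : ∀ x, E x ≃ₗ[ℂ] E' x
  hol : IsHolMap F F' fun x => (equiv x).toLinearMap
  hol_symm : IsHolMap F' F fun x => (equiv x).symm.toLinearMap

/-- The twisted map `φ : E → E' ⊗ L` sends the subbundle `S` of `E` into `T ⊗ L`, where `T` is a
subbundle of `E'`. -/
def MapsInto (φ : ∀ x, E x →ₗ[ℂ] E' x ⊗[ℂ] L x) (S : HolSubbundle F E)
    (T : HolSubbundle F' E') : Prop :=
  ∀ x, ∀ v ∈ S.fiber x, φ x v ∈ LinearMap.range ((T.fiber x).subtype.rTensor (L x))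

/-- The subbundle `S` of the Higgs bundle `(E', φ)` is `φ`-invariant and the Higgs bundle
`(S, φ|_S)` is isomorphic to the Higgs bundle `(E, ψ)`, by an isomorphism `g : E → S`. -/
def IsHiggsIsoTo (φ : ∀ x, E' x →ₗ[ℂ] E' x ⊗[ℂ] L x) (S : HolSubbundle F' E')
    (F : Type*) [NormedAddCommGroup F] [NormedSpace ℂ F] {E : X → Type*}
    [TopologicalSpace (Bundle.TotalSpace F E)] [∀ x, TopologicalSpace (E x)]
    [∀ x, AddCommGroup (E x)] [∀ x, Module ℂ (E x)] [FiberBundle F E]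
    (ψ : ∀ x, E x →ₗ[ℂ] E x ⊗[ℂ] L x) : Prop :=
  MapsInto φ S S ∧ ∃ g : ∀ x, E x →ₗ[ℂ] E' x, IsHolMap F F' g ∧
    (∀ x, Function.Injective (g x)) ∧ (∀ x, LinearMap.range (g x) = S.fiber x) ∧
    ∀ x, φ x ∘ₗ g x = (g x).rTensor (L x) ∘ₗ ψ x

end HolomorphicMaps

section Linear

variable {X : Type*} [TopologicalSpace X] [ChartedSpace ℂ X] [IsManifold 𝓘(ℂ) ω X]
  [CompactSpace X] [T2Space X]
  {F : Type*} [NormedAddCommGroup F] [NormedSpace ℂ F] [FiniteDimensional ℂ F]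
  {E : X → Type*} [TopologicalSpace (Bundle.TotalSpace F E)] [∀ x, TopologicalSpace (E x)]
  [∀ x, AddCommGroup (E x)] [∀ x, Module ℂ (E x)]
  [FiberBundle F E] [VectorBundle ℂ F E] [ContMDiffVectorBundle ω F E 𝓘(ℂ)]
  {L : X → Type*} [∀ x, AddCommGroup (L x)] [∀ x, Module ℂ (L x)]

/-- Stability of the `L`-twisted Higgs bundle `(S, φ|_S)`, for a `φ`-invariant subbundle `S` of `E`:
`μ(T) < μ(S)` for all `φ`-invariant subbundles `0 ≠ T ⊊ S`. -/
def IsStableOn (φ : ∀ x, E x →ₗ[ℂ] E x ⊗[ℂ] L x) (S : HolSubbundle F E) : Prop :=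
  ∀ T : HolSubbundle F E, MapsInto φ T T → (∀ x, T.fiber x ≤ S.fiber x) →
    0 < T.rank → T.rank < S.rank → T.slope < S.slope

variable (F) in
/-- Stability of the `L`-twisted `GL(n, ℂ)`-Higgs bundle `(E, φ)`. -/
def IsStable (φ : ∀ x, E x →ₗ[ℂ] E x ⊗[ℂ] L x) : Prop := IsStableOn φ (whole F E)

variable (F) in
/-- Semistability of the `L`-twisted `GL(n, ℂ)`-Higgs bundle `(E, φ)`. -/
def IsSemistable (φ : ∀ x, E x →ₗ[ℂ] E x ⊗[ℂ] L x) : Prop :=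
  ∀ T : HolSubbundle F E, MapsInto φ T T → 0 < T.rank → T.rank < (whole F E).rank →
    T.slope ≤ (whole F E).slope

variable (F) in
/-- Polystability of the `L`-twisted `GL(n, ℂ)`-Higgs bundle `(E, φ)`: it is a direct sum of
(nonzero) stable Higgs bundles of the same slope. -/
def IsPolystable (φ : ∀ x, E x →ₗ[ℂ] E x ⊗[ℂ] L x) : Prop :=
  ∃ (n : ℕ) (S : Fin n → HolSubbundle F E),
    (∀ x, DirectSum.IsInternal fun i => (S i).fiber x) ∧
    (∀ i, 0 < (S i).rank ∧ MapsInto φ (S i) (S i) ∧ IsStableOn φ (S i)) ∧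
    ∀ i j, (S i).slope = (S j).slope

end Linear

section Unitary

variable {X : Type*} [TopologicalSpace X] [ChartedSpace ℂ X] [IsManifold 𝓘(ℂ) ω X]
  [CompactSpace X] [T2Space X]
  {FV : Type*} [NormedAddCommGroup FV] [NormedSpace ℂ FV] [FiniteDimensional ℂ FV]
  {V : X → Type*} [TopologicalSpace (Bundle.TotalSpace FV V)] [∀ x, TopologicalSpace (V x)]
  [∀ x, AddCommGroup (V x)] [∀ x, Module ℂ (V x)]
  [FiberBundle FV V] [VectorBundle ℂ FV V] [ContMDiffVectorBundle ω FV V 𝓘(ℂ)]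
  {FW : Type*} [NormedAddCommGroup FW] [NormedSpace ℂ FW] [FiniteDimensional ℂ FW]
  {W : X → Type*} [TopologicalSpace (Bundle.TotalSpace FW W)] [∀ x, TopologicalSpace (W x)]
  [∀ x, AddCommGroup (W x)] [∀ x, Module ℂ (W x)]
  [FiberBundle FW W] [VectorBundle ℂ FW W] [ContMDiffVectorBundle ω FW W 𝓘(ℂ)]
  {L : X → Type*} [∀ x, AddCommGroup (L x)] [∀ x, Module ℂ (L x)]

/-- The `α`-slope `(deg V' + deg W') / (p' + q') + α p' / (p' + q')` of a pair of subbundles. -/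
def alphaSlope (α : ℝ) (V' : HolSubbundle FV V) (W' : HolSubbundle FW W) : ℝ :=
  (V'.degree + W'.degree) / (V'.rank + W'.rank) + α * (V'.rank / (V'.rank + W'.rank))

/-- `(V', W')` is a subobject of `(V, W, β, γ)`, neither zero nor everything. -/
def IsProperSubobject (β : ∀ x, W x →ₗ[ℂ] V x ⊗[ℂ] L x) (γ : ∀ x, V x →ₗ[ℂ] W x ⊗[ℂ] L x)
    (V' : HolSubbundle FV V) (W' : HolSubbundle FW W) : Prop :=
  MapsInto β W' V' ∧ MapsInto γ V' W' ∧ 0 < V'.rank + W'.rank ∧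
    V'.rank + W'.rank < (whole FV V).rank + (whole FW W).rank

variable (FV FW) in
/-- `α`-semistability of the `L`-twisted `U(p,q)`-Higgs bundle `(V, W, β, γ)`. -/
def IsAlphaSemistable (α : ℝ) (β : ∀ x, W x →ₗ[ℂ] V x ⊗[ℂ] L x)
    (γ : ∀ x, V x →ₗ[ℂ] W x ⊗[ℂ] L x) : Prop :=
  ∀ (V' : HolSubbundle FV V) (W' : HolSubbundle FW W), IsProperSubobject β γ V' W' →
    alphaSlope α V' W' ≤ alphaSlope α (whole FV V) (whole FW W)

variable (FV FW) in
/-- `α`-stability of the `L`-twisted `U(p,q)`-Higgs bundle `(V, W, β, γ)`. -/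
def IsAlphaStable (α : ℝ) (β : ∀ x, W x →ₗ[ℂ] V x ⊗[ℂ] L x)
    (γ : ∀ x, V x →ₗ[ℂ] W x ⊗[ℂ] L x) : Prop :=
  ∀ (V' : HolSubbundle FV V) (W' : HolSubbundle FW W), IsProperSubobject β γ V' W' →
    alphaSlope α V' W' < alphaSlope α (whole FV V) (whole FW W)

/-- The Higgs field `φ(v, w) = (β w, γ v)` on the direct sum bundle `V ⊕ W`. -/
def higgsField (β : ∀ x, W x →ₗ[ℂ] V x ⊗[ℂ] L x) (γ : ∀ x, V x →ₗ[ℂ] W x ⊗[ℂ] L x) (x : X) :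
    (V ×ᵇ W) x →ₗ[ℂ] (V ×ᵇ W) x ⊗[ℂ] L x :=
  (LinearMap.inl ℂ (V x) (W x)).rTensor (L x) ∘ₗ β x ∘ₗ LinearMap.snd ℂ (V x) (W x) +
    (LinearMap.inr ℂ (V x) (W x)).rTensor (L x) ∘ₗ γ x ∘ₗ LinearMap.fst ℂ (V x) (W x)

end Unitary

end Higgs

end

open scoped Topology
open Filter MeasureTheory

noncomputable section

set_option linter.unusedSectionVars false

namespace Higgs

/-! ### Laplacians in the plane and the estimate at a zero -/

section Plane

/-! Let `T` be an invariant subbundle of `V ⊕ W`. The saturations `V₁`, `W₁` of its projections form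
a subobject of `E`, and so do its generic intersections `V₂`, `W₂` with the summands, because the
Higgs field interchanges the summands. Projecting `T` to `V` and to `W` gives `rk T = rk V₁ + rk W₂
= rk W₁ + rk V₂`, and `deg T` is at most `deg V₁ + deg W₂` and at most `deg W₁ + deg V₂`. Adding the
`α`-semistability inequalities of the two subobjects yields `2 deg T + α (rk V₁ - rk W₁) ≤ 2 μ rk
T`, with `μ` the slope of `V ⊕ W`. It remains to see that `α (rk V₁ - rk W₁) ≥ 0`.

For `0 ≤ α < α₀` this holds because `β` is generically injective. Let `N` be its kernel, of rank
`n`, and `I` its saturated image. Then `(0, N)` and `(I, W)` are subobjects; their inequalities,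
together with `deg W ≤ deg N + deg I + (p - n) d`, contradict `α < α₀` as soon as `n ≥ 1`. This is
`IsAlphaSemistable.rank_le`. The negative range follows by exchanging `V` and `W`.

If `E` is `α`-stable and `T` violates stability, all these inequalities are equalities. The two
subobjects are then everything and zero, so `T` has rank `p`, and equality of degrees makes both
projections isomorphisms at every point, not only generically. Hence `T` is the graph of an
isomorphism `f : V → W`, and its invariance is the relation `β f = f⁻¹ γ`. Conversely such an `f`
gives the invariant graphs of `f` and `-f`, which are complementary. An invariant subbundle of one
of them is isomorphic to both its projections, which form a subobject of `α`-slope `μ(T) + α / 2`,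
so each graph is stable, whatever `α` is.

Degrees are integrals of curvature, so the facts used about them need analysis. All reduce to one
principle (`LineHom.deg_le`, `LineHom.deg_eq`, `LineHom.deg_lt`): a generically nonzero morphism `M
→ N` of line bundles gives `deg M ≤ deg N`, with equality if it has no zero and strict inequality if
it has one. If `q` is its squared norm, the Laplacian of the global function `log (q + ε)`
integrates to zero. This Laplacian is the curvature difference damped by `q / (q + ε)`, plus a
nonnegative gradient term. The damped part converges as `ε → 0`, and near a zero the gradient term
keeps a mass bounded below. The principle is applied to the determinant `det S → det K ⊗ det T ⊗ L ^
rk T` of a map `S → T ⊗ L` with generic kernel `K` (`TwistedMap.exists_lineHom`). -/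

theorem laplacian_eq_fderiv (f : ℂ → ℝ) (z : ℂ) : Laplacian.laplacian f z =
    fderiv ℝ (fderiv ℝ f) z 1 1 + fderiv ℝ (fderiv ℝ f) z Complex.I Complex.I := by
  rw [InnerProductSpace.laplacian_eq_iteratedFDeriv_complexPlane]
  simp [iteratedFDeriv_two_apply]

theorem continuousAt_laplacian {f : ℂ → ℝ} {z : ℂ} (hf : ContDiffAt ℝ 2 f z) :
    ContinuousAt (Laplacian.laplacian f) z := by
  have h : ContinuousAt (fderiv ℝ (fderiv ℝ f)) z :=
    ((hf.fderiv_right (m := 1) (by norm_num)).fderiv_right (m := 0) (by norm_num)).continuousAt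
  simp only [funext (laplacian_eq_fderiv f)]
  fun_prop

theorem laplacian_sum {ι : Type*} (s : Finset ι) {f : ι → ℂ → ℝ} {z : ℂ}
    (hf : ∀ i ∈ s, ContDiffAt ℝ 2 (f i) z) :
    Laplacian.laplacian (fun y => ∑ i ∈ s, f i y) z = ∑ i ∈ s, Laplacian.laplacian (f i) z := by
  classical
  induction s using Finset.induction_on with
  | empty => simp
  | insert a s ha ih =>
    have h1 : (fun y => ∑ i ∈ insert a s, f i y) = f a + fun y => ∑ i ∈ s, f i y := by
      funext y; simp [ha]
    rw [h1, ContDiffAt.laplacian_add (hf a (by simp)) (ContDiffAt.sum fun i hi =>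
      hf i (by simp [hi])), ih fun i hi => hf i (by simp [hi]), Finset.sum_insert ha]

/-- The second derivative of `f ∘ τ` along `v` is `D²f (τ' v, τ' v) + Df (τ'' v²)`. Summed over `v =
1` and `v = I`, the last terms cancel since `I² = -1`. The factor left over is the Jacobian of `τ`,
which is why `Δu dx ∧ dy` does not depend on the coordinate. -/
theorem laplacian_comp_analytic {f : ℂ → ℝ} {τ : ℂ → ℂ} {z : ℂ} (hf : ContDiffAt ℝ 2 f (τ z))
    (hτ : AnalyticAt ℂ τ z) :
    Laplacian.laplacian (f ∘ τ) z = ‖deriv τ z‖ ^ 2 * Laplacian.laplacian f (τ z) := by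
  have hd : ∀ᶠ w in 𝓝 z, ∀ v, fderiv ℝ (f ∘ τ) w v = fderiv ℝ f (τ w) (deriv τ w * v) := by
    have h1 : ∀ᶠ w in 𝓝 z, ContDiffAt ℝ 2 f (τ w) :=
      hτ.continuousAt.eventually (hf.eventually (by simp))
    filter_upwards [h1, hτ.eventually_analyticAt] with w hw1 hw2 v
    have h2 : HasFDerivAt τ ((ContinuousLinearMap.toSpanSingleton ℂ (deriv τ w)).restrictScalars ℝ) w :=
      hw2.differentiableAt.hasDerivAt.hasFDerivAt.restrictScalars ℝ
    rw [((hw1.differentiableAt (by simp)).hasFDerivAt.comp w h2).fderiv]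
    simp [mul_comm]
  have hD : ∀ v, fderiv ℝ (fderiv ℝ (f ∘ τ)) z v v =
      fderiv ℝ (fderiv ℝ f) (τ z) (deriv τ z * v) (deriv τ z * v) +
        fderiv ℝ f (τ z) (deriv (deriv τ) z * v * v) := by
    intro v
    have hc : ContDiffAt ℝ 2 (f ∘ τ) z := hf.comp z (hτ.contDiffAt.restrict_scalars ℝ)
    have h3 : fderiv ℝ (fderiv ℝ (f ∘ τ)) z v v = fderiv ℝ (fun w => fderiv ℝ (f ∘ τ) w v) z v := by
      rw [fderiv_clm_apply ((hc.fderiv_right (m := 1) (by norm_num)).differentiableAt (by simp))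
        (by fun_prop)]
      simp
    have h4 : (fun w => fderiv ℝ (f ∘ τ) w v) =ᶠ[𝓝 z]
        fun w => fderiv ℝ f (τ w) (deriv τ w * v) := by
      filter_upwards [hd] with w hw using hw v
    rw [h3, h4.fderiv_eq]
    have h5 : HasFDerivAt τ ((ContinuousLinearMap.toSpanSingleton ℂ (deriv τ z)).restrictScalars ℝ) z :=
      hτ.differentiableAt.hasDerivAt.hasFDerivAt.restrictScalars ℝ
    have h6 : HasFDerivAt (deriv τ)
      ((ContinuousLinearMap.toSpanSingleton ℂ (deriv (deriv τ) z)).restrictScalars ℝ) z :=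
      hτ.deriv.differentiableAt.hasDerivAt.hasFDerivAt.restrictScalars ℝ
    have h7 := ((hf.fderiv_right (m := 1) (by norm_num)).differentiableAt
      (by simp)).hasFDerivAt.comp z h5
    have h8 := h7.clm_apply (h6.mul_const v)
    rw [show (fun w => fderiv ℝ f (τ w) (deriv τ w * v)) =
      fun y => ((fderiv ℝ f ∘ τ) y) (deriv τ y * v) from rfl, h8.fderiv]
    simp [mul_comm, add_comm]
  rw [laplacian_eq_fderiv, laplacian_eq_fderiv, hD, hD]
  set B := fderiv ℝ (fderiv ℝ f) (τ z)
  set l := fderiv ℝ f (τ z)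
  have e1 : deriv (deriv τ) z * Complex.I * Complex.I = -deriv (deriv τ) z := by
    rw [mul_assoc, Complex.I_mul_I]; ring
  rw [e1]
  set t := deriv τ z
  have ht : t = t.re • (1 : ℂ) + t.im • Complex.I := by
    simp [Complex.re_add_im]
  have hre : (t.re • (1 : ℂ) + t.im • Complex.I).re = t.re := by simp
  have him : (t.re • (1 : ℂ) + t.im • Complex.I).im = t.im := by simp
  have ht' : t * Complex.I = (-t.im) • (1 : ℂ) + t.re • Complex.I := by
    conv_lhs => rw [ht]
    simp only [Complex.real_smul, add_mul, mul_assoc, Complex.I_mul_I]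
    push_cast
    ring
  rw [ht', mul_one, mul_one, ← Complex.normSq_eq_norm_sq, Complex.normSq_apply]
  rw [show B t t = B (t.re • (1 : ℂ) + t.im • Complex.I) (t.re • (1 : ℂ) + t.im • Complex.I) by
    rw [← ht]]
  simp only [map_add, map_smul, add_apply, smul_apply, smul_eq_mul, map_neg, mul_one]
  ring

theorem laplacian_comp_real {F : ℝ → ℝ} {w : ℂ → ℝ} {z : ℂ} (hF : ContDiffAt ℝ 2 F (w z))
    (hw : ContDiffAt ℝ 2 w z) :
    Laplacian.laplacian (fun y => F (w y)) z = deriv F (w z) * Laplacian.laplacian w z +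
      deriv (deriv F) (w z) * (fderiv ℝ w z 1 ^ 2 + fderiv ℝ w z Complex.I ^ 2) := by
  have hd : fderiv ℝ (fun y => F (w y)) =ᶠ[𝓝 z] fun y => deriv F (w y) • fderiv ℝ w y := by
    have h1 : ∀ᶠ y in 𝓝 z, ContDiffAt ℝ 2 F (w y) :=
      hw.continuousAt.eventually (hF.eventually (by simp))
    filter_upwards [h1, hw.eventually (by simp)] with y h1 h2
    exact ((h1.differentiableAt (by simp)).hasDerivAt.comp_hasFDerivAt y
      (h2.differentiableAt (by simp)).hasFDerivAt).fderiv
  have hD : fderiv ℝ (fderiv ℝ fun y => F (w y)) z = deriv F (w z) • fderiv ℝ (fderiv ℝ w) z +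
      (deriv (deriv F) (w z) • fderiv ℝ w z).smulRight (fderiv ℝ w z) := by
    rw [hd.fderiv_eq]
    have h3 : DifferentiableAt ℝ (deriv F) (w z) :=
      ((ContDiffAt.fderiv_right (m := 1) hF (by norm_num)).differentiableAt (by simp)).clm_apply
        (differentiableAt_const (1 : ℝ))
    have h4 := (h3.hasDerivAt.comp_hasFDerivAt z (hw.differentiableAt (by simp)).hasFDerivAt)
    have h5 := ((hw.fderiv_right (m := 1) (by norm_num)).differentiableAt (by simp)).hasFDerivAt
    exact (h4.smul h5).fderiv
  rw [laplacian_eq_fderiv, laplacian_eq_fderiv, hD]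
  simp
  ring

/-- To be used with `w = log q`. The sign of the gradient term is what makes degrees increase along
morphisms. -/
theorem laplacian_log_exp_add {ε : ℝ} (hε : 0 < ε) {w : ℂ → ℝ} {z : ℂ} (hw : ContDiffAt ℝ 2 w z) :
    Laplacian.laplacian (fun y => Real.log (Real.exp (w y) + ε)) z =
      Real.exp (w z) / (Real.exp (w z) + ε) * Laplacian.laplacian w z +
      ε * Real.exp (w z) / (Real.exp (w z) + ε) ^ 2 *
        (fderiv ℝ w z 1 ^ 2 + fderiv ℝ w z Complex.I ^ 2) := by
  have hp : ∀ s, Real.exp s + ε ≠ 0 := fun s => (add_pos (Real.exp_pos s) hε).ne'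
  have h1 : deriv (fun s => Real.log (Real.exp s + ε)) = fun s => Real.exp s / (Real.exp s + ε) := by
    funext s
    exact (((Real.hasDerivAt_exp s).add_const ε).log (hp s)).deriv
  have h2 : ContDiffAt ℝ 2 (fun s => Real.log (Real.exp s + ε)) (w z) :=
    ContDiffAt.log (by fun_prop) (hp _)
  rw [laplacian_comp_real h2 hw, h1]
  have h3 : deriv (fun s => Real.exp s / (Real.exp s + ε)) (w z) =
      ε * Real.exp (w z) / (Real.exp (w z) + ε) ^ 2 := by
    have h := (Real.hasDerivAt_exp (w z)).div ((Real.hasDerivAt_exp (w z)).add_const ε) (hp _)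
    rw [show (fun s => Real.exp s / (Real.exp s + ε)) = Real.exp / fun s => Real.exp s + ε from rfl,
      h.deriv]
    ring
  rw [h3]

/-- Harmonicity of `log ‖u‖²` makes curvature independent of the holomorphic frame. -/
theorem laplacian_log_norm_sq {u : ℂ → ℂ} {z : ℂ} (hu : AnalyticAt ℂ u z) (h0 : u z ≠ 0) :
    ContDiffAt ℝ 2 (fun y => Real.log (‖u y‖ ^ 2)) z ∧
      Laplacian.laplacian (fun y => Real.log (‖u y‖ ^ 2)) z = 0 := by
  have h := (hu.harmonicAt_log_norm h0).const_smul (c := (2 : ℝ))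
  have e : (fun y => Real.log (‖u y‖ ^ 2)) = (2 : ℝ) • fun y => Real.log ‖u y‖ := by
    funext y; simp [Real.log_pow]
  rw [e]
  exact ⟨h.1, h.2.self_of_nhds⟩

/-- Integration by parts against the constant `1`. -/
theorem integral_fderiv_eq_zero {f : ℂ → ℝ} (hf : ContDiff ℝ 1 f) (hc : HasCompactSupport f)
    (v : ℂ) : ∫ z, fderiv ℝ f z v = 0 := by
  have h := integral_mul_fderiv_eq_neg_fderiv_mul_of_integrable (μ := (volume : Measure ℂ))
    (f := fun _ : ℂ => (1 : ℝ)) (g := f) (v := v) (𝕜 := ℝ) (by simp)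
    (by
      have hd : Continuous fun z => fderiv ℝ f z v :=
        (hf.continuous_fderiv (by simp)).clm_apply continuous_const
      simpa using hd.integrable_of_hasCompactSupport (hc.fderiv_apply (𝕜 := ℝ) v))
    (by simpa using hf.continuous.integrable_of_hasCompactSupport hc) (by fun_prop)
    (fun x _ => hf.differentiable (by simp) x)
  simpa using h

theorem integral_laplacian_eq_zero {f : ℂ → ℝ} (hf : ContDiff ℝ 2 f) (hc : HasCompactSupport f) :
    ∫ z, Laplacian.laplacian f z = 0 := by
  have hd : ContDiff ℝ 1 (fderiv ℝ f) := hf.fderiv_right (by norm_num)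
  have hv : ∀ v, ContDiff ℝ 1 fun z => fderiv ℝ f z v := fun v => hd.clm_apply contDiff_const
  have hcv : ∀ v, HasCompactSupport fun z => fderiv ℝ f z v := fun v => hc.fderiv_apply (𝕜 := ℝ) v
  have e : ∀ v z, fderiv ℝ (fderiv ℝ f) z v v = fderiv ℝ (fun y => fderiv ℝ f y v) z v := by
    intro v z
    rw [fderiv_clm_apply (hd.differentiable (by simp) z) (by fun_prop)]
    simp
  have hi : ∀ v, Integrable fun z => fderiv ℝ (fun y => fderiv ℝ f y v) z v := fun v =>
    (((hv v).continuous_fderiv (by simp)).clm_apply continuous_const).integrable_of_hasCompactSupport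
      ((hcv v).fderiv_apply (𝕜 := ℝ) v)
  simp only [laplacian_eq_fderiv, e]
  rw [integral_add (hi 1) (hi _), integral_fderiv_eq_zero (hv _) (hcv _),
    integral_fderiv_eq_zero (hv _) (hcv _), add_zero]

/-- The squared Euclidean norm of the gradient. -/
def gradSq (w : ℂ → ℝ) (z : ℂ) : ℝ := fderiv ℝ w z 1 ^ 2 + fderiv ℝ w z Complex.I ^ 2

theorem gradSq_nonneg (w : ℂ → ℝ) (z : ℂ) : 0 ≤ gradSq w z := by
  unfold gradSq; positivity

theorem gradSq_congr {w w' : ℂ → ℝ} {z : ℂ} (h : w =ᶠ[𝓝 z] w') : gradSq w z = gradSq w' z := by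
  unfold gradSq; rw [h.fderiv_eq]

theorem log_norm_sq_mul_exp {q ψ : ℂ → ℝ} {D : ℂ → ℂ} {z : ℂ} (hD : AnalyticAt ℂ D z)
    (h0 : D z ≠ 0) (hq : ∀ᶠ y in 𝓝 z, q y = ‖D y‖ ^ 2 * Real.exp (ψ y)) :
    ∀ᶠ y in 𝓝 z, 0 < q y ∧ Real.log (q y) = Real.log (‖D y‖ ^ 2) + ψ y := by
  filter_upwards [hq, hD.continuousAt.eventually_ne h0] with y hy hy0
  have : 0 < ‖D y‖ ^ 2 := by positivity
  rw [hy, Real.log_mul this.ne' (Real.exp_pos _).ne', Real.log_exp]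
  exact ⟨mul_pos this (Real.exp_pos _), rfl⟩

/-- Here `q` stands for the squared norm of a morphism of line bundles, `D` for its local
coefficient and `ψ` for the difference of the metric weights; the harmonic part `log ‖D‖²` drops
out. -/
theorem laplacian_log_of_eq {q ψ : ℂ → ℝ} {D : ℂ → ℂ} {z : ℂ} (hD : AnalyticAt ℂ D z)
    (h0 : D z ≠ 0) (hψ : ContDiffAt ℝ 2 ψ z)
    (hq : ∀ᶠ y in 𝓝 z, q y = ‖D y‖ ^ 2 * Real.exp (ψ y)) :
    ContDiffAt ℝ 2 (fun y => Real.log (q y)) z ∧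
      Laplacian.laplacian (fun y => Real.log (q y)) z = Laplacian.laplacian ψ z := by
  have h1 : (fun y => Real.log (q y)) =ᶠ[𝓝 z] (fun y => Real.log (‖D y‖ ^ 2)) + ψ :=
    (log_norm_sq_mul_exp hD h0 hq).mono fun y hy => hy.2
  obtain ⟨h2, h3⟩ := laplacian_log_norm_sq hD h0
  refine ⟨(h2.add hψ).congr_of_eventuallyEq h1, ?_⟩
  rw [(InnerProductSpace.laplacian_congr_nhds h1).self_of_nhds, h2.laplacian_add hψ, h3, zero_add]

theorem laplacian_log_add {q ψ : ℂ → ℝ} {D : ℂ → ℂ} {z : ℂ} {ε : ℝ} (hε : 0 < ε)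
    (hD : AnalyticAt ℂ D z) (h0 : D z ≠ 0) (hψ : ContDiffAt ℝ 2 ψ z)
    (hq : ∀ᶠ y in 𝓝 z, q y = ‖D y‖ ^ 2 * Real.exp (ψ y)) :
    Laplacian.laplacian (fun y => Real.log (q y + ε)) z =
      q z / (q z + ε) * Laplacian.laplacian ψ z +
      ε * q z / (q z + ε) ^ 2 * gradSq (fun y => Real.log (q y)) z := by
  obtain ⟨h1, h2⟩ := laplacian_log_of_eq hD h0 hψ hq
  have h3 := log_norm_sq_mul_exp hD h0 hq
  have h4 : (fun y => Real.log (q y + ε)) =ᶠ[𝓝 z]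
      fun y => Real.log (Real.exp (Real.log (q y)) + ε) :=
    h3.mono fun y hy => by simp only [Real.exp_log hy.1]
  rw [(InnerProductSpace.laplacian_congr_nhds h4).self_of_nhds, laplacian_log_exp_add hε h1, h2,
    Real.exp_log h3.self_of_nhds.1, gradSq]

/-- The vector bounded below is the gradient of `m log (x² + y²) + θ`, where `(a, b)` is the
gradient of `θ`. Its scalar product with `(x, y)` is at least `2m - m`, and Cauchy–Schwarz
concludes. -/
theorem gradient_lower_bound {x y a b C m : ℝ} (hm : 0 < m) (hρ : 0 < x ^ 2 + y ^ 2)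
    (ha : |a| ≤ C) (hb : |b| ≤ C) (h : C * (|x| + |y|) ≤ m) :
    m ^ 2 / (x ^ 2 + y ^ 2) ≤ (m * (2 * x / (x ^ 2 + y ^ 2)) + a) ^ 2 +
      (m * (2 * y / (x ^ 2 + y ^ 2)) + b) ^ 2 := by
  set P := m * (2 * x / (x ^ 2 + y ^ 2)) + a with hP
  set Q := m * (2 * y / (x ^ 2 + y ^ 2)) + b with hQ
  have h1 : P * x + Q * y = 2 * m + (a * x + b * y) := by
    rw [hP, hQ]; field_simp; ring
  have h2 : |a * x + b * y| ≤ m := by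
    refine (abs_add_le _ _).trans (le_trans ?_ h)
    rw [abs_mul, abs_mul, mul_add]
    gcongr
  have h3 : m ≤ P * x + Q * y := by rw [h1]; linarith [(abs_le.1 h2).1]
  have h4 : m ^ 2 ≤ (P * x + Q * y) ^ 2 := by gcongr
  rw [div_le_iff₀ hρ]
  nlinarith [sq_nonneg (P * y - Q * x)]

/-- For a zero of order `m` and `ε = r ^ (2 * m)`, both `q` and `ε` have size `r ^ (2 * m)` at
distance about `r` from the zero, so the coefficient of the gradient term is bounded below while the
squared gradient grows like `1 / r²`. The disc lies in the annulus `r < ‖z - z₀‖ < 2 r` and has area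
`π r² / 4`, so the integral over it stays away from zero as `r` shrinks. -/
theorem exists_annulus_bound {q ψ : ℂ → ℝ} {D : ℂ → ℂ} {z₀ : ℂ} (hD : AnalyticAt ℂ D z₀)
    (h0 : D z₀ = 0) (hne : ¬ ∀ᶠ z in 𝓝 z₀, D z = 0) (hψ : ContDiffAt ℝ 2 ψ z₀)
    (hq : ∀ᶠ y in 𝓝 z₀, q y = ‖D y‖ ^ 2 * Real.exp (ψ y)) :
    ∃ (m : ℕ) (c : ℝ), 0 < m ∧ 0 < c ∧ ∀ᶠ r in 𝓝[>] (0 : ℝ),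
      ∀ z ∈ Metric.ball (z₀ + (3 / 2 * r : ℝ)) (r / 2), c / r ^ 2 ≤
        r ^ (2 * m) * q z / (q z + r ^ (2 * m)) ^ 2 * gradSq (fun y => Real.log (q y)) z := by
  obtain ⟨m, g, hg, hg0, hDg⟩ := hD.exists_eventuallyEq_pow_smul_nonzero_iff.2 hne
  have hm : 0 < m := by
    rcases Nat.eq_zero_or_pos m with rfl | h
    · have := hDg.self_of_nhds
      simp [h0] at this
      exact absurd this.symm hg0
    · exact h
  obtain ⟨hθ1, -⟩ := laplacian_log_norm_sq hg hg0
  -- Near `z₀` one has `q = ‖y - z₀‖ ^ (2 * m) * exp θ` with `θ` regular: the unit part of `D` is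
  -- absorbed into the weight.
  set θ : ℂ → ℝ := fun y => Real.log (‖g y‖ ^ 2) + ψ y with hθ
  have hθc : ContDiffAt ℝ 2 θ z₀ := hθ1.add hψ
  set C := ‖fderiv ℝ θ z₀‖ + 1 with hC
  have hCpos : 0 < C := by positivity
  set k0 := Real.exp (θ z₀ - 1)
  set k1 := Real.exp (θ z₀ + 1)
  have hev : ∀ᶠ z in 𝓝 z₀, (∀ᶠ y in 𝓝 z, q y = ‖y - z₀‖ ^ (2 * m) * Real.exp (θ y)) ∧
      DifferentiableAt ℝ θ z ∧ ‖fderiv ℝ θ z‖ < C ∧ θ z₀ - 1 < θ z ∧ θ z < θ z₀ + 1 ∧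
      C * (2 * ‖z - z₀‖) < m := by
    have e1 : ∀ᶠ y in 𝓝 z₀, q y = ‖y - z₀‖ ^ (2 * m) * Real.exp (θ y) := by
      filter_upwards [hq, hDg, hg.continuousAt.eventually_ne hg0] with y h1 h2 h3
      rw [h1, h2, hθ, Real.exp_add, Real.exp_log (by positivity)]
      simp only [norm_smul, norm_pow, pow_mul', mul_pow]
      ring
    have hc : ContinuousAt (fun z => ‖fderiv ℝ θ z‖) z₀ :=
      ((hθc.fderiv_right (m := 1) (by norm_num)).continuousAt).norm
    have hc2 : ContinuousAt (fun z => C * (2 * ‖z - z₀‖)) z₀ := by fun_prop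
    filter_upwards [e1.eventually_nhds, hθc.eventually (by simp),
      hc.eventually_lt_const (lt_add_one _), hθc.continuousAt.eventually_const_lt (sub_one_lt _),
      hθc.continuousAt.eventually_lt_const (lt_add_one _),
      hc2.eventually_lt_const (u := (m : ℝ)) (by simpa using hm)] with z h1 h2 h3 h4 h5 h6
    exact ⟨h1, h2.differentiableAt (by simp), h3, h4, h5, h6⟩
  obtain ⟨R, hR, hball⟩ := Metric.eventually_nhds_iff.1 hev
  -- The first factor bounds the coefficient, since `q` lies between `k0 r ^ (2 * m)` and `4 ^ m k1
  -- r ^ (2 * m)`; the second comes from `m² / ‖z - z₀‖²` and `‖z - z₀‖ < 2 r`.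
  refine ⟨m, k0 / (1 + 4 ^ m * k1) ^ 2 * (m ^ 2 / 4), hm, by positivity, ?_⟩
  filter_upwards [Ioo_mem_nhdsGT (show (0 : ℝ) < R / 2 by positivity)] with r hr z hz
  have hr0 : 0 < r := hr.1
  have hup : ‖z - z₀‖ < 2 * r := by
    have h1 : ‖z - (z₀ + (3 / 2 * r : ℝ))‖ < r / 2 := by simpa [dist_eq_norm] using hz
    have h2 : ‖((3 / 2 * r : ℝ) : ℂ)‖ = 3 / 2 * r := by
      rw [Complex.norm_real, Real.norm_of_nonneg (by positivity)]
    have h3 := norm_add_le (z - (z₀ + (3 / 2 * r : ℝ))) ((3 / 2 * r : ℝ) : ℂ)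
    rw [show z - (z₀ + (3 / 2 * r : ℝ)) + ((3 / 2 * r : ℝ) : ℂ) = z - z₀ by ring] at h3
    linarith
  have hlo : r < ‖z - z₀‖ := by
    have h1 : ‖z - (z₀ + (3 / 2 * r : ℝ))‖ < r / 2 := by simpa [dist_eq_norm] using hz
    have h2 : ‖((3 / 2 * r : ℝ) : ℂ)‖ = 3 / 2 * r := by
      rw [Complex.norm_real, Real.norm_of_nonneg (by positivity)]
    have h3 := norm_sub_le (z - z₀) (z - (z₀ + (3 / 2 * r : ℝ)))
    rw [show z - z₀ - (z - (z₀ + (3 / 2 * r : ℝ))) = ((3 / 2 * r : ℝ) : ℂ) by ring] at h3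
    linarith
  have hzpos : 0 < ‖z - z₀‖ := hr0.trans hlo
  obtain ⟨e1, e2, e3, e4, e5, e6⟩ := hball (y := z) (by rw [dist_eq_norm]; linarith [hr.2])
  have hqz := e1.self_of_nhds
  have hgrad : m ^ 2 / 4 / r ^ 2 ≤ gradSq (fun y => Real.log (q y)) z := by
    have hne : z - z₀ ≠ 0 := norm_pos_iff.1 hzpos
    have h1 : (fun y => Real.log (q y)) =ᶠ[𝓝 z]
        fun y => m * Real.log ((y - z₀).re ^ 2 + (y - z₀).im ^ 2) + θ y := by
      have hne' : ∀ᶠ y in 𝓝 z, y - z₀ ≠ 0 :=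
        ContinuousAt.eventually_ne (by fun_prop) hne
      filter_upwards [e1, hne'] with y hy hy0
      have : 0 < ‖y - z₀‖ := norm_pos_iff.2 hy0
      rw [hy, Real.log_mul (by positivity) (by positivity), Real.log_exp, pow_mul, Real.log_pow,
        ← Complex.normSq_eq_norm_sq, Complex.normSq_apply]
      ring_nf
    have hn : (z - z₀).re ^ 2 + (z - z₀).im ^ 2 = ‖z - z₀‖ ^ 2 := by
      rw [← Complex.normSq_eq_norm_sq, Complex.normSq_apply]; ring
    have hnpos : 0 < (z - z₀).re ^ 2 + (z - z₀).im ^ 2 := by rw [hn]; positivity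
    have hre : HasFDerivAt (fun y : ℂ => (y - z₀).re) Complex.reCLM z := by
      simpa using (Complex.reCLM.hasFDerivAt (x := z)).sub_const z₀.re
    have him : HasFDerivAt (fun y : ℂ => (y - z₀).im) Complex.imCLM z := by
      simpa using (Complex.imCLM.hasFDerivAt (x := z)).sub_const z₀.im
    have h2 := ((((hre.pow 2).add (him.pow 2)).log hnpos.ne').const_mul (m : ℝ)).add
      e2.hasFDerivAt
    have hb : ∀ v : ℂ, ‖v‖ = 1 → |fderiv ℝ θ z v| ≤ C := fun v hv => by
      have := (fderiv ℝ θ z).le_opNorm v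
      rw [hv, mul_one] at this
      exact this.trans e3.le
    have h3 := gradient_lower_bound (x := (z - z₀).re) (y := (z - z₀).im) (m := m)
      (by exact_mod_cast hm) hnpos (hb 1 (by simp)) (hb Complex.I (by simp))
      (by
        refine le_trans ?_ e6.le
        have := Complex.abs_re_le_norm (z - z₀)
        have := Complex.abs_im_le_norm (z - z₀)
        gcongr
        linarith)
    have h4 : HasFDerivAt (fun y => m * Real.log ((y - z₀).re ^ 2 + (y - z₀).im ^ 2) + θ y) _ z := h2
    rw [gradSq_congr h1, gradSq, h4.fderiv]
    refine le_trans ?_ (h3.trans (le_of_eq ?_))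
    · rw [hn, div_div]
      gcongr
      nlinarith
    · simp
      ring
  have hcoef : k0 / (1 + 4 ^ m * k1) ^ 2 ≤
      r ^ (2 * m) * q z / (q z + r ^ (2 * m)) ^ 2 := by
    have hp : 0 < r ^ (2 * m) := by positivity
    have hk0 : k0 ≤ Real.exp (θ z) := Real.exp_le_exp.2 e4.le
    have hk1 : Real.exp (θ z) ≤ k1 := Real.exp_le_exp.2 e5.le
    have hq0 : r ^ (2 * m) * k0 ≤ q z := by
      rw [hqz]; gcongr
    have hq1 : q z ≤ r ^ (2 * m) * (4 ^ m * k1) := by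
      rw [hqz, ← mul_assoc]
      have : ‖z - z₀‖ ^ (2 * m) ≤ r ^ (2 * m) * 4 ^ m := by
        calc ‖z - z₀‖ ^ (2 * m) ≤ (2 * r) ^ (2 * m) := by gcongr
          _ = r ^ (2 * m) * 4 ^ m := by rw [mul_pow, pow_mul 2]; norm_num; ring
      gcongr
    have hqpos : 0 < q z := lt_of_lt_of_le (by positivity) hq0
    calc k0 / (1 + 4 ^ m * k1) ^ 2
        = r ^ (2 * m) * (r ^ (2 * m) * k0) /
          (r ^ (2 * m) * (4 ^ m * k1) + r ^ (2 * m)) ^ 2 := by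
          field_simp
          ring
      _ ≤ r ^ (2 * m) * q z / (q z + r ^ (2 * m)) ^ 2 := by
          gcongr
  calc k0 / (1 + 4 ^ m * k1) ^ 2 * (m ^ 2 / 4) / r ^ 2
      = k0 / (1 + 4 ^ m * k1) ^ 2 * (m ^ 2 / 4 / r ^ 2) := by ring
    _ ≤ _ := mul_le_mul hcoef hgrad (by positivity) (le_trans (by positivity) hcoef)

end Plane

/-! ### Holomorphic functions on a Riemann surface -/

section Charts

variable {X : Type*} [TopologicalSpace X] [ChartedSpace ℂ X]

/-- `f` is holomorphic at `x`. -/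
def HolAt (f : X → ℂ) (x : X) : Prop := ContMDiffAt 𝓘(ℂ) 𝓘(ℂ) ω f x

theorem HolAt.continuousAt {f : X → ℂ} {x : X} (hf : HolAt f x) : ContinuousAt f x :=
  ContMDiffAt.continuousAt hf

theorem HolAt.congr {f g : X → ℂ} {x : X} (hf : HolAt f x) (h : g =ᶠ[𝓝 x] f) : HolAt g x :=
  ContMDiffAt.congr_of_eventuallyEq hf h

theorem HolAt.eventually [IsManifold 𝓘(ℂ) ω X] {f : X → ℂ} {x : X} (hf : HolAt f x) :
    ∀ᶠ y in 𝓝 x, HolAt f y :=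
  (contMDiffAt_iff_contMDiffAt_nhds (by simp)).1 hf

theorem holAt_const (c : ℂ) (x : X) : HolAt (fun _ : X => c) x := contMDiffAt_const

theorem HolAt.add {f g : X → ℂ} {x : X} (hf : HolAt f x) (hg : HolAt g x) :
    HolAt (fun y => f y + g y) x := ContMDiffAt.add hf hg

theorem HolAt.mul {f g : X → ℂ} {x : X} (hf : HolAt f x) (hg : HolAt g x) :
    HolAt (fun y => f y * g y) x := ContMDiffAt.mul hf hg

theorem HolAt.sum {ι : Type*} {s : Finset ι} {f : ι → X → ℂ} {x : X}
    (hf : ∀ i ∈ s, HolAt (f i) x) : HolAt (fun y => ∑ i ∈ s, f i y) x := by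
  exact ContMDiffAt.sum hf

theorem HolAt.prod {ι : Type*} {s : Finset ι} {f : ι → X → ℂ} {x : X}
    (hf : ∀ i ∈ s, HolAt (f i) x) : HolAt (fun y => ∏ i ∈ s, f i y) x := by
  exact ContMDiffAt.prod hf

theorem HolAt.inv {f : X → ℂ} {x : X} (hf : HolAt f x) (h0 : f x ≠ 0) :
    HolAt (fun y => (f y)⁻¹) x :=
  ContMDiffAt.comp x (g := fun z : ℂ => z⁻¹) ((contDiffAt_inv ℂ h0).contMDiffAt) hf

theorem HolAt.det {n : Type*} [Fintype n] [DecidableEq n] {A : X → Matrix n n ℂ} {x : X}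
    (hA : ∀ i j, HolAt (fun y => A y i j) x) : HolAt (fun y => (A y).det) x := by
  simp only [Matrix.det_apply']
  exact HolAt.sum fun σ _ => (holAt_const _ x).mul (HolAt.prod fun i _ => hA _ _)

/-- The local coordinate centred at `x`. -/
def coord (x y : X) : ℂ := chartAt ℂ x y - chartAt ℂ x x

theorem coord_ne_zero (x : X) : ∀ᶠ y in 𝓝[≠] x, coord x y ≠ 0 := by
  rw [eventually_nhdsWithin_iff]
  filter_upwards [(chartAt ℂ x).open_source.mem_nhds (mem_chart_source ℂ x)] with y hy hne h
  exact hne ((chartAt ℂ x).injOn hy (mem_chart_source ℂ x) (sub_eq_zero.1 h))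

theorem tendsto_chart_symm_punctured (x : X) :
    Tendsto (chartAt ℂ x).symm (𝓝[≠] (chartAt ℂ x x)) (𝓝[≠] x) := by
  have hc := (chartAt ℂ x).symm.continuousAt (mem_chart_target ℂ x)
  have h1 : Tendsto (chartAt ℂ x).symm (𝓝 (chartAt ℂ x x)) (𝓝 x) := by
    simpa [ContinuousAt] using hc
  refine tendsto_nhdsWithin_iff.2 ⟨h1.mono_left nhdsWithin_le_nhds, ?_⟩
  rw [eventually_nhdsWithin_iff]
  filter_upwards [(chartAt ℂ x).open_target.mem_nhds (mem_chart_target ℂ x)] with z hz hne h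
  apply hne
  have h' : (chartAt ℂ x).symm z = x := h
  rw [Set.mem_singleton_iff, ← (chartAt ℂ x).right_inv hz, h']

/-- Points are not isolated: generic points near `x` exist, and limits taken off `x` are unique. -/
instance neBot_punctured (x : X) : NeBot (𝓝[≠] x) :=
  (tendsto_chart_symm_punctured x).neBot

variable [IsManifold 𝓘(ℂ) ω X]

theorem holAt_iff {f : X → ℂ} {p x : X} (hx : x ∈ (chartAt ℂ p).source) :
    HolAt f x ↔ AnalyticAt ℂ (f ∘ (chartAt ℂ p).symm) (chartAt ℂ p x) := by
  have hc : chartAt ℂ p ∈ IsManifold.maximalAtlas 𝓘(ℂ) ω X := IsManifold.chart_mem_maximalAtlas p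
  have ht := (chartAt ℂ p).map_source hx
  constructor
  · intro hf
    have h1 : ContMDiffAt 𝓘(ℂ) 𝓘(ℂ) ω f ((chartAt ℂ p).symm (chartAt ℂ p x)) := by
      rwa [(chartAt ℂ p).left_inv hx]
    exact ContDiffAt.analyticAt
      ((h1.comp _ (contMDiffAt_symm_of_mem_maximalAtlas hc ht)).contDiffAt)
  · intro hf
    have h1 := (AnalyticAt.contDiffAt (n := ω) hf).contMDiffAt.comp x
      (contMDiffAt_of_mem_maximalAtlas hc hx)
    refine ContMDiffAt.congr_of_eventuallyEq h1 ?_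
    filter_upwards [(chartAt ℂ p).open_source.mem_nhds hx] with y hy
    simp [(chartAt ℂ p).left_inv hy]

theorem contDiffAt_chart {u : X → ℝ} {p x : X} (hx : x ∈ (chartAt ℂ p).source)
    (hu : ContMDiffAt 𝓘(ℝ, ℂ) 𝓘(ℝ) ∞ u x) :
    ContDiffAt ℝ 2 (u ∘ (chartAt ℂ p).symm) (chartAt ℂ p x) := by
  have := isManifold_real (X := X)
  have hc : chartAt ℂ p ∈ IsManifold.maximalAtlas 𝓘(ℝ, ℂ) ∞ X :=
    IsManifold.chart_mem_maximalAtlas p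
  have h1 : ContMDiffAt 𝓘(ℝ, ℂ) 𝓘(ℝ) ∞ u ((chartAt ℂ p).symm (chartAt ℂ p x)) := by
    rwa [(chartAt ℂ p).left_inv hx]
  exact ((h1.comp _ (contMDiffAt_symm_of_mem_maximalAtlas hc
    ((chartAt ℂ p).map_source hx))).contDiffAt).of_le (WithTop.coe_le_coe.2 le_top)

theorem analyticAt_transition {p q : X} {z : ℂ} (hz : z ∈ (chartAt ℂ p).target)
    (hz' : (chartAt ℂ p).symm z ∈ (chartAt ℂ q).source) :
    AnalyticAt ℂ (chartAt ℂ q ∘ (chartAt ℂ p).symm) z := by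
  have hc : chartAt ℂ q ∈ IsManifold.maximalAtlas 𝓘(ℂ) ω X := IsManifold.chart_mem_maximalAtlas q
  have h := (holAt_iff ((chartAt ℂ p).map_target hz)).1 (contMDiffAt_of_mem_maximalAtlas hc hz')
  rwa [(chartAt ℂ p).right_inv hz] at h

theorem holAt_coord (x : X) : HolAt (coord x) x :=
  have h : HolAt (chartAt ℂ x) x := contMDiffAt_of_mem_maximalAtlas
    (IsManifold.chart_mem_maximalAtlas x) (mem_chart_source ℂ x)
  (h.add (holAt_const (-chartAt ℂ x x) x)).congr
    (Eventually.of_forall fun y => by simp [coord, sub_eq_add_neg])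

/-- A holomorphic function vanishes near `x`, or it is a unit times a power of the coordinate. -/
theorem HolAt.eq_zero_or_pow {f : X → ℂ} {x : X} (hf : HolAt f x) :
    (∀ᶠ y in 𝓝 x, f y = 0) ∨ ∃ (m : ℕ) (u : X → ℂ), HolAt u x ∧ u x ≠ 0 ∧
      ∀ᶠ y in 𝓝 x, f y = coord x y ^ m * u y := by
  have hx := mem_chart_source ℂ x
  have h1 := (holAt_iff hx).1 hf
  have hback : ∀ {P : ℂ → Prop}, (∀ᶠ z in 𝓝 (chartAt ℂ x x), P z) →
      ∀ᶠ y in 𝓝 x, P (chartAt ℂ x y) := fun h => ((chartAt ℂ x).continuousAt hx).eventually h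
  by_cases h0 : ∀ᶠ z in 𝓝 (chartAt ℂ x x), (f ∘ (chartAt ℂ x).symm) z = 0
  · left
    filter_upwards [hback h0, (chartAt ℂ x).open_source.mem_nhds hx] with y hy hys
    simpa [(chartAt ℂ x).left_inv hys] using hy
  · right
    obtain ⟨m, g, hg, hg0, hfg⟩ := h1.exists_eventuallyEq_pow_smul_nonzero_iff.2 h0
    refine ⟨m, g ∘ chartAt ℂ x, (holAt_iff hx).2 ?_, hg0, ?_⟩
    · refine hg.congr ?_
      filter_upwards [(chartAt ℂ x).open_target.mem_nhds (mem_chart_target ℂ x)] with z hz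
      simp [(chartAt ℂ x).right_inv hz]
    · filter_upwards [hback hfg, (chartAt ℂ x).open_source.mem_nhds hx] with y hy hys
      simpa [coord, (chartAt ℂ x).left_inv hys] using hy

theorem HolAt.eq_zero_or_ne_zero {f : X → ℂ} {x : X} (hf : HolAt f x) :
    (∀ᶠ y in 𝓝 x, f y = 0) ∨ ∀ᶠ y in 𝓝[≠] x, f y ≠ 0 := by
  refine hf.eq_zero_or_pow.imp_right ?_
  rintro ⟨m, u, hu, hu0, h⟩
  filter_upwards [h.filter_mono nhdsWithin_le_nhds, coord_ne_zero x,
    (hu.continuousAt.eventually_ne hu0).filter_mono nhdsWithin_le_nhds] with y h1 h2 h3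
  rw [h1]
  exact mul_ne_zero (pow_ne_zero _ h2) h3

theorem HolAt.exists_eq_coord_mul {f : X → ℂ} {x : X} (hf : HolAt f x) (h0 : f x = 0) :
    ∃ g : X → ℂ, HolAt g x ∧ ∀ᶠ y in 𝓝 x, f y = coord x y * g y := by
  rcases hf.eq_zero_or_pow with h | ⟨m, u, hu, hu0, h⟩
  · exact ⟨fun _ => 0, holAt_const _ x, by simpa using h⟩
  · cases m with
    | zero => exact absurd (by simpa [h0] using h.self_of_nhds.symm) hu0
    | succ m =>
      refine ⟨fun y => coord x y ^ m * u y, ?_, h.mono fun y hy => by rw [hy]; ring⟩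
      exact HolAt.mul (ContMDiffAt.pow (holAt_coord x) m) hu

end Charts

/-! ### Integration of densities and Stokes' theorem -/

section Integration

variable {X : Type*} [TopologicalSpace X] [ChartedSpace ℂ X]
  (ρ : SmoothPartitionOfUnity X 𝓘(ℝ, ℂ) X Set.univ)

/-- The integral over `X` of the two-form whose density in the chart at `p` is `k p`. -/
def integ (k : X → ℂ → ℝ) : ℝ :=
  ∑ᶠ p : X, ∫ z in (chartAt ℂ p).target, ρ p ((chartAt ℂ p).symm z) * k p z

theorem contDiffAt_partition [IsManifold 𝓘(ℂ) ω X] (p q : X) {z : ℂ} (hz : z ∈ (chartAt ℂ p).target) :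
    ContDiffAt ℝ 2 (fun y => ρ q ((chartAt ℂ p).symm y)) z := by
  have := contDiffAt_chart ((chartAt ℂ p).map_target hz)
    ((ρ q).contMDiff.contMDiffAt (x := (chartAt ℂ p).symm z))
  rwa [(chartAt ℂ p).right_inv hz] at this

theorem integ_congr {k k' : X → ℂ → ℝ} (h : ∀ p, ∀ z ∈ (chartAt ℂ p).target, k p z = k' p z) :
    integ ρ k = integ ρ k' := by
  unfold integ
  refine finsum_congr fun p => setIntegral_congr_fun (chartAt ℂ p).open_target.measurableSet ?_
  intro z hz
  simp only [h p z hz]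

variable [CompactSpace X]

theorem finite_partition : {p : X | ∃ x, ρ p x ≠ 0}.Finite :=
  (ρ.locallyFinite.finite_nonempty_of_compact).subset fun _ ⟨x, hx⟩ => ⟨x, hx⟩

/-- The finitely many indices at which the partition of unity does not vanish. -/
def pset : Finset X := (finite_partition ρ).toFinset

theorem eq_zero_of_notMem_pset {p : X} (hp : p ∉ pset ρ) (x : X) : ρ p x = 0 := by
  by_contra h
  exact hp ((finite_partition ρ).mem_toFinset.2 ⟨x, h⟩)

theorem integ_eq_sum (k : X → ℂ → ℝ) : integ ρ k =
    ∑ p ∈ pset ρ, ∫ z in (chartAt ℂ p).target, ρ p ((chartAt ℂ p).symm z) * k p z := by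
  refine finsum_eq_sum_of_support_subset _ fun p hp => ?_
  by_contra h
  exact hp (by simp [eq_zero_of_notMem_pset ρ h])

theorem sum_pset (x : X) : ∑ p ∈ pset ρ, ρ p x = 1 := by
  rw [← ρ.sum_eq_one (Set.mem_univ x)]
  refine (finsum_eq_sum_of_support_subset _ fun p hp => ?_).symm
  by_contra h
  exact hp (eq_zero_of_notMem_pset ρ h x)

/-- Take the image of the support of `ρ p`. Vanishing near each point outside it, and not only at
the point, is what derivatives require. -/
theorem exists_compact_support (hρ : ρ.IsSubordinate fun p => (chartAt ℂ p).source)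
    (p : X) : ∃ K : Set ℂ, IsCompact K ∧ K ⊆ (chartAt ℂ p).target ∧
    ∀ z ∈ (chartAt ℂ p).target, z ∉ K → ∀ᶠ y in 𝓝 z, ρ p ((chartAt ℂ p).symm y) = 0 := by
  have hcl : IsClosed (tsupport (ρ p)) := isClosed_tsupport _
  refine ⟨chartAt ℂ p '' tsupport (ρ p), hcl.isCompact.image_of_continuousOn
    ((chartAt ℂ p).continuousOn.mono (hρ p)), ?_, fun z hz hzK => ?_⟩
  · rintro _ ⟨x, hx, rfl⟩
    exact (chartAt ℂ p).map_source (hρ p hx)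
  · have h1 : (chartAt ℂ p).symm z ∉ tsupport (ρ p) := fun h =>
      hzK ⟨_, h, (chartAt ℂ p).right_inv hz⟩
    have h2 := (notMem_tsupport_iff_eventuallyEq.1 h1)
    exact ((chartAt ℂ p).symm.continuousAt hz).eventually h2

theorem integrableOn_partition_mul
    (hρ : ρ.IsSubordinate fun p => (chartAt ℂ p).source) (p : X) {k : ℂ → ℝ} (hk : ContinuousOn k (chartAt ℂ p).target) :
    IntegrableOn (fun z => ρ p ((chartAt ℂ p).symm z) * k z) (chartAt ℂ p).target := by
  obtain ⟨K, hK, hKt, hK0⟩ := exists_compact_support ρ hρ p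
  have hc : ContinuousOn (fun z => ρ p ((chartAt ℂ p).symm z) * k z) (chartAt ℂ p).target :=
    ((ρ p).contMDiff.continuous.comp_continuousOn (chartAt ℂ p).symm.continuousOn).mul hk
  refine ((hc.mono hKt).integrableOn_compact hK).of_forall_sdiff_eq_zero
    (chartAt ℂ p).open_target.measurableSet fun z hz => ?_
  simp [(hK0 z hz.1 hz.2).self_of_nhds]

theorem integ_add (hρ : ρ.IsSubordinate fun p => (chartAt ℂ p).source)
    {k k' : X → ℂ → ℝ} (hk : ∀ p, ContinuousOn (k p) (chartAt ℂ p).target)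
    (hk' : ∀ p, ContinuousOn (k' p) (chartAt ℂ p).target) :
    integ ρ (fun p z => k p z + k' p z) = integ ρ k + integ ρ k' := by
  rw [integ_eq_sum, integ_eq_sum, integ_eq_sum, ← Finset.sum_add_distrib]
  refine Finset.sum_congr rfl fun p _ => ?_
  rw [← integral_add (integrableOn_partition_mul ρ hρ p (hk p))
    (integrableOn_partition_mul ρ hρ p (hk' p))]
  simp only [mul_add]

theorem integ_smul (c : ℝ) (k : X → ℂ → ℝ) : integ ρ (fun p z => c * k p z) = c * integ ρ k := by
  rw [integ_eq_sum, integ_eq_sum, Finset.mul_sum]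
  refine Finset.sum_congr rfl fun p _ => ?_
  rw [← integral_const_mul]
  simp only [mul_left_comm]

variable [IsManifold 𝓘(ℂ) ω X]

/-- Both integrands vanish outside the overlap of the two charts. There the conformal factor of the
Laplacian is the Jacobian in the change of variables. -/
theorem integral_partition_laplacian_change
    (hρ : ρ.IsSubordinate fun p => (chartAt ℂ p).source) {u : X → ℝ}
    (hu : ∀ p, ∀ z ∈ (chartAt ℂ p).target, ContDiffAt ℝ 2 (fun y => u ((chartAt ℂ p).symm y)) z)
    (p q : X) :
    ∫ z in (chartAt ℂ p).target, ρ p ((chartAt ℂ p).symm z) * Laplacian.laplacian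
      (fun y => ρ q ((chartAt ℂ p).symm y) * u ((chartAt ℂ p).symm y)) z =
    ∫ z in (chartAt ℂ q).target, ρ p ((chartAt ℂ q).symm z) * Laplacian.laplacian
      (fun y => ρ q ((chartAt ℂ q).symm y) * u ((chartAt ℂ q).symm y)) z := by
  set c := chartAt ℂ p
  set c' := chartAt ℂ q
  set A := c.target ∩ c.symm ⁻¹' c'.source with hA
  set B := c'.target ∩ c'.symm ⁻¹' c.source with hB
  have hAo : IsOpen A := c.symm.isOpen_inter_preimage c'.open_source
  have hBo : IsOpen B := c'.symm.isOpen_inter_preimage c.open_source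
  have e1 : ∫ z in c.target, ρ p (c.symm z) * Laplacian.laplacian
      (fun y => ρ q (c.symm y) * u (c.symm y)) z =
      ∫ z in A, ρ p (c.symm z) * Laplacian.laplacian
      (fun y => ρ q (c.symm y) * u (c.symm y)) z := by
    refine (setIntegral_eq_of_subset_of_forall_sdiff_eq_zero c.open_target.measurableSet
      Set.inter_subset_left fun z hz => ?_)
    have hzq : c.symm z ∉ tsupport (ρ q) := fun h => hz.2 ⟨hz.1, hρ q h⟩
    have h0 := (c.symm.continuousAt hz.1).eventually (notMem_tsupport_iff_eventuallyEq.1 hzq)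
    have h1 : (fun y => ρ q (c.symm y) * u (c.symm y)) =ᶠ[𝓝 z] fun _ => 0 := by
      filter_upwards [h0] with y hy
      simp [hy]
    rw [(InnerProductSpace.laplacian_congr_nhds h1).self_of_nhds]
    simp
  have e2 : ∫ z in c'.target, ρ p (c'.symm z) * Laplacian.laplacian
      (fun y => ρ q (c'.symm y) * u (c'.symm y)) z =
      ∫ z in B, ρ p (c'.symm z) * Laplacian.laplacian
      (fun y => ρ q (c'.symm y) * u (c'.symm y)) z := by
    refine (setIntegral_eq_of_subset_of_forall_sdiff_eq_zero c'.open_target.measurableSet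
      Set.inter_subset_left fun z hz => ?_)
    have hzp : c'.symm z ∉ tsupport (ρ p) := fun h => hz.2 ⟨hz.1, hρ p h⟩
    simp [image_eq_zero_of_notMem_tsupport hzp]
  have hτB : (c' ∘ c.symm) '' A = B := by
    ext w
    constructor
    · rintro ⟨z, hz, rfl⟩
      exact ⟨c'.map_source hz.2, by
        simpa [c'.left_inv hz.2] using c.map_target hz.1⟩
    · intro hw
      refine ⟨c (c'.symm w), ⟨c.map_source hw.2, ?_⟩, ?_⟩
      · simpa [c.left_inv hw.2] using c'.map_target hw.1
      · simp [c.left_inv hw.2, c'.right_inv hw.1]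
  have hinj : Set.InjOn (c' ∘ c.symm) A := by
    intro z hz w hw h
    have := c'.injOn hz.2 hw.2 h
    exact c.symm.injOn hz.1 hw.1 this
  have han : ∀ z ∈ A, AnalyticAt ℂ (c' ∘ c.symm) z := fun z hz => analyticAt_transition hz.1 hz.2
  rw [e1, e2, ← hτB, integral_image_eq_integral_abs_det_fderiv_smul volume hAo.measurableSet
    (f' := fun z => (ContinuousLinearMap.toSpanSingleton ℂ
      (deriv (c' ∘ c.symm) z)).restrictScalars ℝ)
    (fun z hz => ((han z hz).differentiableAt.hasDerivAt.hasFDerivAt.restrictScalars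
      ℝ).hasFDerivWithinAt) hinj]
  refine setIntegral_congr_fun hAo.measurableSet fun z hz => ?_
  -- The real determinant of multiplication by `t` is the field norm of `t`, that is `‖t‖²`.
  have hdet : ∀ t : ℂ, |((ContinuousLinearMap.toSpanSingleton ℂ t).restrictScalars ℝ).det| =
      ‖t‖ ^ 2 := by
    intro t
    have e : ((ContinuousLinearMap.toSpanSingleton ℂ t).restrictScalars ℝ).det =
      LinearMap.det (LinearMap.mulLeft ℝ t) := by
      change LinearMap.det _ = _
      congr 1
      exact LinearMap.ext fun v => by simp [mul_comm]
    rw [e, ← Complex.normSq_eq_norm_sq]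
    have := Algebra.norm_complex_apply t
    rw [Algebra.norm_apply] at this
    change |LinearMap.det (Algebra.lmul ℝ ℂ t)| = _
    rw [this, abs_of_nonneg (Complex.normSq_nonneg _)]
  have hloc : (fun y => ρ q (c.symm y) * u (c.symm y)) =ᶠ[𝓝 z]
      (fun y => ρ q (c'.symm y) * u (c'.symm y)) ∘ (c' ∘ c.symm) := by
    filter_upwards [hAo.mem_nhds hz] with y hy
    simp [c'.left_inv hy.2]
  have ht : (c' ∘ c.symm) z ∈ c'.target := c'.map_source hz.2
  simp only [hdet]
  rw [(InnerProductSpace.laplacian_congr_nhds hloc).self_of_nhds, laplacian_comp_analytic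
    ((contDiffAt_partition ρ q q ht).mul (hu q _ ht)) (han z hz)]
  simp [c'.left_inv hz.2]
  ring

/-- The cut-off function extends by zero to a compactly supported `C²` function on the plane. -/
theorem integral_laplacian_chart_eq_zero
    (hρ : ρ.IsSubordinate fun p => (chartAt ℂ p).source) {u : X → ℝ} (q : X)
    (hu : ∀ z ∈ (chartAt ℂ q).target, ContDiffAt ℝ 2 (fun y => u ((chartAt ℂ q).symm y)) z) :
    ∫ z in (chartAt ℂ q).target, Laplacian.laplacian
      (fun y => ρ q ((chartAt ℂ q).symm y) * u ((chartAt ℂ q).symm y)) z = 0 := by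
  obtain ⟨K, hK, hKt, hK0⟩ := exists_compact_support ρ hρ q
  set c := chartAt ℂ q
  set g : ℂ → ℝ := fun y => ρ q (c.symm y) * u (c.symm y)
  set f : ℂ → ℝ := c.target.indicator g with hf
  have hin : ∀ z ∈ c.target, f =ᶠ[𝓝 z] g := fun z hz => by
    filter_upwards [c.open_target.mem_nhds hz] with y hy
    exact Set.indicator_of_mem hy g
  have hout : ∀ z ∉ K, f =ᶠ[𝓝 z] fun _ => 0 := fun z hz => by
    by_cases hzt : z ∈ c.target
    · filter_upwards [hin z hzt, hK0 z hzt hz] with y h1 h2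
      simp [h1, g, h2]
    · filter_upwards [hK.isClosed.isOpen_compl.mem_nhds hz] with y hy
      by_cases hyt : y ∈ c.target
      · simp [hf, Set.indicator_of_mem hyt, g, (hK0 y hyt hy).self_of_nhds]
      · exact Set.indicator_of_notMem hyt g
  have hsupp : HasCompactSupport f :=
    HasCompactSupport.intro hK fun z hz => (hout z hz).self_of_nhds
  have hsm : ContDiff ℝ 2 f := contDiff_iff_contDiffAt.2 fun z => by
    by_cases hz : z ∈ K
    · exact ((contDiffAt_partition ρ q q (hKt hz)).mul (hu z (hKt hz))).congr_of_eventuallyEq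
        (hin z (hKt hz))
    · exact contDiffAt_const.congr_of_eventuallyEq (hout z hz)
  have h1 : ∫ z in c.target, Laplacian.laplacian g z = ∫ z in c.target, Laplacian.laplacian f z :=
    setIntegral_congr_fun c.open_target.measurableSet fun z hz =>
      ((InnerProductSpace.laplacian_congr_nhds (hin z hz)).self_of_nhds).symm
  rw [h1, ← integral_laplacian_eq_zero hsm hsupp]
  refine setIntegral_eq_integral_of_forall_compl_eq_zero fun z hz => ?_
  rw [(InnerProductSpace.laplacian_congr_nhds (hout z fun h => hz (hKt h))).self_of_nhds]
  simp

/-- Stokes' theorem for the Laplacian of a global function. -/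
theorem integ_laplacian_eq_zero (hρ : ρ.IsSubordinate fun p => (chartAt ℂ p).source)
    {u : X → ℝ}
    (hu : ∀ p, ∀ z ∈ (chartAt ℂ p).target, ContDiffAt ℝ 2 (fun y => u ((chartAt ℂ p).symm y)) z) :
    integ ρ (fun p z => Laplacian.laplacian (fun y => u ((chartAt ℂ p).symm y)) z) = 0 := by
  set Λ : X → X → ℂ → ℝ := fun p q => Laplacian.laplacian (fun y => ρ q ((chartAt ℂ p).symm y) *
      u ((chartAt ℂ p).symm y))
  have hsm : ∀ p q, ∀ z ∈ (chartAt ℂ p).target, ContDiffAt ℝ 2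
      (fun y => ρ q ((chartAt ℂ p).symm y) * u ((chartAt ℂ p).symm y)) z := fun p q z hz =>
    (contDiffAt_partition ρ p q hz).mul (hu p z hz)
  have hc : ∀ p q, ContinuousOn (Λ p q) (chartAt ℂ p).target := fun p q z hz =>
    (continuousAt_laplacian (hsm p q z hz)).continuousWithinAt
  have hsplit : ∀ p, ∀ z ∈ (chartAt ℂ p).target,
      Laplacian.laplacian (fun y => u ((chartAt ℂ p).symm y)) z = ∑ q ∈ pset ρ, Λ p q z := by
    intro p z hz
    rw [← laplacian_sum _ fun q _ => hsm p q z hz]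
    simp only [← Finset.sum_mul, sum_pset, one_mul]
  have hint : ∀ p q, IntegrableOn (fun z => ρ p ((chartAt ℂ q).symm z) * Λ q q z)
      (chartAt ℂ q).target := by
    intro p q
    obtain ⟨K, hK, hKt, hK0⟩ := exists_compact_support ρ hρ q
    have hcont : ContinuousOn (fun z => ρ p ((chartAt ℂ q).symm z) * Λ q q z)
        (chartAt ℂ q).target :=
      ((ρ p).contMDiff.continuous.comp_continuousOn (chartAt ℂ q).symm.continuousOn).mul (hc q q)
    refine ((hcont.mono hKt).integrableOn_compact hK).of_forall_sdiff_eq_zero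
      (chartAt ℂ q).open_target.measurableSet fun z hz => ?_
    have h1 : (fun y => ρ q ((chartAt ℂ q).symm y) * u ((chartAt ℂ q).symm y)) =ᶠ[𝓝 z]
        fun _ => 0 := (hK0 z hz.1 hz.2).mono fun y hy => by simp [hy]
    have h2 : Λ q q z = 0 := by
      simp only [Λ]
      rw [(InnerProductSpace.laplacian_congr_nhds h1).self_of_nhds]
      simp
    rw [h2, mul_zero]
  rw [integ_congr ρ hsplit, integ_eq_sum]
  -- Write `u = ∑ ρ q * u` and move the term of index `q` to the chart at `q`. There the weights `ρ
  -- p` add up to `1`, which leaves a compactly supported Laplacian.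
  calc ∑ p ∈ pset ρ, ∫ z in (chartAt ℂ p).target, ρ p ((chartAt ℂ p).symm z) *
        ∑ q ∈ pset ρ, Λ p q z
      = ∑ p ∈ pset ρ, ∑ q ∈ pset ρ, ∫ z in (chartAt ℂ q).target,
          ρ p ((chartAt ℂ q).symm z) * Λ q q z := by
        refine Finset.sum_congr rfl fun p _ => ?_
        simp only [Finset.mul_sum]
        rw [integral_finsetSum _ fun q _ => integrableOn_partition_mul ρ hρ p (hc p q)]
        exact Finset.sum_congr rfl fun q _ => integral_partition_laplacian_change ρ hρ hu p q
    _ = ∑ q ∈ pset ρ, ∫ z in (chartAt ℂ q).target, Λ q q z := by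
        rw [Finset.sum_comm]
        refine Finset.sum_congr rfl fun q _ => ?_
        rw [← integral_finsetSum _ fun p _ => hint p q]
        simp only [← Finset.sum_mul, sum_pset, one_mul]
    _ = 0 := Finset.sum_eq_zero fun q _ => integral_laplacian_chart_eq_zero ρ hρ q (hu q)

end Integration

/-! ### Metrized line bundles, their degrees and their morphisms -/

section HermitianLine

variable {X : Type*} [TopologicalSpace X] [ChartedSpace ℂ X]

variable (X) in
/-- The squared norms `G x` of local frames near `x` of a Hermitian holomorphic line bundle. -/
structure HermLine where
  G : X → X → ℝ
  pos : ∀ x, ∀ᶠ y in 𝓝 x, 0 < G x y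
  smooth : ∀ x, ∀ᶠ y in 𝓝 x, ∀ p, y ∈ (chartAt ℂ p).source →
    ContDiffAt ℝ 2 (fun z => G x ((chartAt ℂ p).symm z)) (chartAt ℂ p y)
  compat : ∀ x, ∀ᶠ y in 𝓝 x, ∃ u : X → ℂ, HolAt u y ∧ u y ≠ 0 ∧
    ∀ᶠ w in 𝓝 y, G y w = ‖u w‖ ^ 2 * G x w

namespace HermLine

/-- The Laplacian of the logarithm of the squared norm of a local frame. -/
def dens (M : HermLine X) (p : X) (z : ℂ) : ℝ :=
  Laplacian.laplacian (fun w => Real.log (M.G ((chartAt ℂ p).symm z) ((chartAt ℂ p).symm w))) z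

/-- The degree. -/
def deg (M : HermLine X) (ρ : SmoothPartitionOfUnity X 𝓘(ℝ, ℂ) X Set.univ) : ℝ :=
  integ ρ fun p z => -(1 / (4 * Real.pi)) * M.dens p z

theorem eventually_chart_symm {p : X} {z : ℂ} (hz : z ∈ (chartAt ℂ p).target)
    {P : X → Prop} (h : ∀ᶠ y in 𝓝 ((chartAt ℂ p).symm z), P y) : ∀ᶠ w in 𝓝 z, P ((chartAt ℂ p).symm w) :=
  ((chartAt ℂ p).symm.continuousAt hz).eventually h

theorem contDiffAt_log (M : HermLine X) {p : X} {z : ℂ} (hz : z ∈ (chartAt ℂ p).target) :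
    ContDiffAt ℝ 2 (fun w => Real.log (M.G ((chartAt ℂ p).symm z) ((chartAt ℂ p).symm w))) z := by
  have h := (M.smooth ((chartAt ℂ p).symm z)).self_of_nhds p ((chartAt ℂ p).map_target hz)
  rw [(chartAt ℂ p).right_inv hz] at h
  exact h.log (M.pos _).self_of_nhds.ne'

/-- The tensor product of Hermitian line bundles. -/
def mul (M N : HermLine X) : HermLine X where
  G x y := M.G x y * N.G x y
  pos x := by
    filter_upwards [M.pos x, N.pos x] with y h1 h2 using mul_pos h1 h2
  smooth x := by
    filter_upwards [M.smooth x, N.smooth x] with y h1 h2 p hp using (h1 p hp).mul (h2 p hp)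
  compat x := by
    filter_upwards [M.compat x, N.compat x] with y ⟨u, hu, hu0, h⟩ ⟨v, hv, hv0, h'⟩
    refine ⟨fun w => u w * v w, hu.mul hv, mul_ne_zero hu0 hv0, ?_⟩
    filter_upwards [h, h'] with w h1 h2
    rw [h1, h2, norm_mul]
    ring

variable (X) in
/-- The trivial Hermitian line bundle. -/
def one : HermLine X where
  G _ _ := 1
  pos x := by simp
  smooth x := Eventually.of_forall fun _ _ _ => contDiffAt_const
  compat x := Eventually.of_forall fun y => ⟨fun _ => 1, holAt_const _ _, by simp, by simp⟩

/-- The powers of a Hermitian line bundle. -/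
def pow (M : HermLine X) : ℕ → HermLine X
  | 0 => one X
  | n + 1 => (M.pow n).mul M

theorem pow_G (M : HermLine X) (n : ℕ) (x y : X) : (M.pow n).G x y = M.G x y ^ n := by
  induction n with
  | zero => simp [pow, one]
  | succ n ih => simp [pow, mul, ih, pow_succ]

theorem dens_mul (M N : HermLine X) {p : X} {z : ℂ} (hz : z ∈ (chartAt ℂ p).target) :
    (M.mul N).dens p z = M.dens p z + N.dens p z := by
  have e : (fun w => Real.log ((M.mul N).G ((chartAt ℂ p).symm z) ((chartAt ℂ p).symm w))) =ᶠ[𝓝 z]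
      (fun w => Real.log (M.G ((chartAt ℂ p).symm z) ((chartAt ℂ p).symm w))) +
        fun w => Real.log (N.G ((chartAt ℂ p).symm z) ((chartAt ℂ p).symm w)) := by
    filter_upwards [eventually_chart_symm hz (M.pos _), eventually_chart_symm hz (N.pos _)]
      with w h1 h2
    exact Real.log_mul h1.ne' h2.ne'
  unfold dens
  rw [(InnerProductSpace.laplacian_congr_nhds e).self_of_nhds,
    (M.contDiffAt_log hz).laplacian_add (N.contDiffAt_log hz)]

theorem deg_one (ρ : SmoothPartitionOfUnity X 𝓘(ℝ, ℂ) X Set.univ) : (one X).deg ρ = 0 := by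
  simp [deg, dens, one, integ]

variable [IsManifold 𝓘(ℂ) ω X]

/-- In `dens` the frame moves with the point. Two frames differ by a holomorphic unit, whose
logarithmic norm is harmonic, so near `z` the frame at `z` can be kept; this makes the density
continuous. -/
theorem dens_eventuallyEq (M : HermLine X) {p : X} {z : ℂ} (hz : z ∈ (chartAt ℂ p).target) :
    M.dens p =ᶠ[𝓝 z] Laplacian.laplacian
      (fun w => Real.log (M.G ((chartAt ℂ p).symm z) ((chartAt ℂ p).symm w))) := by
  set x := (chartAt ℂ p).symm z
  filter_upwards [eventually_chart_symm hz (M.pos x).eventually_nhds,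
    eventually_chart_symm hz (M.compat x), eventually_chart_symm hz (M.smooth x),
    (chartAt ℂ p).open_target.mem_nhds hz] with z' h1 h2 h3 hz'
  obtain ⟨u, hu, hu0, h⟩ := h2
  have hua : AnalyticAt ℂ (u ∘ (chartAt ℂ p).symm) z' := by
    have := (holAt_iff ((chartAt ℂ p).map_target hz')).1 hu
    rwa [(chartAt ℂ p).right_inv hz'] at this
  obtain ⟨e1, e2⟩ := laplacian_log_norm_sq hua hu0
  have e3 : (fun w => Real.log (M.G ((chartAt ℂ p).symm z') ((chartAt ℂ p).symm w))) =ᶠ[𝓝 z']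
      (fun w => Real.log (‖(u ∘ (chartAt ℂ p).symm) w‖ ^ 2)) +
        fun w => Real.log (M.G x ((chartAt ℂ p).symm w)) := by
    filter_upwards [eventually_chart_symm hz' h, eventually_chart_symm hz' h1,
      hua.continuousAt.eventually_ne hu0] with w hw1 hw2 hw3
    have : ‖u ((chartAt ℂ p).symm w)‖ ^ 2 ≠ 0 := pow_ne_zero _ (norm_ne_zero_iff.2 hw3)
    simp only [Pi.add_apply, Function.comp_apply]
    rw [hw1, Real.log_mul this hw2.ne']
  have e4 : ContDiffAt ℝ 2 (fun w => Real.log (M.G x ((chartAt ℂ p).symm w))) z' := by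
    have := h3 p ((chartAt ℂ p).map_target hz')
    rw [(chartAt ℂ p).right_inv hz'] at this
    exact this.log h1.self_of_nhds.ne'
  unfold dens
  rw [(InnerProductSpace.laplacian_congr_nhds e3).self_of_nhds, e1.laplacian_add e4, e2, zero_add]

theorem continuousOn_dens (M : HermLine X) (p : X) :
    ContinuousOn (M.dens p) (chartAt ℂ p).target := fun _ hz =>
  ((continuousAt_laplacian (M.contDiffAt_log hz)).congr
    (M.dens_eventuallyEq hz).symm).continuousWithinAt

variable (ρ : SmoothPartitionOfUnity X 𝓘(ℝ, ℂ) X Set.univ) [CompactSpace X]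

theorem deg_mul (hρ : ρ.IsSubordinate fun p => (chartAt ℂ p).source) (M N : HermLine X) :
    (M.mul N).deg ρ = M.deg ρ + N.deg ρ := by
  have h : integ ρ (fun p z => M.dens p z + N.dens p z) = integ ρ M.dens + integ ρ N.dens :=
    integ_add ρ hρ M.continuousOn_dens N.continuousOn_dens
  unfold deg
  rw [integ_smul, integ_smul, integ_smul, ← mul_add]
  congr 1
  rw [← h]
  exact integ_congr ρ fun p z hz => dens_mul M N hz

theorem deg_pow (hρ : ρ.IsSubordinate fun p => (chartAt ℂ p).source) (M : HermLine X) (n : ℕ) :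
    (M.pow n).deg ρ = n * M.deg ρ := by
  induction n with
  | zero => simp [pow, deg_one]
  | succ n ih => rw [pow, deg_mul ρ hρ, ih]; push_cast; ring

theorem deg_sub_deg (hρ : ρ.IsSubordinate fun p => (chartAt ℂ p).source) (M N : HermLine X) :
    N.deg ρ - M.deg ρ = -(1 / (4 * Real.pi)) * integ ρ fun p z => N.dens p z - M.dens p z := by
  have h : integ ρ (fun p z => N.dens p z - M.dens p z + M.dens p z) =
      integ ρ (fun p z => N.dens p z - M.dens p z) + integ ρ M.dens :=
    integ_add ρ hρ (fun p => (N.continuousOn_dens p).sub (M.continuousOn_dens p))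
      M.continuousOn_dens
  simp only [sub_add_cancel] at h
  unfold deg
  rw [integ_smul, integ_smul]
  linear_combination -(1 / (4 * Real.pi)) * h

end HermLine

/-- A holomorphic morphism `M → N` of Hermitian line bundles: the local functions `D x` represent
it near `x` in the local frames, and `q` is its squared norm. -/
structure LineHom (M N : HermLine X) where
  D : X → X → ℂ
  q : X → ℝ
  hol : ∀ x, HolAt (D x) x
  eq : ∀ x, ∀ᶠ y in 𝓝 x, q y * M.G x y = ‖D x y‖ ^ 2 * N.G x y
  ne_zero : ∀ x, ∀ᶠ y in 𝓝[≠] x, D x y ≠ 0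

namespace LineHom

variable {M N : HermLine X} (f : LineHom M N)

theorem q_eq_zero_iff (x : X) : f.q x = 0 ↔ f.D x x = 0 := by
  have h := (f.eq x).self_of_nhds
  have h1 := (M.pos x).self_of_nhds
  have h2 := (N.pos x).self_of_nhds
  constructor
  · intro h0
    rw [h0, zero_mul] at h
    simpa [h2.ne'] using h.symm
  · intro h0
    rw [h0] at h
    simpa [h1.ne'] using h

theorem q_nonneg (x : X) : 0 ≤ f.q x := by
  have h := (f.eq x).self_of_nhds
  have h1 := (M.pos x).self_of_nhds
  have h2 := (N.pos x).self_of_nhds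
  rw [← mul_nonneg_iff_of_pos_right h1, h]
  positivity

/-- By compactness, infinitely many zeros would accumulate somewhere, against `ne_zero`. -/
theorem finite_zeros [CompactSpace X] : {x | f.q x = 0}.Finite := by
  by_contra hinf
  obtain ⟨x, hx⟩ := Set.Infinite.exists_accPt_principal (s := {x | f.q x = 0}) hinf
  rw [accPt_iff_frequently_nhdsNE] at hx
  apply hx
  filter_upwards [f.ne_zero x, (f.eq x).filter_mono nhdsWithin_le_nhds,
    (N.pos x).filter_mono nhdsWithin_le_nhds] with y h1 h2 h3 h4
  have h4' : f.q y = 0 := h4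
  rw [h4', zero_mul] at h2
  have : 0 < ‖f.D x y‖ ^ 2 * N.G x y := by positivity
  exact this.ne h2

/-- The difference of the logarithms of the local metrics. -/
def psi (_ : LineHom M N) (p : X) (z w : ℂ) : ℝ :=
  Real.log (N.G ((chartAt ℂ p).symm z) ((chartAt ℂ p).symm w)) -
    Real.log (M.G ((chartAt ℂ p).symm z) ((chartAt ℂ p).symm w))

variable {p : X} {z : ℂ}

theorem contDiffAt_psi (hz : z ∈ (chartAt ℂ p).target) : ContDiffAt ℝ 2 (f.psi p z) z :=
  (N.contDiffAt_log hz).sub (M.contDiffAt_log hz)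

theorem laplacian_psi (hz : z ∈ (chartAt ℂ p).target) :
    Laplacian.laplacian (f.psi p z) z = N.dens p z - M.dens p z :=
  (N.contDiffAt_log hz).laplacian_sub (M.contDiffAt_log hz)

theorem q_eq (hz : z ∈ (chartAt ℂ p).target) : ∀ᶠ w in 𝓝 z, f.q ((chartAt ℂ p).symm w) =
    ‖f.D ((chartAt ℂ p).symm z) ((chartAt ℂ p).symm w)‖ ^ 2 * Real.exp (f.psi p z w) := by
  filter_upwards [HermLine.eventually_chart_symm hz (M.pos _),
    HermLine.eventually_chart_symm hz (N.pos _), HermLine.eventually_chart_symm hz (f.eq _)]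
    with w h1 h2 h3
  rw [psi, Real.exp_sub, Real.exp_log h1, Real.exp_log h2, ← mul_div_assoc, ← h3,
    mul_div_cancel_right₀ _ h1.ne']

variable [IsManifold 𝓘(ℂ) ω X]

theorem analyticAt_D (hz : z ∈ (chartAt ℂ p).target) :
    AnalyticAt ℂ (fun w => f.D ((chartAt ℂ p).symm z) ((chartAt ℂ p).symm w)) z := by
  have := (holAt_iff ((chartAt ℂ p).map_target hz)).1 (f.hol ((chartAt ℂ p).symm z))
  rwa [(chartAt ℂ p).right_inv hz] at this

theorem contDiffAt_q (hz : z ∈ (chartAt ℂ p).target) :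
    ContDiffAt ℝ 2 (fun w => f.q ((chartAt ℂ p).symm w)) z := by
  have h1 : ContDiffAt ℝ 2 (fun w => f.D ((chartAt ℂ p).symm z) ((chartAt ℂ p).symm w)) z :=
    (f.analyticAt_D hz).contDiffAt.restrict_scalars ℝ
  exact ((h1.norm_sq ℝ).mul (f.contDiffAt_psi hz).exp).congr_of_eventuallyEq (f.q_eq hz)

theorem contDiffAt_log_q_add {ε : ℝ} (hε : 0 < ε) (hz : z ∈ (chartAt ℂ p).target) :
    ContDiffAt ℝ 2 (fun w => Real.log (f.q ((chartAt ℂ p).symm w) + ε)) z :=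
  ((f.contDiffAt_q hz).add contDiffAt_const).log (by linarith [f.q_nonneg ((chartAt ℂ p).symm z)])

variable [CompactSpace X] (ρ : SmoothPartitionOfUnity X 𝓘(ℝ, ℂ) X Set.univ)

/-- A nowhere vanishing morphism preserves the degree. -/
theorem deg_eq (hρ : ρ.IsSubordinate fun p => (chartAt ℂ p).source)
    (h0 : ∀ x, f.D x x ≠ 0) : M.deg ρ = N.deg ρ := by
  have h := fun p z (hz : z ∈ (chartAt ℂ p).target) =>
    laplacian_log_of_eq (f.analyticAt_D hz) (h0 _) (f.contDiffAt_psi hz) (f.q_eq hz)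
  -- Without zeros, `log q` is a global function whose Laplacian is the difference of the densities.
  have h1 := integ_laplacian_eq_zero ρ hρ (u := fun x => Real.log (f.q x))
    fun p z hz => (h p z hz).1
  have h2 := HermLine.deg_sub_deg ρ hρ M N
  rw [← integ_congr ρ (k := fun p z => Laplacian.laplacian
    (fun y => Real.log (f.q ((chartAt ℂ p).symm y))) z) fun p z hz => by
      rw [(h p z hz).2, f.laplacian_psi hz], h1] at h2
  linarith

theorem ae_q_ne_zero : ∀ᵐ z ∂(volume.restrict (chartAt ℂ p).target),
    f.q ((chartAt ℂ p).symm z) ≠ 0 := by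
  rw [ae_restrict_iff' (chartAt ℂ p).open_target.measurableSet]
  have h : (volume : Measure ℂ) (chartAt ℂ p '' {x | f.q x = 0}) = 0 :=
    (f.finite_zeros.image _).measure_zero _
  filter_upwards [measure_eq_zero_iff_ae_notMem.1 h] with z hz hzt h0
  exact hz ⟨_, h0, (chartAt ℂ p).right_inv hzt⟩

/-- The curvature density of `M⁻¹ ⊗ N`, damped near the zeros of the morphism. -/
def damped (ε : ℝ) (p : X) (z : ℂ) : ℝ :=
  f.q ((chartAt ℂ p).symm z) / (f.q ((chartAt ℂ p).symm z) + ε) * (N.dens p z - M.dens p z)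

/-- What the damped curvature density lacks of the Laplacian of `log (q + ε)`. -/
def defect (ε : ℝ) (p : X) (z : ℂ) : ℝ :=
  Laplacian.laplacian (fun w => Real.log (f.q ((chartAt ℂ p).symm w) + ε)) z - f.damped ε p z

variable {ε : ℝ}

theorem continuousOn_damped (hε : 0 < ε) (p : X) :
    ContinuousOn (f.damped ε p) (chartAt ℂ p).target := by
  have hq : ContinuousOn (fun z => f.q ((chartAt ℂ p).symm z)) (chartAt ℂ p).target :=
    fun z hz => (f.contDiffAt_q hz).continuousAt.continuousWithinAt
  exact (hq.div (hq.add continuousOn_const) fun z _ => by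
    exact (add_pos_of_nonneg_of_pos (f.q_nonneg ((chartAt ℂ p).symm z)) hε).ne').mul ((N.continuousOn_dens p).sub (M.continuousOn_dens p))

theorem continuousOn_defect (hε : 0 < ε) (p : X) :
    ContinuousOn (f.defect ε p) (chartAt ℂ p).target :=
  ContinuousOn.sub (fun _ hz =>
    (continuousAt_laplacian (f.contDiffAt_log_q_add hε hz)).continuousWithinAt)
    (f.continuousOn_damped hε p)

/-- Off the zeros the defect is the gradient term, hence nonnegative. -/
theorem defect_eq (hε : 0 < ε) (hz : z ∈ (chartAt ℂ p).target)
    (h0 : f.q ((chartAt ℂ p).symm z) ≠ 0) :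
    f.defect ε p z = ε * f.q ((chartAt ℂ p).symm z) / (f.q ((chartAt ℂ p).symm z) + ε) ^ 2 *
      gradSq (fun w => Real.log (f.q ((chartAt ℂ p).symm w))) z := by
  rw [defect, laplacian_log_add hε (f.analyticAt_D hz) (fun h => h0 ((f.q_eq_zero_iff _).2 h))
    (f.contDiffAt_psi hz) (f.q_eq hz), f.laplacian_psi hz, damped]
  ring

/-- Stokes' theorem for `log (q + ε)`, which is smooth across the zeros. -/
theorem integ_damped (hρ : ρ.IsSubordinate fun p => (chartAt ℂ p).source) (hε : 0 < ε) :
    integ ρ (f.damped ε) = -integ ρ (f.defect ε) := by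
  have h1 := integ_laplacian_eq_zero ρ hρ (u := fun x => Real.log (f.q x + ε))
    fun p z hz => f.contDiffAt_log_q_add hε hz
  have h2 := integ_add ρ hρ (f.continuousOn_defect hε) (f.continuousOn_damped hε)
  simp only [defect, sub_add_cancel] at h2
  rw [h1] at h2
  have h3 : integ ρ (f.defect ε) = integ ρ fun p z => Laplacian.laplacian
    (fun w => Real.log (f.q ((chartAt ℂ p).symm w) + ε)) z - f.damped ε p z := rfl
  rw [h3]
  linarith

theorem ae_mul_defect_nonneg (hε : 0 < ε) (p : X) : ∀ᵐ z ∂(volume.restrict (chartAt ℂ p).target),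
    0 ≤ ρ p ((chartAt ℂ p).symm z) * f.defect ε p z := by
  filter_upwards [f.ae_q_ne_zero (p := p),
    ae_restrict_mem (chartAt ℂ p).open_target.measurableSet] with z h0 hz
  rw [f.defect_eq hε hz h0]
  have h1 := f.q_nonneg ((chartAt ℂ p).symm z)
  exact mul_nonneg (ρ.nonneg p _) (mul_nonneg (by positivity) (gradSq_nonneg _ _))

theorem integ_defect_nonneg (hε : 0 < ε) : 0 ≤ integ ρ (f.defect ε) := by
  rw [integ_eq_sum]
  exact Finset.sum_nonneg fun p _ => integral_nonneg_of_ae (f.ae_mul_defect_nonneg ρ hε p)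

/-- As the defect is nonnegative almost everywhere, any local contribution bounds the total from
below. -/
theorem integral_le_integ_defect (hρ : ρ.IsSubordinate fun p => (chartAt ℂ p).source)
    (hε : 0 < ε) (p : X) {B : Set ℂ} (hBt : B ⊆ (chartAt ℂ p).target) :
    ∫ z in B, ρ p ((chartAt ℂ p).symm z) * f.defect ε p z ≤ integ ρ (f.defect ε) := by
  have h1 : ∫ z in B, ρ p ((chartAt ℂ p).symm z) * f.defect ε p z ≤
      ∫ z in (chartAt ℂ p).target, ρ p ((chartAt ℂ p).symm z) * f.defect ε p z :=
    setIntegral_mono_set (integrableOn_partition_mul ρ hρ p (f.continuousOn_defect hε p))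
      (f.ae_mul_defect_nonneg ρ hε p) (Eventually.of_forall hBt)
  refine h1.trans ?_
  rw [integ_eq_sum]
  by_cases hp : p ∈ pset ρ
  · exact Finset.single_le_sum (f := fun p => ∫ z in (chartAt ℂ p).target,
      ρ p ((chartAt ℂ p).symm z) * f.defect ε p z) (fun q _ =>
      integral_nonneg_of_ae (f.ae_mul_defect_nonneg ρ hε q)) hp
  · simp only [eq_zero_of_notMem_pset ρ hp, zero_mul, integral_zero]
    exact Finset.sum_nonneg fun q _ => integral_nonneg_of_ae (f.ae_mul_defect_nonneg ρ hε q)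

/-- Dominated convergence: the damping factor lies in `[0, 1]` and tends to `1` off the finite set
of zeros. -/
theorem tendsto_integ_damped (hρ : ρ.IsSubordinate fun p => (chartAt ℂ p).source) :
    Tendsto (fun ε => integ ρ (f.damped ε)) (𝓝[>] 0)
      (𝓝 (integ ρ fun p z => N.dens p z - M.dens p z)) := by
  simp only [integ_eq_sum]
  refine tendsto_finsetSum _ fun p _ => ?_
  have hL : ContinuousOn (fun z => N.dens p z - M.dens p z) (chartAt ℂ p).target :=
    (N.continuousOn_dens p).sub (M.continuousOn_dens p)
  refine tendsto_integral_filter_of_dominated_convergence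
    (fun z => ‖ρ p ((chartAt ℂ p).symm z) * (N.dens p z - M.dens p z)‖) ?_ ?_
    (integrableOn_partition_mul ρ hρ p hL).norm ?_
  · filter_upwards [self_mem_nhdsWithin] with ε hε
    exact (integrableOn_partition_mul ρ hρ p (f.continuousOn_damped hε p)).aestronglyMeasurable
  · filter_upwards [self_mem_nhdsWithin] with ε hε
    refine Eventually.of_forall fun z => ?_
    have h1 := f.q_nonneg ((chartAt ℂ p).symm z)
    have hε' : 0 < ε := hε
    rw [damped, mul_left_comm, norm_mul]
    refine mul_le_of_le_one_left (norm_nonneg _) ?_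
    rw [Real.norm_of_nonneg (by positivity)]
    exact div_le_one_of_le₀ (by linarith) (by positivity)
  · filter_upwards [f.ae_q_ne_zero (p := p)] with z hz
    have h1 : Tendsto (fun ε : ℝ => f.q ((chartAt ℂ p).symm z) /
        (f.q ((chartAt ℂ p).symm z) + ε)) (𝓝[>] 0) (𝓝 1) := by
      have : ContinuousAt (fun ε : ℝ => f.q ((chartAt ℂ p).symm z) /
          (f.q ((chartAt ℂ p).symm z) + ε)) 0 :=
        continuousAt_const.div (by fun_prop) (by simpa using hz)
      have h2 := this.tendsto
      rw [add_zero, div_self hz] at h2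
      exact h2.mono_left nhdsWithin_le_nhds
    have h2 := (h1.mul_const (N.dens p z - M.dens p z)).const_mul (ρ p ((chartAt ℂ p).symm z))
    simpa only [one_mul, damped] using h2

/-- Degrees increase along morphisms. -/
theorem deg_le (f : LineHom M N)
    (hρ : ρ.IsSubordinate fun p => (chartAt ℂ p).source) : M.deg ρ ≤ N.deg ρ := by
  -- The degree is `-1 / (4π)` times the integral of the density, so a nonpositive difference of
  -- densities means an increasing degree.
  have h1 : integ ρ (fun p z => N.dens p z - M.dens p z) ≤ 0 := by
    refine le_of_tendsto (f.tendsto_integ_damped ρ hρ) ?_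
    filter_upwards [self_mem_nhdsWithin] with ε hε
    rw [f.integ_damped ρ hρ hε]
    linarith [f.integ_defect_nonneg ρ hε]
  have h2 := HermLine.deg_sub_deg ρ hρ M N
  have h3 : 0 < 1 / (4 * Real.pi) := by positivity
  nlinarith

/-- The degree increases strictly along a morphism with a zero. -/
theorem deg_lt (hρ : ρ.IsSubordinate fun p => (chartAt ℂ p).source) {x : X}
    (hx : f.D x x = 0) : M.deg ρ < N.deg ρ := by
  -- A chart of positive weight at the zero `x`, in which the zero contributes to the integral.
  obtain ⟨p, hp⟩ := ρ.exists_pos_of_mem (Set.mem_univ x)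
  have hxp : x ∈ (chartAt ℂ p).source := hρ p (subset_tsupport _ (Function.mem_support.2 hp.ne'))
  set c := chartAt ℂ p
  have hzt : c x ∈ c.target := c.map_source hxp
  have hsx : c.symm (c x) = x := c.left_inv hxp
  have hDan := f.analyticAt_D hzt
  have hne : ¬ ∀ᶠ z in 𝓝 (c x), f.D (c.symm (c x)) (c.symm z) = 0 := by
    intro h
    rw [hsx] at h
    have h1 : ∀ᶠ y in 𝓝 x, f.D x y = 0 := by
      filter_upwards [(c.continuousAt hxp).eventually h, c.open_source.mem_nhds hxp] with y h1 h2
      rwa [c.left_inv h2] at h1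
    obtain ⟨y, h2, h3⟩ := ((h1.filter_mono nhdsWithin_le_nhds).and (f.ne_zero x)).exists
    exact h3 h2
  obtain ⟨m, k, hm, hk, hr⟩ := exists_annulus_bound hDan (by rw [hsx]; exact hx) hne
    (f.contDiffAt_psi hzt) (f.q_eq hzt)
  have hnear : ∀ᶠ z in 𝓝 (c x), z ∈ c.target ∧ ρ p x / 2 < ρ p (c.symm z) := by
    have h1 : ContinuousAt (fun z => ρ p (c.symm z)) (c x) :=
      (contDiffAt_partition ρ p p hzt).continuousAt
    exact (show ∀ᶠ z in 𝓝 (c x), z ∈ c.target from c.open_target.mem_nhds hzt).and (h1.eventually_const_lt (by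
      change ρ p x / 2 < ρ p (c.symm (c x))
      rw [hsx]
      linarith))
  obtain ⟨R, hR, hball⟩ := Metric.eventually_nhds_iff.1 hnear
  -- On the disc of `exists_annulus_bound` the weighted defect is at least `(ρ p x / 2) * k / r²`;
  -- multiplied by the area `π r² / 4` this no longer depends on `r`.
  have hbound : ∀ᶠ r in 𝓝[>] (0 : ℝ),
      integ ρ (f.damped (r ^ (2 * m))) ≤ -(ρ p x / 2 * k * (Real.pi / 4)) := by
    filter_upwards [hr, Ioo_mem_nhdsGT (show (0 : ℝ) < R / 2 by positivity)] with r hr hrR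
    have hr0 : 0 < r := hrR.1
    have hε : 0 < r ^ (2 * m) := by positivity
    set B := Metric.ball (c x + (3 / 2 * r : ℝ)) (r / 2) with hB
    have hBnear : ∀ z ∈ B, z ∈ c.target ∧ ρ p x / 2 < ρ p (c.symm z) := fun z hz => by
      refine hball ?_
      have h1 : dist z (c x + (3 / 2 * r : ℝ)) < r / 2 := hz
      have h2 : dist (c x + ((3 / 2 * r : ℝ) : ℂ)) (c x) = 3 / 2 * r := by
        rw [dist_eq_norm, add_sub_cancel_left, Complex.norm_real,
          Real.norm_of_nonneg (by positivity)]
      linarith [dist_triangle z (c x + ((3 / 2 * r : ℝ) : ℂ)) (c x), hrR.2]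
    have hpt : ∀ z ∈ B, ρ p x / 2 * (k / r ^ 2) ≤
        ρ p (c.symm z) * f.defect (r ^ (2 * m)) p z := fun z hz => by
      obtain ⟨hz1, hz2⟩ := hBnear z hz
      have h1 := hr z hz
      have h2 : 0 < k / r ^ 2 := by positivity
      have h3 : f.q (c.symm z) ≠ 0 := fun h => by
        rw [h] at h1
        simp only [mul_zero, zero_div, zero_mul] at h1
        exact absurd h1 (not_le.2 h2)
      rw [f.defect_eq hε hz1 h3]
      exact mul_le_mul hz2.le h1 h2.le (ρ.nonneg p _)
    have h4 := setIntegral_ge_of_const_le (μ := (volume : Measure ℂ)) (s := B)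
      Metric.isOpen_ball.measurableSet measure_ball_lt_top.ne hpt
      ((integrableOn_partition_mul ρ hρ p (f.continuousOn_defect hε p)).mono_set
        fun z hz => (hBnear z hz).1)
    have h5 : (volume : Measure ℂ).real B = r ^ 2 / 4 * Real.pi := by
      rw [hB, Measure.real, Complex.volume_ball, ENNReal.toReal_mul, ENNReal.toReal_pow,
        ENNReal.toReal_ofReal (by positivity)]
      simp
      ring
    rw [f.integ_damped ρ hρ hε]
    have h6 := f.integral_le_integ_defect ρ hρ hε p fun z hz => (hBnear z hz).1
    have h7 : ρ p x / 2 * (k / r ^ 2) * (r ^ 2 / 4 * Real.pi) =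
        ρ p x / 2 * k * (Real.pi / 4) := by
      field_simp
    rw [h5, smul_eq_mul, mul_comm, h7] at h4
    linarith
  have hlim : Tendsto (fun r : ℝ => r ^ (2 * m)) (𝓝[>] 0) (𝓝[>] 0) := by
    refine tendsto_nhdsWithin_iff.2 ⟨?_, ?_⟩
    · have : ContinuousAt (fun r : ℝ => r ^ (2 * m)) 0 := by fun_prop
      have h := this.tendsto
      rw [zero_pow (by omega)] at h
      exact h.mono_left nhdsWithin_le_nhds
    · filter_upwards [self_mem_nhdsWithin] with r hr
      exact pow_pos (show (0 : ℝ) < r from hr) _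
  have h1 := le_of_tendsto ((f.tendsto_integ_damped ρ hρ).comp hlim) hbound
  have h2 := HermLine.deg_sub_deg ρ hρ M N
  have h3 : 0 < 1 / (4 * Real.pi) := by positivity
  have h4 : 0 < ρ p x / 2 * k * (Real.pi / 4) := by positivity
  nlinarith

end LineHom

end HermitianLine

/-! ### Minors and linear independence -/

section LinearAlgebra

/-- Row rank equals column rank, so the columns span and some of them form a basis; `J` selects
these. -/
theorem exists_minor_ne_zero {ι κ : Type*} [Fintype ι] [DecidableEq ι] [Fintype κ]
    {v : ι → κ → ℂ} (hv : LinearIndependent ℂ v) :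
    ∃ J : ι → κ, (Matrix.of fun i j => v i (J j)).det ≠ 0 := by
  set M : Matrix ι κ ℂ := Matrix.of v
  have h1 : Module.finrank ℂ (Submodule.span ℂ (Set.range fun k i => v i k)) =
      Module.finrank ℂ (ι → ℂ) := by
    have h2 : M.rank = Fintype.card ι := LinearIndependent.rank_matrix (M := M) hv
    rw [← Matrix.rank_transpose, Matrix.rank_eq_finrank_span_row] at h2
    rw [Module.finrank_pi, ← h2]
    rfl
  have htop := Submodule.eq_top_of_finrank_eq h1
  obtain ⟨κ', a, -, hsp, hli⟩ := exists_linearIndependent' ℂ fun k i => v i k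
  rw [htop] at hsp
  let B := Module.Basis.mk hli hsp.ge
  let e := B.indexEquiv (Pi.basisFun ℂ ι)
  refine ⟨fun j => a (e.symm j), ?_⟩
  rw [← Matrix.det_transpose]
  have h3 : LinearIndependent ℂ (Matrix.of fun i j => v i (a (e.symm j))).transpose.row :=
    hli.comp e.symm e.symm.injective
  exact ((Matrix.isUnit_iff_isUnit_det _).1 (Matrix.linearIndependent_rows_iff_isUnit.1 h3)).ne_zero

theorem linearIndependent_of_det_ne_zero {ι V : Type*} [Fintype ι] [DecidableEq ι]
    [AddCommGroup V] [Module ℂ V] {v : ι → V} {l : ι → V →ₗ[ℂ] ℂ}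
    (h : (Matrix.of fun i j => l j (v i)).det ≠ 0) : LinearIndependent ℂ v := by
  have h1 := Matrix.linearIndependent_rows_of_det_ne_zero h
  exact LinearIndependent.of_comp (LinearMap.pi l) h1

end LinearAlgebra

/-! ### Holomorphic sections, local frames and saturation -/

section Sections

variable {X : Type*} [TopologicalSpace X] [ChartedSpace ℂ X] [IsManifold 𝓘(ℂ) ω X]
  (F : Type*) [NormedAddCommGroup F] [NormedSpace ℂ F]
  {E : X → Type*} [TopologicalSpace (Bundle.TotalSpace F E)] [∀ x, TopologicalSpace (E x)]
  [∀ x, AddCommGroup (E x)] [∀ x, Module ℂ (E x)]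
  [FiberBundle F E]

/-- `s` is a holomorphic section of `E` near `x`. -/
def HolSec (s : ∀ y, E y) (x : X) : Prop :=
  ContMDiffAt 𝓘(ℂ) (𝓘(ℂ).prod 𝓘(ℂ, F)) ω (fun y => Bundle.TotalSpace.mk' F y (s y)) x

/-- `l` is a holomorphic section of the dual bundle near `x`. -/
def HolCo (l : ∀ y, E y →ₗ[ℂ] ℂ) (x : X) : Prop :=
  ∀ᶠ y in 𝓝 x, ∀ s : ∀ y, E y, HolSec F s y → HolAt (fun w => l w (s w)) y

variable {F}

theorem IsHolSection.holSec {U : Set X} (hU : IsOpen U) {s : ∀ y, E y} (h : IsHolSection F U s)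
    {x : X} (hx : x ∈ U) : HolSec F s x :=
  ContMDiffOn.contMDiffAt h (hU.mem_nhds hx)

theorem isHolSection_of_holSec {U : Set X} {s : ∀ y, E y} (h : ∀ x ∈ U, HolSec F s x) :
    IsHolSection F U s := fun x hx => (h x hx).contMDiffWithinAt

theorem HolSec.congr {s t : ∀ y, E y} {x : X} (hs : HolSec F s x) (h : ∀ᶠ y in 𝓝 x, t y = s y) :
    HolSec F t x :=
  ContMDiffAt.congr_of_eventuallyEq hs (h.mono fun y hy => by simp only [hy])

variable [VectorBundle ℂ F E]

theorem HolSec.smul {f : X → ℂ} {s : ∀ y, E y} {x : X} (hf : HolAt f x) (hs : HolSec F s x) :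
    HolSec F (fun y => f y • s y) x := ContMDiffAt.smul_section hf hs

theorem HolSec.const_smul {s : ∀ y, E y} {x : X} (c : ℂ) (hs : HolSec F s x) :
    HolSec F (fun y => c • s y) x := HolSec.smul (holAt_const c x) hs

theorem HolSec.sum {ι : Type*} {I : Finset ι} {s : ι → ∀ y, E y} {x : X}
    (hs : ∀ i ∈ I, HolSec F (s i) x) : HolSec F (fun y => ∑ i ∈ I, s i y) x :=
  ContMDiffAt.sum_section hs

theorem HolSec.sub {s t : ∀ y, E y} {x : X} (hs : HolSec F s x) (ht : HolSec F t x) :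
    HolSec F (fun y => s y - t y) x := ContMDiffAt.sub_section hs ht

variable [ContMDiffVectorBundle ω F E 𝓘(ℂ)]

theorem HolSec.eventually {s : ∀ y, E y} {x : X} (hs : HolSec F s x) :
    ∀ᶠ y in 𝓝 x, HolSec F s y :=
  (contMDiffAt_iff_contMDiffAt_nhds (by simp)).1 hs

theorem HolCo.eventually {l : ∀ y, E y →ₗ[ℂ] ℂ} {x : X} (hl : HolCo F l x) :
    ∀ᶠ y in 𝓝 x, HolCo F l y := eventually_eventually_nhds.2 hl

theorem HolCo.sum_smul {ι : Type*} {I : Finset ι} {l : ι → ∀ y, E y →ₗ[ℂ] ℂ} {a : ι → X → ℂ}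
    {x : X} (hl : ∀ i ∈ I, HolCo F (l i) x) (ha : ∀ i ∈ I, HolAt (a i) x) :
    HolCo F (fun y => ∑ i ∈ I, a i y • l i y) x := by
  have h1 : ∀ᶠ y in 𝓝 x, ∀ i ∈ I, HolAt (a i) y :=
    (Finset.eventually_all I).2 fun i hi => (ha i hi).eventually
  have h2 : ∀ᶠ y in 𝓝 x, ∀ i ∈ I, ∀ s : ∀ y, E y, HolSec F s y → HolAt (fun w => l i w (s w)) y :=
    (Finset.eventually_all I).2 hl
  filter_upwards [h1, h2] with y h1 h2 s hs
  simp only [LinearMap.sum_apply, LinearMap.smul_apply, smul_eq_mul]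
  exact HolAt.sum fun i hi => (h1 i hi).mul (h2 i hi s hs)

variable (F E) in
/-- A holomorphic local frame near `x`, with its dual coframe. -/
structure LocFrame (ι : Type*) [Fintype ι] [DecidableEq ι] (x : X) where
  e : ι → ∀ y, E y
  ε : ι → ∀ y, E y →ₗ[ℂ] ℂ
  hol_e : ∀ i, HolSec F (e i) x
  hol_ε : ∀ i, HolCo F (ε i) x
  dual : ∀ᶠ y in 𝓝 x, ∀ i j, ε i y (e j y) = if i = j then 1 else 0
  total : ∀ᶠ y in 𝓝 x, ∀ v, ∑ i, ε i y v • e i y = v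

namespace LocFrame

variable {ι : Type*} [Fintype ι] [DecidableEq ι] {x : X}

variable (F E) in
/-- The local frame of the preferred trivialization. -/
def triv [FiniteDimensional ℂ F] (x : X) :
    LocFrame F E (Fin (Module.finrank ℂ F)) x :=
  have : ContMDiffVectorBundle 1 F E 𝓘(ℂ) := ContMDiffVectorBundle.of_le le_top
  { e := (trivializationAt F E x).localFrame (Module.finBasis ℂ F)
    ε := fun i => (trivializationAt F E x).localFrameCoeff 𝓘(ℂ) (Module.finBasis ℂ F) i
    hol_e := fun i => contMDiffAt_localFrame_of_mem ω _ _ i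
      (FiberBundle.mem_baseSet_trivializationAt' x)
    hol_ε := fun i => by
      filter_upwards [(trivializationAt F E x).open_baseSet.mem_nhds
        (FiberBundle.mem_baseSet_trivializationAt' x)] with y hy s hs
      exact contMDiffAt_localFrameCoeff _ hy hs i
    dual := by
      filter_upwards [(trivializationAt F E x).open_baseSet.mem_nhds
        (FiberBundle.mem_baseSet_trivializationAt' x)] with y hy i j
      rw [(trivializationAt F E x).localFrameCoeff_apply_of_mem_baseSet _ hy,
        (trivializationAt F E x).localFrame_apply_of_mem_baseSet _ hy, Module.Basis.repr_self,
        Finsupp.single_apply]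
      simp only [eq_comm]
    total := by
      classical
      filter_upwards [(trivializationAt F E x).open_baseSet.mem_nhds
        (FiberBundle.mem_baseSet_trivializationAt' x)] with y hy v
      have h := Bundle.Trivialization.eq_sum_localFrameCoeff_smul (I := 𝓘(ℂ))
        (e := trivializationAt F E x) (b := Module.finBasis ℂ F)
        (s := fun w => if h : w = y then h ▸ v else 0) hy
      simpa using h.symm }

/-- The change of local frame by an invertible matrix of holomorphic functions. -/
def change (f : LocFrame F E ι x) (A : X → Matrix ι ι ℂ)
    (hA : ∀ i j, HolAt (fun y => A y i j) x) (h0 : (A x).det ≠ 0) : LocFrame F E ι x where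
  e j y := ∑ i, A y i j • f.e i y
  ε i y := ∑ j, (A y)⁻¹ i j • f.ε j y
  hol_e j := HolSec.sum fun i _ => HolSec.smul (hA i j) (f.hol_e i)
  hol_ε i := by
    refine HolCo.sum_smul (fun j _ => f.hol_ε j) fun j _ => ?_
    have h : HolAt (fun y => ((A y).det)⁻¹ * (A y).adjugate i j) x := by
      refine ((HolAt.det hA).inv h0).mul ?_
      simp only [Matrix.adjugate_apply]
      refine HolAt.det fun k l => ?_
      by_cases hk : k = j
      · subst hk
        simp only [Matrix.updateRow_self]
        exact holAt_const _ x
      · simp only [Matrix.updateRow_ne hk]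
        exact hA k l
    refine h.congr (Eventually.of_forall fun y => ?_)
    simp [Matrix.inv_def]
  dual := by
    filter_upwards [f.dual, (HolAt.det hA).continuousAt.eventually_ne h0] with y h1 h2 i j
    simp only [map_sum, map_smul, LinearMap.sum_apply, LinearMap.smul_apply, h1, smul_eq_mul,
      mul_ite, mul_one, mul_zero, Finset.sum_ite_eq', Finset.mem_univ, if_true]
    have h3 := congrFun (congrFun (Matrix.nonsing_inv_mul (A y) h2.isUnit) i) j
    rw [Matrix.mul_apply, Matrix.one_apply] at h3
    rw [← h3]
    exact Finset.sum_congr rfl fun k _ => mul_comm _ _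
  total := by
    filter_upwards [f.total, (HolAt.det hA).continuousAt.eventually_ne h0] with y h1 h2 v
    have h3 : ∀ d : ι → ℂ, ∑ i, d i • ∑ k, A y k i • f.e k y =
        ∑ k, (A y).mulVec d k • f.e k y := fun d => by
      simp only [Matrix.mulVec, dotProduct, Finset.smul_sum, Finset.sum_smul, smul_smul]
      rw [Finset.sum_comm]
      simp only [mul_comm]
    have h4 : (fun i => (∑ j, (A y)⁻¹ i j • f.ε j y) v) =
        (A y)⁻¹.mulVec fun j => f.ε j y v := by
      funext i
      simp [Matrix.mulVec, dotProduct]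
    rw [h3 fun i => (∑ j, (A y)⁻¹ i j • f.ε j y) v, h4, Matrix.mulVec_mulVec,
      Matrix.mul_nonsing_inv _ h2.isUnit, Matrix.one_mulVec]
    exact h1 v

/-- Replacing the sections of a local frame by sections equal to them near `x`. -/
def withFrame (f : LocFrame F E ι x) (w : ι → ∀ y, E y)
    (h : ∀ᶠ y in 𝓝 x, ∀ i, w i y = f.e i y) : LocFrame F E ι x where
  e := w
  ε := f.ε
  hol_e i := (f.hol_e i).congr (h.mono fun _ hy => hy i)
  hol_ε := f.hol_ε
  dual := by
    filter_upwards [h, f.dual] with y h1 h2 i j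
    rw [h1, h2]
  total := by
    filter_upwards [h, f.total] with y h1 h2 v
    simp only [h1, h2]

/-- Reindexing a local frame. -/
def reindex {κ : Type*} [Fintype κ] [DecidableEq κ] (f : LocFrame F E ι x) (σ : κ ≃ ι) :
    LocFrame F E κ x where
  e i := f.e (σ i)
  ε i := f.ε (σ i)
  hol_e i := f.hol_e _
  hol_ε i := f.hol_ε _
  dual := by
    filter_upwards [f.dual] with y hy i j
    rw [hy]
    simp
  total := by
    filter_upwards [f.total] with y hy v
    rw [Equiv.sum_comp σ fun i => f.ε i y v • f.e i y, hy]

theorem linearIndependent (f : LocFrame F E ι x) :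
    ∀ᶠ y in 𝓝 x, LinearIndependent ℂ fun i => f.e i y := by
  filter_upwards [f.dual] with y hy
  refine linearIndependent_of_det_ne_zero (l := fun i => f.ε i y) ?_
  have : (Matrix.of fun i j => f.ε j y (f.e i y)) = 1 := by
    ext i j
    simp [hy, Matrix.one_apply, eq_comm]
  simp [this]

theorem holAt_coeff (f : LocFrame F E ι x) {s : ∀ y, E y} (hs : HolSec F s x) (i : ι) :
    HolAt (fun y => f.ε i y (s y)) x := (f.hol_ε i).self_of_nhds s hs

/-- A section vanishing at `x` is divisible by the coordinate. -/
theorem exists_eq_coord_smul (f : LocFrame F E ι x) {s : ∀ y, E y} (hs : HolSec F s x)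
    (h0 : s x = 0) : ∃ t : ∀ y, E y, HolSec F t x ∧ ∀ᶠ y in 𝓝 x, s y = coord x y • t y := by
  have h1 : ∀ i, ∃ g : X → ℂ, HolAt g x ∧ ∀ᶠ y in 𝓝 x, f.ε i y (s y) = coord x y * g y :=
    fun i => (f.holAt_coeff hs i).exists_eq_coord_mul (by simp [h0])
  choose g hg hg' using h1
  refine ⟨fun y => ∑ i, g i y • f.e i y, HolSec.sum fun i _ => HolSec.smul (hg i) (f.hol_e i), ?_⟩
  filter_upwards [f.total, eventually_all.2 hg'] with y h1 h2
  conv_lhs => rw [← h1 (s y)]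
  simp only [h2, Finset.smul_sum, smul_smul]

/-- A family of holomorphic sections is either detected by a nonvanishing minor off `x`, or it is
linearly dependent near `x`. -/
theorem exists_minor (f : LocFrame F E ι x) {κ : Type*} [Fintype κ] [DecidableEq κ]
    {v : κ → ∀ y, E y} (hv : ∀ i, HolSec F (v i) x) :
    (∃ J : κ → ι, ∀ᶠ y in 𝓝[≠] x, (Matrix.of fun i j => f.ε (J j) y (v i y)).det ≠ 0) ∨
      ∀ᶠ y in 𝓝 x, ¬ LinearIndependent ℂ fun i => v i y := by
  classical
  rw [or_iff_not_imp_left]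
  intro h
  push Not at h
  -- Every minor is holomorphic, hence zero near `x` or nonvanishing off `x` near `x`.
  have h1 : ∀ J : κ → ι, ∀ᶠ y in 𝓝 x, (Matrix.of fun i j => f.ε (J j) y (v i y)).det = 0 :=
    fun J => (HolAt.eq_zero_or_ne_zero (HolAt.det fun i j =>
      f.holAt_coeff (hv i) (J j))).resolve_right (h J)
  filter_upwards [eventually_all.2 h1, f.total] with y h2 h3 hli
  have h4 : LinearIndependent ℂ fun i k => f.ε k y (v i y) := by
    refine hli.map' (LinearMap.pi fun k => f.ε k y) (LinearMap.ker_eq_bot'.2 fun w hw => ?_)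
    rw [← h3 w]
    refine Finset.sum_eq_zero fun k _ => ?_
    have : f.ε k y w = 0 := congrFun hw k
    rw [this, zero_smul]
  obtain ⟨J, hJ⟩ := exists_minor_ne_zero h4
  exact hJ (h2 J)

/-- Saturation: a family of holomorphic sections independent off `x` can be replaced by one
independent at `x` with the same span off `x`. -/
theorem exists_saturation (f : LocFrame F E ι x) {κ : Type*} [Fintype κ] [DecidableEq κ]
    {s : κ → ∀ y, E y} (hs : ∀ i, HolSec F (s i) x)
    (hli : ∀ᶠ y in 𝓝[≠] x, LinearIndependent ℂ fun i => s i y) :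
    ∃ t : κ → ∀ y, E y, (∀ i, HolSec F (t i) x) ∧ (LinearIndependent ℂ fun i => t i x) ∧
      ∀ᶠ y in 𝓝[≠] x, ∀ i, t i y ∈ Submodule.span ℂ (Set.range fun j => s j y) := by
  classical
  rcases f.exists_minor hs with ⟨J, hJ⟩ | h
  swap
  · obtain ⟨y, h1, h2⟩ := (hli.and (h.filter_mono nhdsWithin_le_nhds)).exists
    exact absurd h1 h2
  clear hli
  -- Induction on the order `m` at `x` of a minor. A linear relation at `x` gives a combination of
  -- the sections divisible by the coordinate; replacing one section of the relation by the quotient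
  -- lowers the order by one and keeps the span off `x`. The unit `u` need only be continuous, since
  -- the identity is used off `x`.
  have key : ∀ (m : ℕ) (s : κ → ∀ y, E y), (∀ i, HolSec F (s i) x) →
      (∃ u : X → ℂ, ContinuousAt u x ∧ u x ≠ 0 ∧ ∀ᶠ y in 𝓝[≠] x,
        (Matrix.of fun i j => f.ε (J j) y (s i y)).det = coord x y ^ m * u y) →
      ∃ t : κ → ∀ y, E y, (∀ i, HolSec F (t i) x) ∧ (LinearIndependent ℂ fun i => t i x) ∧
        ∀ᶠ y in 𝓝[≠] x, ∀ i, t i y ∈ Submodule.span ℂ (Set.range fun j => s j y) := by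
    intro m
    induction m with
    | zero =>
      rintro s hs ⟨u, hu, hu0, h⟩
      refine ⟨s, hs, linearIndependent_of_det_ne_zero (l := fun j => f.ε (J j) x) ?_,
        Eventually.of_forall fun y i => Submodule.subset_span ⟨i, rfl⟩⟩
      -- In order zero the minor is nonzero at `x` itself, by comparing limits.
      have h1 := (HolAt.det fun i j => f.holAt_coeff (hs i) (J j)).continuousAt.tendsto
      have h2 : Tendsto u (𝓝[≠] x) (𝓝 (u x)) := hu.tendsto.mono_left nhdsWithin_le_nhds
      have h3 := (h1.mono_left nhdsWithin_le_nhds).congr' h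
      simp only [pow_zero, one_mul] at h3
      exact (tendsto_nhds_unique h3 h2).symm ▸ hu0
    | succ m ih =>
      rintro s hs ⟨u, hu, hu0, h⟩
      by_cases hx : LinearIndependent ℂ fun i => s i x
      · exact ⟨s, hs, hx, Eventually.of_forall fun y i => Submodule.subset_span ⟨i, rfl⟩⟩
      obtain ⟨c, hc, k, hk⟩ := Fintype.not_linearIndependent_iff.1 hx
      obtain ⟨t, ht, hst⟩ := f.exists_eq_coord_smul (s := fun y => ∑ i, c i • s i y)
        (HolSec.sum fun i _ => (hs i).const_smul (c i)) hc
      have hmem : ∀ᶠ y in 𝓝[≠] x, t y ∈ Submodule.span ℂ (Set.range fun j => s j y) := by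
        filter_upwards [hst.filter_mono nhdsWithin_le_nhds, coord_ne_zero x] with y h1 h2
        rw [← inv_smul_smul₀ h2 (t y), ← h1]
        exact Submodule.smul_mem _ _ (Submodule.sum_mem _ fun i _ =>
          Submodule.smul_mem _ _ (Submodule.subset_span ⟨i, rfl⟩))
      obtain ⟨t', ht', hli', hsp'⟩ := ih (Function.update s k t) (fun i => by
        by_cases hi : i = k
        · subst hi; simpa using ht
        · simpa [hi] using hs i) ⟨fun y => c k * u y, continuousAt_const.mul hu,
          mul_ne_zero hk hu0, by
        filter_upwards [h, hst.filter_mono nhdsWithin_le_nhds, coord_ne_zero x] with y h1 h2 h3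
        -- The coordinate times the new row is the combination `∑ c i • s i` of the old rows, and
        -- only its `k`-th term contributes to the determinant.
        have e1 : coord x y * (Matrix.of fun i j => f.ε (J j) y (Function.update s k t i y)).det =
            c k * (Matrix.of fun i j => f.ε (J j) y (s i y)).det := by
          have e2 : (Matrix.of fun i j => f.ε (J j) y (Function.update s k t i y)) =
              (Matrix.of fun i j => f.ε (J j) y (s i y)).updateRow k fun j => f.ε (J j) y (t y) := by
            ext i j
            by_cases hi : i = k
            · subst hi; simp
            · simp [hi]
          rw [e2, ← smul_eq_mul (c k), ← Matrix.det_updateRow_sum, ← Matrix.det_updateRow_smul]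
          congr 2
          funext j
          have h4 := congrArg (f.ε (J j) y) h2
          simp only [map_sum, map_smul, smul_eq_mul] at h4
          simp [h4]
        rw [h1] at e1
        refine mul_left_cancel₀ h3 (e1.trans ?_)
        ring⟩
      refine ⟨t', ht', hli', ?_⟩
      filter_upwards [hsp', hmem] with y h1 h2 i
      refine Submodule.span_le.2 ?_ (h1 i)
      rintro _ ⟨j, rfl⟩
      by_cases hj : j = k
      · subst hj; simpa using h2
      · have h3 : s j y ∈ Submodule.span ℂ (Set.range fun j => s j y) :=
          Submodule.subset_span ⟨j, rfl⟩
        simpa [hj] using h3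
  rcases HolAt.eq_zero_or_pow (HolAt.det fun i j => f.holAt_coeff (hs i) (J j)) with h | h
  · obtain ⟨y, h1, h2⟩ := (hJ.and (h.filter_mono nhdsWithin_le_nhds)).exists
    exact absurd h2 h1
  · obtain ⟨m, u, hu, hu0, h⟩ := h
    exact key m s hs ⟨u, hu.continuousAt, hu0, h.filter_mono nhdsWithin_le_nhds⟩

/-- Holomorphic sections which are independent at `x` extend to a local frame. -/
theorem exists_extension [FiniteDimensional ℂ F] {κ : Type*} [Fintype κ] [DecidableEq κ]
    {v : κ → ∀ y, E y} (hv : ∀ i, HolSec F (v i) x) (hli : LinearIndependent ℂ fun i => v i x) :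
    ∃ (m : ℕ) (g : LocFrame F E (κ ⊕ Fin m) x), ∀ i, g.e (Sum.inl i) = v i := by
  classical
  set f := LocFrame.triv F E x
  have hb : ∃ b : Module.Basis (Fin (Module.finrank ℂ F)) ℂ (E x), ∀ i, b i = f.e i x :=
    ⟨Module.Basis.mk f.linearIndependent.self_of_nhds fun w _ => by
      rw [← f.total.self_of_nhds w]
      exact Submodule.sum_mem _ fun i _ => Submodule.smul_mem _ _ (Submodule.subset_span ⟨i, rfl⟩),
      fun i => by simp⟩
  obtain ⟨b, hb⟩ := hb
  let B := Module.Basis.sumExtend hli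
  have := Module.Finite.of_basis b
  have hfin : Finite (κ ⊕ Module.Basis.sumExtendIndex hli) := Module.Finite.finite_basis B
  have hfin' : Finite (Module.Basis.sumExtendIndex hli) :=
    Finite.of_injective (Sum.inr (α := κ)) Sum.inr_injective
  obtain ⟨m, ⟨σ⟩⟩ := Finite.exists_equiv_fin (Module.Basis.sumExtendIndex hli)
  let B' := B.reindex ((Equiv.refl κ).sumCongr σ)
  have hB' : ∀ i, B' (Sum.inl i) = v i x := fun i => by
    simp only [B', B, Module.Basis.reindex_apply, Equiv.sumCongr_symm, Equiv.sumCongr_apply,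
      Sum.map_inl, Equiv.refl_symm, Equiv.refl_apply, Module.Basis.sumExtend,
      Module.Basis.extend_apply_self]
    rfl
  let f' := f.reindex (B'.indexEquiv b)
  -- The added basis vectors at `x` are extended with constant coefficients in the old frame.
  let w : κ ⊕ Fin m → ∀ y, E y := Sum.elim v fun k y => ∑ i, f'.ε i x (B' (Sum.inr k)) • f'.e i y
  have hw : ∀ i, HolSec F (w i) x := by
    rintro (i | k)
    · exact hv i
    · exact HolSec.sum fun i _ => (f'.hol_e i).const_smul _
  have hwx : ∀ i, w i x = B' i := by
    rintro (i | k)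
    · exact (hB' i).symm
    · exact f'.total.self_of_nhds _
  let A : X → Matrix (κ ⊕ Fin m) (κ ⊕ Fin m) ℂ := fun y => Matrix.of fun i j => f'.ε i y (w j y)
  have hA : ∀ i j, HolAt (fun y => A y i j) x := fun i j => f'.holAt_coeff (hw j) i
  have h0 : (A x).det ≠ 0 := by
    rw [← Matrix.det_transpose]
    refine IsUnit.ne_zero ((Matrix.isUnit_iff_isUnit_det _).1
      (Matrix.linearIndependent_rows_iff_isUnit.1 ?_))
    have h1 : (A x).transpose.row = fun j => (LinearMap.pi fun i => f'.ε i x) (B' j) := by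
      funext j i
      simp [A, Matrix.row, hwx]
    rw [h1]
    refine B'.linearIndependent.map' _ (LinearMap.ker_eq_bot'.2 fun u hu => ?_)
    rw [← f'.total.self_of_nhds u]
    refine Finset.sum_eq_zero fun k _ => ?_
    have : f'.ε k x u = 0 := congrFun hu k
    rw [this, zero_smul]
  refine ⟨m, (f'.change A hA h0).withFrame w ?_, fun i => rfl⟩
  filter_upwards [f'.total] with y hy i
  exact (hy (w i y)).symm

/-- The span of sections independent at `x` is closed under limits of holomorphic sections. -/
theorem mem_span_of_punctured [FiniteDimensional ℂ F] {κ : Type*} [Fintype κ] [DecidableEq κ]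
    {v : κ → ∀ y, E y} (hv : ∀ i, HolSec F (v i) x) (hli : LinearIndependent ℂ fun i => v i x)
    {s : ∀ y, E y} (hs : HolSec F s x)
    (h : ∀ᶠ y in 𝓝[≠] x, s y ∈ Submodule.span ℂ (Set.range fun i => v i y)) :
    s x ∈ Submodule.span ℂ (Set.range fun i => v i x) := by
  obtain ⟨m, g, hg⟩ := exists_extension hv hli
  -- The complementary coordinates of `s` vanish off `x`, hence at `x` by continuity.
  have h0 : ∀ k, g.ε (Sum.inr k) x (s x) = 0 := fun k => by
    have h1 := (g.holAt_coeff hs (Sum.inr k)).continuousAt.tendsto.mono_left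
      (nhdsWithin_le_nhds (s := {x}ᶜ))
    refine tendsto_nhds_unique (h1.congr' ?_) tendsto_const_nhds
    filter_upwards [h, g.dual.filter_mono nhdsWithin_le_nhds] with y h1 h2
    have h3 : Submodule.span ℂ (Set.range fun i => v i y) ≤ LinearMap.ker (g.ε (Sum.inr k) y) := by
      refine Submodule.span_le.2 ?_
      rintro _ ⟨i, rfl⟩
      simpa [hg] using h2 (Sum.inr k) (Sum.inl i)
    exact h3 h1
  rw [← g.total.self_of_nhds (s x)]
  refine Submodule.sum_mem _ fun i _ => ?_
  rcases i with i | k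
  · exact Submodule.smul_mem _ _ (Submodule.subset_span ⟨i, by simp [hg]⟩)
  · simp [h0]

theorem linearIndependent_nhds [FiniteDimensional ℂ F] {κ : Type*} [Fintype κ] [DecidableEq κ]
    {v : κ → ∀ y, E y} (hv : ∀ i, HolSec F (v i) x) (hli : LinearIndependent ℂ fun i => v i x) :
    ∀ᶠ y in 𝓝 x, LinearIndependent ℂ fun i => v i y := by
  obtain ⟨m, g, hg⟩ := exists_extension hv hli
  filter_upwards [g.linearIndependent] with y hy
  have := hy.comp Sum.inl Sum.inl_injective
  simpa [Function.comp_def, hg] using this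

end LocFrame

end Sections

/-! ### Generic kernel and image of a holomorphic map -/

section Splitting

variable {X : Type*} [TopologicalSpace X] [ChartedSpace ℂ X] [IsManifold 𝓘(ℂ) ω X]
  (F : Type*) [NormedAddCommGroup F] [NormedSpace ℂ F] [FiniteDimensional ℂ F]
  {E : X → Type*} [TopologicalSpace (Bundle.TotalSpace F E)] [∀ x, TopologicalSpace (E x)]
  [∀ x, AddCommGroup (E x)] [∀ x, Module ℂ (E x)]
  [FiberBundle F E] [VectorBundle ℂ F E] [ContMDiffVectorBundle ω F E 𝓘(ℂ)]
  (F' : Type*) [NormedAddCommGroup F'] [NormedSpace ℂ F'] [FiniteDimensional ℂ F']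
  {E' : X → Type*} [TopologicalSpace (Bundle.TotalSpace F' E')] [∀ x, TopologicalSpace (E' x)]
  [∀ x, AddCommGroup (E' x)] [∀ x, Module ℂ (E' x)]
  [FiberBundle F' E'] [VectorBundle ℂ F' E'] [ContMDiffVectorBundle ω F' E' 𝓘(ℂ)]

/-- A fibrewise linear map which is holomorphic near `x`. -/
def HolLin (g : ∀ y, E y →ₗ[ℂ] E' y) (x : X) : Prop :=
  ∀ᶠ y in 𝓝 x, ∀ s : ∀ y, E y, HolSec F s y → HolSec F' (fun w => g w (s w)) y

variable {F F'}

theorem IsHolMap.holLin {g : ∀ y, E y →ₗ[ℂ] E' y} (hg : IsHolMap F F' g) (x : X) :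
    HolLin F F' g x := Eventually.of_forall fun y s hs => by
  obtain ⟨_, hU, hUo, hy⟩ := eventually_nhds_iff.1 hs.eventually
  exact (hg _ s hUo (isHolSection_of_holSec hU)).holSec hUo hy

theorem finrank_add_eq {V V' : Type*} [AddCommGroup V] [Module ℂ V] [AddCommGroup V'] [Module ℂ V']
    (g : V →ₗ[ℂ] V') (S : Submodule ℂ V) [FiniteDimensional ℂ S] :
    Module.finrank ℂ (S ⊓ LinearMap.ker g : Submodule ℂ V) + Module.finrank ℂ (S.map g) =
      Module.finrank ℂ S := by
  have h := LinearMap.finrank_range_add_finrank_ker (g.domRestrict S)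
  have h1 : Module.finrank ℂ (LinearMap.ker (g.domRestrict S)) =
      Module.finrank ℂ (S ⊓ LinearMap.ker g : Submodule ℂ V) := by
    rw [← Submodule.map_comap_subtype, LinearMap.domRestrict, LinearMap.ker_comp]
    exact (Submodule.finrank_map_subtype_eq ..).symm
  rw [LinearMap.range_domRestrict, h1] at h
  omega

theorem exists_dual_family {κ V : Type*} [DecidableEq κ] [AddCommGroup V] [Module ℂ V] {v : κ → V}
    (hv : LinearIndependent ℂ v) :
    ∃ φ : κ → V →ₗ[ℂ] ℂ, ∀ i j, φ i (v j) = if i = j then 1 else 0 := by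
  obtain ⟨g, hg⟩ := LinearMap.exists_leftInverse_of_injective
    (Finsupp.linearCombination ℂ v) (LinearMap.ker_eq_bot.2 hv)
  refine ⟨fun i => Finsupp.lapply i ∘ₗ g, fun i j => ?_⟩
  have h := LinearMap.congr_fun hg (Finsupp.single j 1)
  simp only [LinearMap.comp_apply, Finsupp.linearCombination_single, one_smul,
    LinearMap.id_apply] at h
  simp [h, Finsupp.single_apply, eq_comm]

/-- Near `x`, the kernel and the image of a holomorphic map on the span of a holomorphic frame are
spanned, off `x`, by holomorphic frames which extend across `x`. -/
theorem exists_kernel_image_frames {x : X} {κ : Type*} [Fintype κ] [DecidableEq κ]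
    {s : κ → ∀ y, E y} (hs : ∀ i, HolSec F (s i) x)
    (hli : ∀ᶠ y in 𝓝 x, LinearIndependent ℂ fun i => s i y)
    {g : ∀ y, E y →ₗ[ℂ] E' y} (hg : HolLin F F' g x) :
    ∃ (a b : ℕ) (k : Fin a → ∀ y, E y) (t : Fin b → ∀ y, E' y),
      (∀ i, HolSec F (k i) x) ∧ (LinearIndependent ℂ fun i => k i x) ∧
      (∀ i, HolSec F' (t i) x) ∧ (LinearIndependent ℂ fun i => t i x) ∧
      ∀ᶠ y in 𝓝[≠] x,
        Submodule.span ℂ (Set.range fun i => k i y) =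
          Submodule.span ℂ (Set.range fun i => s i y) ⊓ LinearMap.ker (g y) ∧
        Submodule.span ℂ (Set.range fun i => t i y) =
          (Submodule.span ℂ (Set.range fun i => s i y)).map (g y) := by
  classical
  set f := LocFrame.triv F E x
  set f' := LocFrame.triv F' E' x
  have hgs : ∀ i, HolSec F' (fun y => g y (s i y)) x := fun i => hg.self_of_nhds _ (hs i)
  -- A largest `J` whose images are independent off `x` gives the generic image; by maximality the
  -- other images depend on it.
  let P : Finset κ → Prop := fun J =>
    ∀ᶠ y in 𝓝[≠] x, LinearIndepOn ℂ (fun i => g y (s i y)) (J : Set κ)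
  have hP : (Finset.univ.filter P).Nonempty := ⟨∅, by simp [P]⟩
  obtain ⟨J, hJ, hmax⟩ := Finset.exists_max_image _ Finset.card hP
  have hPJ : P J := (Finset.mem_filter.1 hJ).2
  obtain ⟨K, hK⟩ | hdep := f'.exists_minor (v := fun (i : J) y => g y (s i y)) fun i => hgs i
  swap
  · obtain ⟨y, h1, h2⟩ := (hPJ.and (hdep.filter_mono nhdsWithin_le_nhds)).exists
    exact absurd h1 h2
  have hspan : ∀ i ∉ J, ∀ᶠ y in 𝓝[≠] x,
      g y (s i y) ∈ Submodule.span ℂ (Set.range fun j : J => g y (s j y)) := by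
    intro i hi
    obtain ⟨K', hK'⟩ | hdep := f'.exists_minor
      (v := fun (i' : (insert i J : Finset κ)) y => g y (s i' y)) fun i => hgs i
    · have h1 : P (insert i J) := hK'.mono fun y hy =>
        linearIndependent_of_det_ne_zero (l := fun j => f'.ε (K' j) y) hy
      have h2 := hmax _ (Finset.mem_filter.2 ⟨Finset.mem_univ _, h1⟩)
      rw [Finset.card_insert_of_notMem hi] at h2
      omega
    · filter_upwards [hPJ, hdep.filter_mono nhdsWithin_le_nhds] with y h1 h2
      by_contra h3
      apply h2
      have h4 : LinearIndepOn ℂ (fun i => g y (s i y)) (insert i (J : Set κ)) := by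
        refine h1.insert ?_
        convert! h3 using 3
        ext w
        simp
      rw [← Finset.coe_insert] at h4
      exact h4
  set A : X → Matrix J J ℂ := fun y => Matrix.of fun i j => f'.ε (K j) y (g y (s i y))
  have hA : ∀ i j, HolAt (fun y => A y i j) x := fun i j => f'.holAt_coeff (hgs i) _
  -- Cramer's rule: the adjugate gives holomorphic coefficients for the relations between images,
  -- with denominators cleared.
  let n : κ → J → X → ℂ := fun i j y => ∑ l, f'.ε (K l) y (g y (s i y)) * (A y).adjugate l j
  have hn : ∀ i j, HolAt (n i j) x := fun i j => HolAt.sum fun l _ => by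
    refine (f'.holAt_coeff (hgs i) _).mul ?_
    simp only [Matrix.adjugate_apply]
    refine HolAt.det fun k k' => ?_
    by_cases hk : k = j
    · subst hk
      simp only [Matrix.updateRow_self]
      exact holAt_const _ x
    · simp only [Matrix.updateRow_ne hk]
      exact hA k k'
  have hcramer : ∀ i ∉ J, ∀ᶠ y in 𝓝[≠] x,
      (A y).det • g y (s i y) = ∑ j : J, n i j y • g y (s j y) := by
    intro i hi
    filter_upwards [hspan i hi] with y hy
    obtain ⟨c, hc⟩ := (Submodule.mem_span_range_iff_exists_fun ℂ).1 hy
    have h1 : (fun l => f'.ε (K l) y (g y (s i y))) = Matrix.vecMul c (A y) := by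
      funext l
      rw [← hc]
      simp [Matrix.vecMul, dotProduct, A]
    have h2 : (fun j => n i j y) = (A y).det • c := by
      have h3 : (fun j => n i j y) = Matrix.vecMul (fun l => f'.ε (K l) y (g y (s i y)))
        (A y).adjugate := rfl
      rw [h3, h1, Matrix.vecMul_vecMul, Matrix.mul_adjugate, Matrix.vecMul_smul, Matrix.vecMul_one]
    have h3 : ∀ j, n i j y = (A y).det * c j := fun j => congrFun h2 j
    rw [← hc, Finset.smul_sum]
    simp only [h3, smul_smul]
  -- These relations are kernel sections. Their coefficients along `s i` for `i ∉ J` form `det A`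
  -- times the identity, so they are independent wherever `det A` is nonzero.
  let k0 : {i // i ∉ J} → ∀ y, E y := fun i y => (A y).det • s i y - ∑ j : J, n i j y • s j y
  have hk0 : ∀ i, HolSec F (k0 i) x := fun i => ((hs i).smul (HolAt.det hA)).sub
    (HolSec.sum fun j _ => (hs j).smul (hn i j))
  have hk0li : ∀ᶠ y in 𝓝[≠] x, LinearIndependent ℂ fun i => k0 i y := by
    filter_upwards [hK, hli.filter_mono nhdsWithin_le_nhds] with y h1 h2
    obtain ⟨φ, hφ⟩ := exists_dual_family h2
    refine linearIndependent_of_det_ne_zero (l := fun i => φ i) ?_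
    have e : (Matrix.of fun (i j : {i // i ∉ J}) => φ j (k0 i y)) = (A y).det • 1 := by
      ext i j
      have h3 : ∀ l : J, (j : κ) ≠ l := fun l h => j.2 (h ▸ l.2)
      simp [k0, hφ, h3, Matrix.one_apply, Subtype.ext_iff, eq_comm]
    rw [e, Matrix.det_smul, Matrix.det_one, mul_one]
    exact pow_ne_zero _ h1
  obtain ⟨k, hk, hkli, hksp⟩ := f.exists_saturation hk0 hk0li
  obtain ⟨t, ht, htli, htsp⟩ := f'.exists_saturation (s := fun (i : J) y => g y (s i y))
    (fun i => hgs i) hPJ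
  let σ := Fintype.equivFin {i // i ∉ J}
  let τ := Fintype.equivFin J
  refine ⟨_, _, fun i => k (σ.symm i), fun i => t (τ.symm i), fun i => hk _,
    hkli.comp _ σ.symm.injective, fun i => ht _, htli.comp _ τ.symm.injective, ?_⟩
  have hcard : Fintype.card {i // i ∉ J} + Fintype.card J = Fintype.card κ := by
    rw [Fintype.card_subtype_compl, Fintype.card_coe]
    exact Nat.sub_add_cancel (Finset.card_le_univ J)
  have hker : ∀ᶠ y in 𝓝[≠] x, ∀ i, k0 i y ∈
      Submodule.span ℂ (Set.range fun i => s i y) ⊓ LinearMap.ker (g y) := by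
    filter_upwards [eventually_all.2 fun i : {i // i ∉ J} => hcramer i i.2] with y h1 i
    refine ⟨Submodule.sub_mem _ (Submodule.smul_mem _ _ (Submodule.subset_span ⟨_, rfl⟩))
      (Submodule.sum_mem _ fun j _ => Submodule.smul_mem _ _ (Submodule.subset_span ⟨_, rfl⟩)), ?_⟩
    simp [k0, h1]
  filter_upwards [hker, hksp, htsp, hli.filter_mono nhdsWithin_le_nhds,
    (LocFrame.linearIndependent_nhds hk hkli).filter_mono nhdsWithin_le_nhds,
    (LocFrame.linearIndependent_nhds ht htli).filter_mono nhdsWithin_le_nhds]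
    with y h1 h2 h3 h4 h5 h6
  have := FiniteDimensional.span_of_finite ℂ (Set.finite_range fun i => s i y)
  have e1 : (Set.range fun i => k (σ.symm i) y) = Set.range fun i => k i y :=
    σ.symm.surjective.range_comp fun i => k i y
  have e2 : (Set.range fun i => t (τ.symm i) y) = Set.range fun i => t i y :=
    τ.symm.surjective.range_comp fun i => t i y
  rw [e1, e2]
  have l1 : Submodule.span ℂ (Set.range fun i => k i y) ≤
      Submodule.span ℂ (Set.range fun i => s i y) ⊓ LinearMap.ker (g y) := by
    refine Submodule.span_le.2 ?_
    rintro _ ⟨i, rfl⟩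
    refine Submodule.span_le.2 ?_ (h2 i)
    rintro _ ⟨j, rfl⟩
    exact h1 j
  have l2 : Submodule.span ℂ (Set.range fun i => t i y) ≤
      (Submodule.span ℂ (Set.range fun i => s i y)).map (g y) := by
    refine Submodule.span_le.2 ?_
    rintro _ ⟨i, rfl⟩
    refine Submodule.span_le.2 ?_ (h3 i)
    rintro _ ⟨j, rfl⟩
    exact Submodule.mem_map_of_mem (Submodule.subset_span ⟨_, rfl⟩)
  -- The two saturated frames together have as many members as `s`, so rank–nullity turns both
  -- inclusions into equalities.
  have d := finrank_add_eq (g y) (Submodule.span ℂ (Set.range fun i => s i y))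
  rw [finrank_span_eq_card h4, ← hcard] at d
  have d1 := Submodule.finrank_mono l1
  have d2 := Submodule.finrank_mono l2
  rw [finrank_span_eq_card h5] at d1
  rw [finrank_span_eq_card h6] at d2
  exact ⟨Submodule.eq_of_le_of_finrank_le l1 (by rw [finrank_span_eq_card h5]; omega),
    Submodule.eq_of_le_of_finrank_le l2 (by rw [finrank_span_eq_card h6]; omega)⟩

end Splitting

/-! ### Holomorphic subbundles from generic data -/

section Subbundles

variable {X : Type*} [TopologicalSpace X] [ChartedSpace ℂ X] [IsManifold 𝓘(ℂ) ω X]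
  {F : Type*} [NormedAddCommGroup F] [NormedSpace ℂ F] [FiniteDimensional ℂ F]
  {E : X → Type*} [TopologicalSpace (Bundle.TotalSpace F E)] [∀ x, TopologicalSpace (E x)]
  [∀ x, AddCommGroup (E x)] [∀ x, Module ℂ (E x)]
  [FiberBundle F E] [VectorBundle ℂ F E] [ContMDiffVectorBundle ω F E 𝓘(ℂ)]

namespace HolSubbundle

theorem holSec_frameAt (S : HolSubbundle F E) (x : X) (i : Fin S.rank) :
    HolSec F (S.frameAt x i) x := by
  have h := (S.exists_frame x).choose_spec
  exact (h.2.2.choose_spec.1 i).holSec h.1 h.2.1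

theorem eventually_frameAt (S : HolSubbundle F E) (x : X) : ∀ᶠ y in 𝓝 x,
    LinearIndependent ℂ (fun i => S.frameAt x i y) ∧
      Submodule.span ℂ (Set.range fun i => S.frameAt x i y) = S.fiber y := by
  have h := (S.exists_frame x).choose_spec
  filter_upwards [h.1.mem_nhds h.2.1] with y hy using h.2.2.choose_spec.2 y hy

theorem finiteDimensional_fiber (S : HolSubbundle F E) (x : X) :
    FiniteDimensional ℂ (S.fiber x) := by
  rw [← (S.eventually_frameAt x).self_of_nhds.2]
  exact FiniteDimensional.span_of_finite ℂ (Set.finite_range _)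

theorem finrank_fiber (S : HolSubbundle F E) (x : X) :
    Module.finrank ℂ (S.fiber x) = S.rank := by
  have h := (S.eventually_frameAt x).self_of_nhds
  rw [← h.2, finrank_span_eq_card h.1, Fintype.card_fin]

/-- A subbundle from local holomorphic frames. -/
def ofLocal (A : ∀ y, Submodule ℂ (E y)) (r : ℕ)
    (h : ∀ x, ∃ v : Fin r → ∀ y, E y, (∀ i, HolSec F (v i) x) ∧ ∀ᶠ y in 𝓝 x,
      LinearIndependent ℂ (fun i => v i y) ∧ Submodule.span ℂ (Set.range fun i => v i y) = A y) :
    HolSubbundle F E where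
  fiber := A
  rank := r
  exists_frame x := by
    obtain ⟨v, hv, hA⟩ := h x
    have hv' : ∀ᶠ y in 𝓝 x, ∀ i, HolSec F (v i) y := eventually_all.2 fun i => (hv i).eventually
    obtain ⟨U, hU, hUo, hx⟩ := eventually_nhds_iff.1 (hv'.and hA)
    exact ⟨U, hUo, hx, v, fun i => isHolSection_of_holSec fun y hy => (hU y hy).1 i,
      fun y hy => (hU y hy).2⟩

theorem exists_coframe (S : HolSubbundle F E) (x : X) :
    ∃ R : Fin S.rank → ∀ y, E y →ₗ[ℂ] ℂ, (∀ i, HolCo F (R i) x) ∧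
      ∀ᶠ y in 𝓝 x, ∀ i j, R i y (S.frameAt x j y) = if i = j then 1 else 0 := by
  obtain ⟨m, g, hg⟩ := LocFrame.exists_extension (S.holSec_frameAt x)
    (S.eventually_frameAt x).self_of_nhds.1
  refine ⟨fun i => g.ε (Sum.inl i), fun i => g.hol_ε _, ?_⟩
  filter_upwards [g.dual] with y hy i j
  rw [← hg j, hy]
  simp

/-- Local holomorphic functionals dual to the local frame `S.frameAt x`. -/
def coframeAt (S : HolSubbundle F E) (x : X) : Fin S.rank → ∀ y, E y →ₗ[ℂ] ℂ :=
  (S.exists_coframe x).choose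

theorem holCo_coframeAt (S : HolSubbundle F E) (x : X) (i : Fin S.rank) :
    HolCo F (S.coframeAt x i) x := (S.exists_coframe x).choose_spec.1 i

theorem eventually_coframeAt (S : HolSubbundle F E) (x : X) : ∀ᶠ y in 𝓝 x, ∀ i j,
    S.coframeAt x i y (S.frameAt x j y) = if i = j then 1 else 0 :=
  (S.exists_coframe x).choose_spec.2

theorem mem_fiber_of_punctured (S : HolSubbundle F E) {x : X} {s : ∀ y, E y} (hs : HolSec F s x)
    (h : ∀ᶠ y in 𝓝[≠] x, s y ∈ S.fiber y) : s x ∈ S.fiber x := by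
  have h0 := S.eventually_frameAt x
  rw [← h0.self_of_nhds.2]
  refine LocFrame.mem_span_of_punctured (S.holSec_frameAt x) h0.self_of_nhds.1 hs ?_
  filter_upwards [h, h0.filter_mono nhdsWithin_le_nhds] with y h1 h2
  rwa [h2.2]

theorem exists_section (S : HolSubbundle F E) {x : X} {v : E x} (hv : v ∈ S.fiber x) :
    ∃ s : ∀ y, E y, HolSec F s x ∧ s x = v ∧ ∀ᶠ y in 𝓝 x, s y ∈ S.fiber y := by
  have h0 := S.eventually_frameAt x
  rw [← h0.self_of_nhds.2] at hv
  obtain ⟨c, hc⟩ := (Submodule.mem_span_range_iff_exists_fun ℂ).1 hv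
  refine ⟨fun y => ∑ i, c i • S.frameAt x i y,
    HolSec.sum fun i _ => (S.holSec_frameAt x i).const_smul _, hc, ?_⟩
  filter_upwards [h0] with y hy
  rw [← hy.2]
  exact Submodule.sum_mem _ fun i _ => Submodule.smul_mem _ _ (Submodule.subset_span ⟨i, rfl⟩)

/-- A family of subspaces which is, near every point and off this point, spanned by a holomorphic
frame extending across the point, agrees with a subbundle off a discrete set. -/
theorem exists_saturated [ConnectedSpace X] [T1Space X] (A : ∀ y, Submodule ℂ (E y))
    (h : ∀ x, ∃ (r : ℕ) (v : Fin r → ∀ y, E y), (∀ i, HolSec F (v i) x) ∧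
      (LinearIndependent ℂ fun i => v i x) ∧
      ∀ᶠ y in 𝓝[≠] x, Submodule.span ℂ (Set.range fun i => v i y) = A y) :
    ∃ S : HolSubbundle F E, ∀ x, ∀ᶠ y in 𝓝[≠] x, S.fiber y = A y := by
  choose r v hv hli hA using h
  -- The fibre at `y` is spanned by the frame chosen at `y`. A nearby frame chosen at `x` spans the
  -- same space, because both frames span `A` off `y` and spans of independent sections are closed
  -- under limits.
  let B : ∀ y, Submodule ℂ (E y) := fun y => Submodule.span ℂ (Set.range fun i => v y i y)
  have hB : ∀ x, ∀ᶠ y in 𝓝 x, LinearIndependent ℂ (fun i => v x i y) ∧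
      Submodule.span ℂ (Set.range fun i => v x i y) = B y := by
    intro x
    have h1 := eventually_nhdsWithin_iff.1
      (eventually_eventually_nhdsWithin.2 (hA x))
    have h2 : ∀ᶠ y in 𝓝 x, ∀ i, HolSec F (v x i) y := eventually_all.2 fun i => (hv x i).eventually
    filter_upwards [h1, h2, LocFrame.linearIndependent_nhds (hv x) (hli x)] with y h1 h2 h3
    refine ⟨h3, ?_⟩
    rcases eq_or_ne y x with rfl | hy
    · rfl
    have h4 : ∀ᶠ w in 𝓝 y, Submodule.span ℂ (Set.range fun i => v x i w) = A w := by
      have := h1 hy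
      rwa [(isOpen_compl_singleton (x := x)).nhdsWithin_eq hy] at this
    have h4' := h4.filter_mono (nhdsWithin_le_nhds (s := {y}ᶜ))
    refine le_antisymm (Submodule.span_le.2 ?_) (Submodule.span_le.2 ?_)
    · rintro _ ⟨i, rfl⟩
      refine LocFrame.mem_span_of_punctured (hv y) (hli y) (h2 i) ?_
      filter_upwards [h4', hA y] with w e1 e2
      rw [e2, ← e1]
      exact Submodule.subset_span ⟨i, rfl⟩
    · rintro _ ⟨i, rfl⟩
      refine LocFrame.mem_span_of_punctured h2 h3 (hv y i) ?_
      filter_upwards [h4', hA y] with w e1 e2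
      rw [e1, ← e2]
      exact Submodule.subset_span ⟨i, rfl⟩
  have hr : ∀ x, ∀ᶠ y in 𝓝 x, r y = r x := by
    intro x
    filter_upwards [hB x] with y hy
    have h1 := finrank_span_eq_card hy.1
    have h2 := finrank_span_eq_card (hli y)
    rw [hy.2, Fintype.card_fin] at h1
    rw [Fintype.card_fin] at h2
    exact h2.symm.trans h1
  obtain ⟨x₀⟩ : Nonempty X := inferInstance
  -- The rank is locally constant, hence constant as `X` is connected.
  have hconst : ∀ x, r x = r x₀ := fun x =>
    ((IsLocallyConstant.iff_eventually_eq r).2 hr).apply_eq_of_preconnectedSpace x x₀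
  refine ⟨ofLocal B (r x₀) fun x => ?_, fun x => ?_⟩
  · rw [← hconst x]
    exact ⟨v x, hv x, hB x⟩
  · filter_upwards [hA x, (hB x).filter_mono nhdsWithin_le_nhds] with y h1 h2
    exact h2.2.symm.trans h1

end HolSubbundle

end Subbundles

/-! ### Gram determinants -/

section Gram

open scoped ComplexOrder

variable {X : Type*} [TopologicalSpace X] [ChartedSpace ℂ X]
  {F : Type*} [NormedAddCommGroup F] [NormedSpace ℂ F]
  {E : X → Type*} [TopologicalSpace (Bundle.TotalSpace F E)] [∀ x, TopologicalSpace (E x)]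
  [∀ x, AddCommGroup (E x)] [∀ x, Module ℂ (E x)]
  [FiberBundle F E]

namespace HermitianMetric

theorem posDef_gram (h : HermitianMetric F E) {r : ℕ} {e : Fin r → ∀ y, E y} {y : X}
    (he : LinearIndependent ℂ fun i => e i y) :
    (Matrix.of fun i j => h.form y (e i y) (e j y)).PosDef := by
  refine Matrix.PosDef.of_dotProduct_mulVec_pos ?_ fun x hx => ?_
  · ext i j
    simp only [Matrix.conjTranspose_apply, Matrix.of_apply, ← starRingEnd_apply, h.conj_symm]
  · set v := ∑ i, x i • e i y with hv
    have h0 : v ≠ 0 := fun h0 => hx (funext (Fintype.linearIndependent_iff.1 he x h0))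
    have h1 : star x ⬝ᵥ ((Matrix.of fun i j => h.form y (e i y) (e j y)).mulVec x) =
        h.form y v v := by
      simp only [hv, map_sum, LinearMap.map_smulₛₗ, LinearMap.sum_apply, LinearMap.smul_apply,
        dotProduct, Matrix.mulVec, Matrix.of_apply, Pi.star_apply, smul_eq_mul, Finset.mul_sum,
        RingHom.id_apply, starRingEnd_apply]
      rw [Finset.sum_comm]
      refine Finset.sum_congr rfl fun i _ => Finset.sum_congr rfl fun j _ => ?_
      ring
    have h2 : (h.form y v v).im = 0 := Complex.conj_eq_iff_im.1 (h.conj_symm y v v)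
    rw [h1, Complex.lt_def]
    exact ⟨h.pos y v h0, by simp [h2]⟩

theorem gramDet_pos (h : HermitianMetric F E) {r : ℕ} {e : Fin r → ∀ y, E y} {y : X}
    (he : LinearIndependent ℂ fun i => e i y) : 0 < h.gramDet e y :=
  (Complex.lt_def.1 (h.posDef_gram he).det_pos).1

/-- The Gram matrix `G` becomes `Aᴴ G A`. -/
theorem gramDet_change (h : HermitianMetric F E) {r : ℕ} {e e' : Fin r → ∀ y, E y} {y : X}
    {A : Matrix (Fin r) (Fin r) ℂ} (hA : ∀ j, e' j y = ∑ i, A i j • e i y) :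
    h.gramDet e' y = ‖A.det‖ ^ 2 * h.gramDet e y := by
  have h1 : (Matrix.of fun i j => h.form y (e' i y) (e' j y)) =
      A.conjTranspose * (Matrix.of fun i j => h.form y (e i y) (e j y)) * A := by
    ext i j
    simp only [hA, map_sum, LinearMap.map_smulₛₗ, LinearMap.sum_apply, LinearMap.smul_apply,
      Matrix.mul_apply, Matrix.of_apply, Matrix.conjTranspose_apply, smul_eq_mul, Finset.mul_sum,
      Finset.sum_mul, RingHom.id_apply, starRingEnd_apply]
    refine Finset.sum_congr rfl fun k _ => Finset.sum_congr rfl fun l _ => ?_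
    ring
  have h2 : (star A.det * A.det : ℂ) = ((‖A.det‖ ^ 2 : ℝ) : ℂ) := by
    rw [← starRingEnd_apply, Complex.conj_mul']
    norm_cast
  rw [gramDet, gramDet, h1, Matrix.det_mul, Matrix.det_mul, Matrix.det_conjTranspose, mul_right_comm,
    h2, Complex.re_ofReal_mul]

end HermitianMetric

end Gram

/-! ### The determinant line of a subbundle -/

section Norm

variable {X : Type*} [TopologicalSpace X] [ChartedSpace ℂ X] [IsManifold 𝓘(ℂ) ω X]
  {F : Type*} [NormedAddCommGroup F] [NormedSpace ℂ F] [FiniteDimensional ℂ F]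
  {E : X → Type*} [TopologicalSpace (Bundle.TotalSpace F E)] [∀ x, TopologicalSpace (E x)]
  [∀ x, AddCommGroup (E x)] [∀ x, Module ℂ (E x)]
  [FiberBundle F E] [VectorBundle ℂ F E] [ContMDiffVectorBundle ω F E 𝓘(ℂ)]

theorem contDiffAt_chart_complex {u : X → ℂ} {p x : X} (hx : x ∈ (chartAt ℂ p).source)
    (hu : ContMDiffAt 𝓘(ℝ, ℂ) 𝓘(ℝ, ℂ) ∞ u x) :
    ContDiffAt ℝ 2 (fun z => u ((chartAt ℂ p).symm z)) (chartAt ℂ p x) := by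
  have := isManifold_real (X := X)
  have hc : chartAt ℂ p ∈ IsManifold.maximalAtlas 𝓘(ℝ, ℂ) ∞ X :=
    IsManifold.chart_mem_maximalAtlas p
  have h1 : ContMDiffAt 𝓘(ℝ, ℂ) 𝓘(ℝ, ℂ) ∞ u ((chartAt ℂ p).symm (chartAt ℂ p x)) := by
    rwa [(chartAt ℂ p).left_inv hx]
  exact ((h1.comp _ (contMDiffAt_symm_of_mem_maximalAtlas hc
    ((chartAt ℂ p).map_source hx))).contDiffAt).of_le (WithTop.coe_le_coe.2 le_top)

theorem HermitianMetric.contDiffAt_gramDet (h : HermitianMetric F E) {r : ℕ}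
    {e : Fin r → ∀ y, E y} {p x : X} (he : ∀ i, HolSec F (e i) x)
    (hx : x ∈ (chartAt ℂ p).source) :
    ContDiffAt ℝ 2 (fun z => h.gramDet e ((chartAt ℂ p).symm z)) (chartAt ℂ p x) := by
  obtain ⟨U, hU, hUo, hxU⟩ := eventually_nhds_iff.1 (eventually_all.2 fun i => (he i).eventually)
  have h1 : ∀ i j, ContDiffAt ℝ 2 (fun z => h.form ((chartAt ℂ p).symm z)
      (e i ((chartAt ℂ p).symm z)) (e j ((chartAt ℂ p).symm z))) (chartAt ℂ p x) := fun i j =>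
    contDiffAt_chart_complex (u := fun y => h.form y (e i y) (e j y)) hx
      ((h.smooth U (e i) (e j) hUo (isHolSection_of_holSec fun y hy => hU y hy i)
        (isHolSection_of_holSec fun y hy => hU y hy j)).contMDiffAt (hUo.mem_nhds hxU))
  refine Complex.reCLM.contDiff.contDiffAt.comp (chartAt ℂ p x) (g := Complex.reCLM) (f := fun z =>
    (Matrix.of fun i j => h.form ((chartAt ℂ p).symm z) (e i ((chartAt ℂ p).symm z))
      (e j ((chartAt ℂ p).symm z))).det) ?_
  simp only [Matrix.det_apply, Matrix.of_apply]
  exact ContDiffAt.sum fun σ _ => (contDiffAt_prod fun i _ => h1 _ _).const_smul _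

/-- The determinant line of a subbundle with the metric induced by `h`. -/
def HolSubbundle.herm (S : HolSubbundle F E) (h : HermitianMetric F E) : HermLine X where
  G x y := h.gramDet (S.frameAt x) y
  pos x := (S.eventually_frameAt x).mono fun y hy => h.gramDet_pos hy.1
  smooth x := by
    filter_upwards [eventually_all.2 fun i => (S.holSec_frameAt x i).eventually] with y hy p hp
    exact h.contDiffAt_gramDet hy hp
  compat x := by
    have hR := eventually_all.2 fun i => (S.holCo_coframeAt x i).eventually
    filter_upwards [hR, (S.eventually_frameAt x).eventually_nhds,
      (S.eventually_coframeAt x).eventually_nhds] with y h1 h2 h3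
    -- The transition matrix between the frames, written with the coframe so that its entries are
    -- visibly holomorphic.
    let A : X → Matrix (Fin S.rank) (Fin S.rank) ℂ := fun w =>
      Matrix.of fun i j => S.coframeAt x i w (S.frameAt y j w)
    have key : ∀ᶠ w in 𝓝 y, h.gramDet (S.frameAt y) w =
        ‖(A w).det‖ ^ 2 * h.gramDet (S.frameAt x) w := by
      filter_upwards [h2, h3, S.eventually_frameAt y] with w h2 h3 h4
      refine h.gramDet_change fun j => ?_
      have hj : S.frameAt y j w ∈ Submodule.span ℂ (Set.range fun i => S.frameAt x i w) := by
        rw [h2.2, ← h4.2]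
        exact Submodule.subset_span ⟨j, rfl⟩
      obtain ⟨c, hc⟩ := (Submodule.mem_span_range_iff_exists_fun ℂ).1 hj
      simp only [A, Matrix.of_apply, ← hc, map_sum, map_smul, h3]
      simp
    refine ⟨fun w => (A w).det, HolAt.det fun i j =>
      (h1 i).self_of_nhds _ (S.holSec_frameAt y j), fun h0 => ?_, key⟩
    have h5 := key.self_of_nhds
    have h6 := h.gramDet_pos (S.eventually_frameAt y).self_of_nhds.1
    simp [h5, h0] at h6

end Norm

section Degree

variable {X : Type*} [TopologicalSpace X] [ChartedSpace ℂ X] [IsManifold 𝓘(ℂ) ω X]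
  [CompactSpace X] [T2Space X]
  {F : Type*} [NormedAddCommGroup F] [NormedSpace ℂ F] [FiniteDimensional ℂ F]
  {E : X → Type*} [TopologicalSpace (Bundle.TotalSpace F E)] [∀ x, TopologicalSpace (E x)]
  [∀ x, AddCommGroup (E x)] [∀ x, Module ℂ (E x)]
  [FiberBundle F E] [VectorBundle ℂ F E] [ContMDiffVectorBundle ω F E 𝓘(ℂ)]

/-- The degree of a metrized line bundle. -/
def HermLine.degree (M : HermLine X) : ℝ := M.deg (exists_partition (X := X)).choose

theorem HolSubbundle.degree_eq (S : HolSubbundle F E) :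
    S.degree = (S.herm (hermitianMetric F E)).degree := rfl

end Degree

/-! ### Linear algebra of the determinant of a map with kernel -/

section Adapted

variable {V : Type*} [AddCommGroup V] [Module ℂ V] {V' : Type*} [AddCommGroup V'] [Module ℂ V']

/-- A basis of a subspace `S` with functionals on the whole space dual to it. -/
structure SubFrame (S : Submodule ℂ V) (r : ℕ) where
  e : Fin r → V
  ε : Fin r → V →ₗ[ℂ] ℂ
  span : Submodule.span ℂ (Set.range e) = S
  dual : ∀ i j, ε i (e j) = if i = j then 1 else 0

namespace SubFrame

variable {S K : Submodule ℂ V} {T : Submodule ℂ V'} {s a b : ℕ}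

theorem mem (f : SubFrame S s) (i : Fin s) : f.e i ∈ S :=
  f.span.le (Submodule.subset_span ⟨i, rfl⟩)

theorem sum_eq (f : SubFrame S s) {v : V} (hv : v ∈ S) : ∑ i, f.ε i v • f.e i = v := by
  rw [← f.span] at hv
  obtain ⟨c, rfl⟩ := (Submodule.mem_span_range_iff_exists_fun ℂ).1 hv
  simp [f.dual]

theorem eq_zero_of_sum (f : SubFrame S s) {d : Fin s → ℂ} (h : ∑ i, d i • f.e i = 0) : d = 0 := by
  funext j
  have := congrArg (f.ε j) h
  simpa [f.dual] using this

/-- The matrix of a change of basis. -/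
def change (f f' : SubFrame S s) : Matrix (Fin s) (Fin s) ℂ := Matrix.of fun i j => f.ε i (f'.e j)

theorem eq_sum_change (f f' : SubFrame S s) (j : Fin s) :
    f'.e j = ∑ i, f.change f' i j • f.e i := (f.sum_eq (f'.mem j)).symm

theorem coeff_eq (f f' : SubFrame S s) {v : V} (hv : v ∈ S) (l : Fin s) :
    f.ε l v = ∑ i, f.change f' l i * f'.ε i v := by
  conv_lhs => rw [← f'.sum_eq hv]
  simp [change, mul_comm]

/-- The matrix of `v ↦ (k v, t (g v))` on a basis of `S`. -/
def pairing (f : SubFrame S s) (k : SubFrame K a) (t : SubFrame T b) (g : V →ₗ[ℂ] V')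
    (σ : Fin a ⊕ Fin b ≃ Fin s) : Matrix (Fin a ⊕ Fin b) (Fin a ⊕ Fin b) ℂ :=
  Matrix.of fun i j => Sum.elim k.ε (fun i => t.ε i ∘ₗ g) i (f.e (σ j))

variable (f f' : SubFrame S s) (k k' : SubFrame K a) (t t' : SubFrame T b) {g : V →ₗ[ℂ] V'}
  (σ : Fin a ⊕ Fin b ≃ Fin s)

/-- A vector `v` of `S` is killed by `v ↦ (k v, t (g v))` when `g v = 0` and its `K`-coordinates
vanish. Removing the `K`-part of a vector of `S ⊓ ker g` produces such a vector, which is zero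
exactly when the original lies in `K`. -/
theorem pairing_det_ne_zero_iff (hK : K ≤ S ⊓ LinearMap.ker g) (hT : S.map g ≤ T) :
    (f.pairing k t g σ).det ≠ 0 ↔ S ⊓ LinearMap.ker g ≤ K := by
  have hmul : ∀ (d : Fin a ⊕ Fin b → ℂ) (v : V), v = ∑ j, d j • f.e (σ j) →
      ∀ i, (f.pairing k t g σ).mulVec d i = Sum.elim k.ε (fun i => t.ε i ∘ₗ g) i v := by
    rintro d v rfl i
    simp only [Matrix.mulVec, dotProduct, pairing, Matrix.of_apply, map_sum, map_smul, smul_eq_mul]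
    exact Finset.sum_congr rfl fun j _ => mul_comm _ _
  rw [← not_iff_not, not_not, ← Matrix.exists_mulVec_eq_zero_iff]
  constructor
  · rintro ⟨d, hd0, hd⟩ hle
    set v := ∑ j, d j • f.e (σ j) with hv
    have hvS : v ∈ S := Submodule.sum_mem _ fun j _ => Submodule.smul_mem _ _ (f.mem _)
    have h1 := hmul d v hv
    rw [hd] at h1
    have h2 : g v = 0 := by
      rw [← t.sum_eq (hT (Submodule.mem_map_of_mem hvS))]
      exact Finset.sum_eq_zero fun i _ => by
        have := (h1 (Sum.inr i)).symm
        simp only [Sum.elim_inr, LinearMap.comp_apply, Pi.zero_apply] at this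
        rw [this, zero_smul]
    have h3 : v = 0 := by
      rw [← k.sum_eq (hle ⟨hvS, h2⟩)]
      exact Finset.sum_eq_zero fun i _ => by
        have := (h1 (Sum.inl i)).symm
        simp only [Sum.elim_inl, Pi.zero_apply] at this
        rw [this, zero_smul]
    have h4 : ∑ i, d (σ.symm i) • f.e i = 0 := by
      rw [← h3, hv, ← Equiv.sum_comp σ]
      simp
    apply hd0
    funext j
    have := congrFun (f.eq_zero_of_sum h4) (σ j)
    simpa using this
  · intro hle
    by_contra h
    push Not at h
    apply hle
    rintro v ⟨hvS, hvg⟩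
    set w := v - ∑ i, k.ε i v • k.e i with hw
    have hkS : ∑ i, k.ε i v • k.e i ∈ K :=
      Submodule.sum_mem _ fun j _ => Submodule.smul_mem _ _ (k.mem _)
    have hwS : w ∈ S := Submodule.sub_mem _ hvS (hK hkS).1
    have hwg : g w = 0 := by
      rw [hw, map_sub, show g v = 0 from hvg, show g (∑ i, k.ε i v • k.e i) = 0 from (hK hkS).2,
        sub_zero]
    have h1 : w = ∑ j, (fun j => f.ε (σ j) w) j • f.e (σ j) := by
      rw [Equiv.sum_comp σ fun j => f.ε j w • f.e j, f.sum_eq hwS]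
    have h2 : (f.pairing k t g σ).mulVec (fun j => f.ε (σ j) w) = 0 := by
      funext i
      rw [hmul _ w h1]
      rcases i with i | i
      · simp [hw, k.dual]
      · simp [hwg]
    have h3 : (fun j => f.ε (σ j) w) = 0 := by
      by_contra h0
      exact h _ h0 h2
    have h4 : w = 0 := by
      rw [h1, h3]
      simp
    rw [sub_eq_zero.1 (hw.symm.trans h4)]
    exact hkS

/-- The functionals of `k` depend on a choice outside `K`. Passing from `k'` to `k` introduces on
`S` an error vanishing on `S ⊓ ker g`, hence a combination of the functionals of `t` composed with
`g`. It sits in an off-diagonal block and leaves the determinant unchanged. The scalar `c` is a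
change of frame of the twisting line. -/
theorem pairing_det_change (hT : S.map g ≤ T) {c : ℂ} (hc : c ≠ 0)
    (h0 : S ⊓ LinearMap.ker g ≤ K) :
    (k.change k').det * (t.change t').det * (f'.pairing k' t' (c • g) σ).det =
      c ^ b * (f.pairing k t g σ).det * (f.change f').det := by
  have hQ : ∀ l, ∃ q : Fin b → ℂ, ∀ v ∈ S,
      k.ε l v - ∑ i, k.change k' l i * k'.ε i v = ∑ i, q i * t.ε i (g v) := by
    intro l
    let δ : V →ₗ[ℂ] ℂ := k.ε l - ∑ i, k.change k' l i • k'.ε i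
    have h1 : ⨅ i, LinearMap.ker (((t.ε i ∘ₗ g).domRestrict S)) ≤
        LinearMap.ker (δ.domRestrict S) := by
      intro v hv
      simp only [Submodule.mem_iInf, LinearMap.mem_ker, LinearMap.domRestrict_apply,
        LinearMap.comp_apply] at hv ⊢
      have h2 : g v = 0 := by
        rw [← t.sum_eq (hT (Submodule.mem_map_of_mem v.2))]
        exact Finset.sum_eq_zero fun i _ => by rw [hv i, zero_smul]
      have h3 := k.coeff_eq k' (h0 ⟨v.2, h2⟩) l
      simp [δ, h3]
    obtain ⟨q, hq⟩ := (Submodule.mem_span_range_iff_exists_fun ℂ).1 (mem_span_of_iInf_ker_le_ker h1)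
    refine ⟨q, fun v hv => ?_⟩
    have := LinearMap.congr_fun hq ⟨v, hv⟩
    simp only [LinearMap.sum_apply, LinearMap.smul_apply, LinearMap.domRestrict_apply,
      LinearMap.comp_apply, smul_eq_mul] at this
    rw [this]
    simp [δ]
  choose q hq using hQ
  have key : Matrix.fromBlocks (k.change k') (Matrix.of fun l i => c⁻¹ * ∑ m, q l m * t.change t' m i)
      0 (t.change t') * f'.pairing k' t' (c • g) σ =
      Matrix.fromBlocks 1 0 0 (c • 1) * f.pairing k t g σ * (f.change f').submatrix σ σ := by
    have hR : ∀ i j, (f.pairing k t g σ * (f.change f').submatrix σ σ) i j =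
        Sum.elim k.ε (fun i => t.ε i ∘ₗ g) i (f'.e (σ j)) := by
      intro i j
      rw [f.eq_sum_change f' (σ j), Matrix.mul_apply, map_sum,
        ← Equiv.sum_comp σ]
      simp [pairing, mul_comm]
    have ht : ∀ l j, t.ε l (g (f'.e (σ j))) =
        ∑ i, t.change t' l i * t'.ε i (g (f'.e (σ j))) := fun l j =>
      t.coeff_eq t' (hT (Submodule.mem_map_of_mem (f'.mem _))) l
    rw [Matrix.mul_assoc]
    generalize f.pairing k t g σ * (f.change f').submatrix σ σ = P at hR ⊢
    ext i j
    rcases i with l | l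
    · rw [Matrix.mul_apply, Matrix.mul_apply]
      simp only [Fintype.sum_sum_type, Matrix.fromBlocks_apply₁₁, Matrix.fromBlocks_apply₁₂, hR,
        Matrix.one_apply, Matrix.zero_apply, pairing, Matrix.of_apply, Sum.elim_inl, Sum.elim_inr,
        LinearMap.comp_apply, LinearMap.smul_apply, map_smul, smul_eq_mul, zero_mul,
        Finset.sum_const_zero, add_zero, ite_mul, one_mul, Finset.sum_ite_eq, Finset.mem_univ,
        if_true]
      rw [sub_eq_iff_eq_add'.1 (hq l _ (f'.mem (σ j)))]
      congr 1
      simp only [ht, Finset.mul_sum, Finset.sum_mul]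
      rw [Finset.sum_comm]
      refine Finset.sum_congr rfl fun m _ => Finset.sum_congr rfl fun n _ => ?_
      field_simp
    · rw [Matrix.mul_apply, Matrix.mul_apply]
      simp only [Fintype.sum_sum_type, Matrix.fromBlocks_apply₂₁, Matrix.fromBlocks_apply₂₂, hR,
        Matrix.one_apply, Matrix.zero_apply, pairing, Matrix.of_apply, Sum.elim_inl, Sum.elim_inr,
        LinearMap.comp_apply, LinearMap.smul_apply, map_smul, smul_eq_mul, zero_mul,
        Finset.sum_const_zero, zero_add, Matrix.smul_apply, ht]
      simp [Finset.mul_sum, mul_left_comm]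
  have h := congrArg Matrix.det key
  rw [Matrix.det_mul, Matrix.det_mul, Matrix.det_mul, Matrix.det_fromBlocks_zero₂₁,
    Matrix.det_fromBlocks_zero₂₁, Matrix.det_submatrix_equiv_self, Matrix.det_one, one_mul,
    Matrix.det_smul, Matrix.det_one, mul_one, Fintype.card_fin] at h
  exact h

end SubFrame

end Adapted

/-! ### Twisted maps and their determinants -/

section TwistedMaps

variable {X : Type*} [TopologicalSpace X] [ChartedSpace ℂ X] [IsManifold 𝓘(ℂ) ω X]
  {F : Type*} [NormedAddCommGroup F] [NormedSpace ℂ F] [FiniteDimensional ℂ F]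
  {E : X → Type*} [TopologicalSpace (Bundle.TotalSpace F E)] [∀ x, TopologicalSpace (E x)]
  [∀ x, AddCommGroup (E x)] [∀ x, Module ℂ (E x)]
  [FiberBundle F E] [VectorBundle ℂ F E] [ContMDiffVectorBundle ω F E 𝓘(ℂ)]
  {F' : Type*} [NormedAddCommGroup F'] [NormedSpace ℂ F'] [FiniteDimensional ℂ F']
  {E' : X → Type*} [TopologicalSpace (Bundle.TotalSpace F' E')] [∀ x, TopologicalSpace (E' x)]
  [∀ x, AddCommGroup (E' x)] [∀ x, Module ℂ (E' x)]
  [FiberBundle F' E'] [VectorBundle ℂ F' E'] [ContMDiffVectorBundle ω F' E' 𝓘(ℂ)]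

theorem HolSec.zero (x : X) : HolSec F (fun y => (0 : E y)) x := by
  refine (HolSec.sum (F := F) (E := E) (I := (∅ : Finset ℕ)) (s := fun _ _ => 0)
    (by simp)).congr ?_
  simp

namespace HolSubbundle

variable (F E) in
/-- The zero subbundle. -/
def zero : HolSubbundle F E :=
  ofLocal (fun _ => ⊥) 0 fun x => ⟨fun _ _ => 0, fun _ => HolSec.zero x,
    Eventually.of_forall fun y => ⟨linearIndependent_empty_type, by simp⟩⟩

theorem map_fiber_le_of_punctured (S : HolSubbundle F E) (T : HolSubbundle F' E')
    {g : ∀ y, E y →ₗ[ℂ] E' y} {x : X} (hg : HolLin F F' g x)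
    (h : ∀ᶠ y in 𝓝[≠] x, (S.fiber y).map (g y) ≤ T.fiber y) :
    (S.fiber x).map (g x) ≤ T.fiber x := by
  rintro _ ⟨v, hv, rfl⟩
  obtain ⟨s, hs, rfl, hsS⟩ := S.exists_section hv
  refine T.mem_fiber_of_punctured (hg.self_of_nhds s hs) ?_
  filter_upwards [h, hsS.filter_mono nhdsWithin_le_nhds] with y h1 h2
  exact h1 (Submodule.mem_map_of_mem h2)

theorem fiber_le_of_punctured (S T : HolSubbundle F E) {x : X}
    (h : ∀ᶠ y in 𝓝[≠] x, S.fiber y ≤ T.fiber y) : S.fiber x ≤ T.fiber x := by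
  have := S.map_fiber_le_of_punctured T (g := fun _ => LinearMap.id)
    (Eventually.of_forall fun y s hs => hs) (h.mono fun y hy => by simpa using hy)
  simpa using this

theorem map_fiber_eq_bot_of_punctured (S : HolSubbundle F E)
    {g : ∀ y, E y →ₗ[ℂ] E' y} {x : X} (hg : HolLin F F' g x)
    (h : ∀ᶠ y in 𝓝[≠] x, S.fiber y ≤ LinearMap.ker (g y)) :
    S.fiber x ≤ LinearMap.ker (g x) := by
  have := S.map_fiber_le_of_punctured (zero F' E') hg (h.mono fun y hy => by
    rintro _ ⟨v, hv, rfl⟩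
    rw [show g y v = 0 from hy hv]
    exact Submodule.zero_mem _)
  intro v hv
  exact (Submodule.mem_bot ℂ).1 (this (Submodule.mem_map_of_mem hv))

theorem rank_mono {S T : HolSubbundle F E} {x : X} (h : S.fiber x ≤ T.fiber x) :
    S.rank ≤ T.rank := by
  have := T.finiteDimensional_fiber x
  rw [← S.finrank_fiber x, ← T.finrank_fiber x]
  exact Submodule.finrank_mono h

theorem fiber_eq_of_rank_le {S T : HolSubbundle F E} {x : X} (h : S.fiber x ≤ T.fiber x)
    (hr : T.rank ≤ S.rank) : S.fiber x = T.fiber x := by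
  have := T.finiteDimensional_fiber x
  refine Submodule.eq_of_le_of_finrank_le h ?_
  rwa [S.finrank_fiber, T.finrank_fiber]

/-- The basis of the fibre at a point `y` near `x` given by the frame at `x`. -/
theorem exists_subFrame (S : HolSubbundle F E) (x : X) : ∀ᶠ y in 𝓝 x,
    ∃ f : SubFrame (S.fiber y) S.rank, (∀ i, f.e i = S.frameAt x i y) ∧
      ∀ i, f.ε i = S.coframeAt x i y := by
  filter_upwards [S.eventually_frameAt x, S.eventually_coframeAt x] with y h1 h2
  exact ⟨⟨fun i => S.frameAt x i y, fun i => S.coframeAt x i y, h1.2, h2⟩, fun _ => rfl,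
    fun _ => rfl⟩

end HolSubbundle

variable (F E F' E') in
/-- A holomorphic map from `E` to the tensor product of `E'` with a metrized line bundle, given by
local untwisted representatives. -/
structure TwistedMap where
  loc : X → ∀ y, E y →ₗ[ℂ] E' y
  hol : ∀ x, HolLin F F' (loc x) x
  norm : HermLine X
  compat : ∀ x, ∀ᶠ y in 𝓝 x, ∃ c : ℂ, c ≠ 0 ∧ loc x y = c • loc y y ∧
    norm.G y y = ‖c‖ ^ 2 * norm.G x y

namespace TwistedMap

/-- An untwisted map. -/
def ofMap {g : ∀ y, E y →ₗ[ℂ] E' y} (hg : IsHolMap F F' g) : TwistedMap F E F' E' where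
  loc _ := g
  hol x := hg.holLin x
  norm := HermLine.one X
  compat x := Eventually.of_forall fun y => ⟨1, one_ne_zero, by simp, by simp [HermLine.one]⟩

variable (g : TwistedMap F E F' E')

/-- `g` maps `S` into the twist of `T`. -/
def Maps (S : HolSubbundle F E) (T : HolSubbundle F' E') : Prop :=
  ∀ x, (S.fiber x).map (g.loc x x) ≤ T.fiber x

theorem eventually_ker (x : X) : ∀ᶠ y in 𝓝 x,
    LinearMap.ker (g.loc x y) = LinearMap.ker (g.loc y y) ∧
      ∀ S : Submodule ℂ (E y), S.map (g.loc x y) = S.map (g.loc y y) := by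
  filter_upwards [g.compat x] with y ⟨c, hc, h, _⟩
  rw [h]
  exact ⟨LinearMap.ker_smul _ _ hc, fun S => Submodule.map_smul _ _ _ hc⟩

theorem maps_of_punctured (S : HolSubbundle F E) (T : HolSubbundle F' E')
    (h : ∀ x, ∀ᶠ y in 𝓝[≠] x, (S.fiber y).map (g.loc y y) ≤ T.fiber y) : g.Maps S T := fun x => by
  refine S.map_fiber_le_of_punctured T (g.hol x) ?_
  filter_upwards [h x, (g.eventually_ker x).filter_mono nhdsWithin_le_nhds] with y h1 h2
  rwa [h2.2]

theorem le_ker_of_punctured (S : HolSubbundle F E)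
    (h : ∀ x, ∀ᶠ y in 𝓝[≠] x, S.fiber y ≤ LinearMap.ker (g.loc y y)) (x : X) :
    S.fiber x ≤ LinearMap.ker (g.loc x x) := by
  refine S.map_fiber_eq_bot_of_punctured (g.hol x) ?_
  filter_upwards [h x, (g.eventually_ker x).filter_mono nhdsWithin_le_nhds] with y h1 h2
  rwa [h2.1]

/-- The kernel and the saturation of the image of a twisted map on a subbundle. -/
theorem exists_ker_image [ConnectedSpace X] [T1Space X] (S : HolSubbundle F E) :
    ∃ (K : HolSubbundle F E) (T : HolSubbundle F' E'), K.rank + T.rank = S.rank ∧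
      (∀ x, K.fiber x ≤ S.fiber x ⊓ LinearMap.ker (g.loc x x)) ∧ g.Maps S T ∧
      ∀ x, ∀ᶠ y in 𝓝[≠] x, K.fiber y = S.fiber y ⊓ LinearMap.ker (g.loc y y) ∧
        T.fiber y = (S.fiber y).map (g.loc y y) := by
  have h0 : ∀ x, ∃ (a b : ℕ) (k : Fin a → ∀ y, E y) (t : Fin b → ∀ y, E' y),
      (∀ i, HolSec F (k i) x) ∧ (LinearIndependent ℂ fun i => k i x) ∧
      (∀ i, HolSec F' (t i) x) ∧ (LinearIndependent ℂ fun i => t i x) ∧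
      ∀ᶠ y in 𝓝[≠] x,
        Submodule.span ℂ (Set.range fun i => k i y) = S.fiber y ⊓ LinearMap.ker (g.loc y y) ∧
        Submodule.span ℂ (Set.range fun i => t i y) = (S.fiber y).map (g.loc y y) := by
    intro x
    obtain ⟨a, b, k, t, h1, h2, h3, h4, h5⟩ := exists_kernel_image_frames (S.holSec_frameAt x)
      ((S.eventually_frameAt x).mono fun y hy => hy.1) (g.hol x)
    refine ⟨a, b, k, t, h1, h2, h3, h4, ?_⟩
    filter_upwards [h5, (S.eventually_frameAt x).filter_mono nhdsWithin_le_nhds,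
      (g.eventually_ker x).filter_mono nhdsWithin_le_nhds] with y e1 e2 e3
    rwa [e2.2, e3.1, e3.2] at e1
  obtain ⟨K, hK⟩ := HolSubbundle.exists_saturated
    (fun y => S.fiber y ⊓ LinearMap.ker (g.loc y y)) fun x => by
      obtain ⟨a, b, k, t, h1, h2, h3, h4, h5⟩ := h0 x
      exact ⟨a, k, h1, h2, h5.mono fun y hy => hy.1⟩
  obtain ⟨T, hT⟩ := HolSubbundle.exists_saturated
    (fun y => (S.fiber y).map (g.loc y y)) fun x => by
      obtain ⟨a, b, k, t, h1, h2, h3, h4, h5⟩ := h0 x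
      exact ⟨b, t, h3, h4, h5.mono fun y hy => hy.2⟩
  refine ⟨K, T, ?_, fun x => le_inf ?_ ?_, ?_, fun x => (hK x).and (hT x)⟩
  · obtain ⟨x⟩ : Nonempty X := inferInstance
    obtain ⟨y, h1, h2⟩ := ((hK x).and (hT x)).exists
    have := S.finiteDimensional_fiber y
    rw [← K.finrank_fiber y, ← T.finrank_fiber y, ← S.finrank_fiber y, h1, h2]
    exact finrank_add_eq (g.loc y y) (S.fiber y)
  · exact K.fiber_le_of_punctured S ((hK x).mono fun y hy => hy.le.trans inf_le_left)
  · exact g.le_ker_of_punctured K (fun x => (hK x).mono fun y hy => hy.le.trans inf_le_right) x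
  · exact g.maps_of_punctured S T fun x => (hT x).mono fun y hy => hy.ge

/-- The determinant of a twisted map on a subbundle, from `det S` to
`det K ⊗ det T ⊗ N ^ rk T`, where `K` is contained in the kernel. -/
theorem exists_lineHom {S K : HolSubbundle F E} {T : HolSubbundle F' E'}
    (h : HermitianMetric F E) (h' : HermitianMetric F' E')
    (hK : ∀ x, K.fiber x ≤ S.fiber x ⊓ LinearMap.ker (g.loc x x)) (hT : g.Maps S T)
    (hr : K.rank + T.rank = S.rank)
    (hgen : ∀ x, ∀ᶠ y in 𝓝[≠] x, S.fiber y ⊓ LinearMap.ker (g.loc y y) ≤ K.fiber y) :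
    ∃ f : LineHom (S.herm h) (((K.herm h).mul (T.herm h')).mul (g.norm.pow T.rank)),
      ∀ x, f.D x x ≠ 0 ↔ S.fiber x ⊓ LinearMap.ker (g.loc x x) ≤ K.fiber x := by
  let σ : Fin K.rank ⊕ Fin T.rank ≃ Fin S.rank := finSumFinEquiv.trans (finCongr hr)
  let P : ∀ x y : X, Matrix (Fin K.rank ⊕ Fin T.rank) (Fin K.rank ⊕ Fin T.rank) ℂ := fun x y =>
    Matrix.of fun i j => Sum.elim (fun i => K.coframeAt x i y)
      (fun i => T.coframeAt x i y ∘ₗ g.loc x y) i (S.frameAt x (σ j) y)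
  have hP : ∀ x y (f : SubFrame (S.fiber y) S.rank) (k : SubFrame (K.fiber y) K.rank)
      (t : SubFrame (T.fiber y) T.rank), (∀ i, f.e i = S.frameAt x i y) →
      (∀ i, k.ε i = K.coframeAt x i y) → (∀ i, t.ε i = T.coframeAt x i y) →
      P x y = f.pairing k t (g.loc x y) σ := by
    intro x y f k t h1 h2 h3
    ext i j
    rcases i with i | i <;> simp [P, SubFrame.pairing, h1, h2, h3]
  have hiff : ∀ x, ∀ᶠ y in 𝓝 x,
      (P x y).det ≠ 0 ↔ S.fiber y ⊓ LinearMap.ker (g.loc y y) ≤ K.fiber y := by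
    intro x
    filter_upwards [S.exists_subFrame x, K.exists_subFrame x, T.exists_subFrame x,
      g.eventually_ker x] with y ⟨f, hf, _⟩ ⟨k, _, hk⟩ ⟨t, _, ht⟩ hg
    rw [hP x y f k t hf hk ht, ← hg.1]
    exact f.pairing_det_ne_zero_iff k t σ (by rw [hg.1]; exact hK y) (by rw [hg.2]; exact hT y)
  let M := S.herm h
  let N := ((K.herm h).mul (T.herm h')).mul (g.norm.pow T.rank)
  -- The norm is computed in the frames at `y` itself; comparing it with the frames at a nearby `x`
  -- is the content of the second goal.
  refine ⟨⟨fun x y => (P x y).det, fun y => ‖(P y y).det‖ ^ 2 * N.G y y / M.G y y, ?_, ?_, ?_⟩,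
    fun x => (hiff x).self_of_nhds⟩
  · intro x
    refine HolAt.det fun i j => ?_
    rcases i with i | i
    · exact (K.holCo_coframeAt x i).self_of_nhds _ (S.holSec_frameAt x _)
    · exact (T.holCo_coframeAt x i).self_of_nhds _
        ((g.hol x).self_of_nhds _ (S.holSec_frameAt x _))
  · intro x
    filter_upwards [S.exists_subFrame x, K.exists_subFrame x, T.exists_subFrame x,
      g.eventually_ker x, hiff x, g.compat x, M.pos x] with y ⟨f, hf, _⟩ ⟨k, hk', hk⟩
      ⟨t, ht', ht⟩ hg hi ⟨c, hc, hloc, hnorm⟩ hM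
    have hMy : M.G y y ≠ 0 := (M.pos y).self_of_nhds.ne'
    -- Where `K` is smaller than the kernel both determinants vanish; elsewhere the change of bases
    -- formula applies.
    by_cases h0 : S.fiber y ⊓ LinearMap.ker (g.loc y y) ≤ K.fiber y
    swap
    · have e1 : (P x y).det = 0 := by
        by_contra h1
        exact h0 (hi.1 h1)
      have e2 : (P y y).det = 0 := by
        by_contra h1
        exact h0 ((hiff y).self_of_nhds.1 h1)
      simp [e1, e2]
    obtain ⟨f₀, hf₀, _⟩ := (S.exists_subFrame y).self_of_nhds
    obtain ⟨k₀, hk₀', hk₀⟩ := (K.exists_subFrame y).self_of_nhds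
    obtain ⟨t₀, ht₀', ht₀⟩ := (T.exists_subFrame y).self_of_nhds
    have e := f₀.pairing_det_change f k₀ k t₀ t σ (hT y) hc h0
    rw [← hloc, ← hP x y f k t hf hk ht, ← hP y y f₀ k₀ t₀ hf₀ hk₀ ht₀] at e
    have eS : M.G x y = ‖(f₀.change f).det‖ ^ 2 * M.G y y :=
      h.gramDet_change fun j => by
        rw [← hf, f₀.eq_sum_change f]
        simp only [hf₀]
    have eK : (K.herm h).G x y = ‖(k₀.change k).det‖ ^ 2 * (K.herm h).G y y :=
      h.gramDet_change fun j => by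
        rw [← hk', k₀.eq_sum_change k]
        simp only [hk₀']
    have eT : (T.herm h').G x y = ‖(t₀.change t).det‖ ^ 2 * (T.herm h').G y y :=
      h'.gramDet_change fun j => by
        rw [← ht', t₀.eq_sum_change t]
        simp only [ht₀']
    have e' := congrArg (fun z : ℂ => ‖z‖ ^ 2) e
    simp only [norm_mul, norm_pow, mul_pow] at e'
    change ‖(P y y).det‖ ^ 2 * N.G y y / M.G y y * M.G x y = ‖(P x y).det‖ ^ 2 * N.G x y
    have eN : ∀ z, N.G z y = (K.herm h).G z y * (T.herm h').G z y * g.norm.G z y ^ T.rank :=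
      fun z => by simp [N, HermLine.mul, HermLine.pow_G]
    rw [eN, eN, eS, eK, eT, hnorm, mul_pow]
    field_simp
    linear_combination (-(K.herm h).G y y * (T.herm h').G y y * g.norm.G x y ^ T.rank) * e'
  · intro x
    filter_upwards [hgen x, (hiff x).filter_mono nhdsWithin_le_nhds] with y h1 h2
    exact h2.2 h1

end TwistedMap

end TwistedMaps

/-! ### Degrees of kernel and image -/

section Degree

variable {X : Type*} [TopologicalSpace X] [ChartedSpace ℂ X] [IsManifold 𝓘(ℂ) ω X]
  [CompactSpace X] [T2Space X]
  {F : Type*} [NormedAddCommGroup F] [NormedSpace ℂ F] [FiniteDimensional ℂ F]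
  {E : X → Type*} [TopologicalSpace (Bundle.TotalSpace F E)] [∀ x, TopologicalSpace (E x)]
  [∀ x, AddCommGroup (E x)] [∀ x, Module ℂ (E x)]
  [FiberBundle F E] [VectorBundle ℂ F E] [ContMDiffVectorBundle ω F E 𝓘(ℂ)]
  {F' : Type*} [NormedAddCommGroup F'] [NormedSpace ℂ F'] [FiniteDimensional ℂ F']
  {E' : X → Type*} [TopologicalSpace (Bundle.TotalSpace F' E')] [∀ x, TopologicalSpace (E' x)]
  [∀ x, AddCommGroup (E' x)] [∀ x, Module ℂ (E' x)]
  [FiberBundle F' E'] [VectorBundle ℂ F' E'] [ContMDiffVectorBundle ω F' E' 𝓘(ℂ)]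
  (g : TwistedMap F E F' E')

theorem HermLine.degree_det (A B N : HermLine X) (n : ℕ) :
    ((A.mul B).mul (N.pow n)).degree = A.degree + B.degree + n * N.degree := by
  have hρ := (exists_partition (X := X)).choose_spec
  simp only [HermLine.degree]
  rw [HermLine.deg_mul _ hρ, HermLine.deg_mul _ hρ, HermLine.deg_pow _ hρ]

namespace TwistedMap

/-- The determinant of `g` is a generically nonzero morphism of line bundles. -/
theorem degree_le {S K : HolSubbundle F E} {T : HolSubbundle F' E'}
    (hK : ∀ x, K.fiber x ≤ S.fiber x ⊓ LinearMap.ker (g.loc x x)) (hT : g.Maps S T)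
    (hr : K.rank + T.rank = S.rank)
    (hgen : ∀ x, ∀ᶠ y in 𝓝[≠] x, S.fiber y ⊓ LinearMap.ker (g.loc y y) ≤ K.fiber y) :
    S.degree ≤ K.degree + T.degree + T.rank * g.norm.degree := by
  obtain ⟨f, -⟩ := g.exists_lineHom (hermitianMetric F E) (hermitianMetric F' E') hK hT hr hgen
  simp only [HolSubbundle.degree_eq, ← HermLine.degree_det]
  exact f.deg_le _ (exists_partition (X := X)).choose_spec

/-- When `K` is the kernel at every point, the determinant has no zeros. -/
theorem degree_eq {S K : HolSubbundle F E} {T : HolSubbundle F' E'}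
    (hK : ∀ x, K.fiber x = S.fiber x ⊓ LinearMap.ker (g.loc x x)) (hT : g.Maps S T)
    (hr : K.rank + T.rank = S.rank) :
    S.degree = K.degree + T.degree + T.rank * g.norm.degree := by
  obtain ⟨f, hf⟩ := g.exists_lineHom (hermitianMetric F E) (hermitianMetric F' E')
    (fun x => (hK x).le) hT hr (fun x => Eventually.of_forall fun y => (hK y).ge)
  simp only [HolSubbundle.degree_eq, ← HermLine.degree_det]
  exact f.deg_eq _ (exists_partition (X := X)).choose_spec fun x => (hf x).2 (hK x).ge

/-- A point where the kernel exceeds `K` is a zero of the determinant and would make the degree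
inequality strict. -/
theorem inf_ker_le_of_degree_le {S K : HolSubbundle F E} {T : HolSubbundle F' E'}
    (hK : ∀ x, K.fiber x ≤ S.fiber x ⊓ LinearMap.ker (g.loc x x)) (hT : g.Maps S T)
    (hr : K.rank + T.rank = S.rank)
    (hgen : ∀ x, ∀ᶠ y in 𝓝[≠] x, S.fiber y ⊓ LinearMap.ker (g.loc y y) ≤ K.fiber y)
    (hd : K.degree + T.degree + T.rank * g.norm.degree ≤ S.degree) (x : X) :
    S.fiber x ⊓ LinearMap.ker (g.loc x x) ≤ K.fiber x := by
  obtain ⟨f, hf⟩ := g.exists_lineHom (hermitianMetric F E) (hermitianMetric F' E') hK hT hr hgen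
  by_contra h
  have h0 : f.D x x = 0 := by
    by_contra h1
    exact h ((hf x).1 h1)
  simp only [HolSubbundle.degree_eq, ← HermLine.degree_det] at hd
  exact absurd (f.deg_lt _ (exists_partition (X := X)).choose_spec h0) hd.not_gt

end TwistedMap

theorem HermLine.degree_one : (HermLine.one X).degree = 0 := HermLine.deg_one _

end Degree

/-! ### Tensoring with a line -/

section Contraction

variable {V V' L : Type*} [AddCommGroup V] [Module ℂ V] [AddCommGroup V'] [Module ℂ V']
  [AddCommGroup L] [Module ℂ L]

variable (V) in
/-- Contraction of `V ⊗ L` with a functional on `L`. -/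
def contract (l : L →ₗ[ℂ] ℂ) : V ⊗[ℂ] L →ₗ[ℂ] V :=
  (TensorProduct.rid ℂ V).toLinearMap ∘ₗ l.lTensor V

@[simp]
theorem contract_tmul (l : L →ₗ[ℂ] ℂ) (v : V) (u : L) : contract V l (v ⊗ₜ u) = l u • v := by
  simp [contract]

theorem contract_smul (l : L →ₗ[ℂ] ℂ) (c : ℂ) : contract V (c • l) = c • contract V l := by
  ext v u
  simp [mul_smul]

theorem contract_rTensor (l : L →ₗ[ℂ] ℂ) (f : V →ₗ[ℂ] V') (t : V ⊗[ℂ] L) :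
    contract V' l (f.rTensor L t) = f (contract V l t) := by
  induction t with
  | zero => simp
  | tmul v u => simp
  | add a b ha hb => simp [ha, hb]

theorem contract_tmul_eq {l : L →ₗ[ℂ] ℂ} {u : L} (h : ∀ w, l w • u = w) (t : V ⊗[ℂ] L) :
    contract V l t ⊗ₜ[ℂ] u = t := by
  induction t with
  | zero => simp
  | tmul v w =>
    rw [contract_tmul, TensorProduct.smul_tmul, h]
  | add a b ha hb => rw [map_add, TensorProduct.add_tmul, ha, hb]

theorem contract_injective {l : L →ₗ[ℂ] ℂ} {u : L} (h : ∀ w, l w • u = w) :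
    Function.Injective (contract V l) := fun a b hab => by
  rw [← contract_tmul_eq h a, hab, contract_tmul_eq h b]

/-- When `u` spans `L` with coordinate `l`, contraction identifies `V ⊗ L` with `V` and `T ⊗ L` with
`T`. -/
theorem mem_range_rTensor_iff {l : L →ₗ[ℂ] ℂ} {u : L} (h : ∀ w, l w • u = w) (T : Submodule ℂ V)
    (t : V ⊗[ℂ] L) : t ∈ LinearMap.range (T.subtype.rTensor L) ↔ contract V l t ∈ T := by
  constructor
  · rintro ⟨s, rfl⟩
    rw [contract_rTensor]
    exact (contract T l s).2
  · intro ht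
    refine ⟨(⟨_, ht⟩ : T) ⊗ₜ u, ?_⟩
    rw [LinearMap.rTensor_tmul, Submodule.subtype_apply, contract_tmul_eq h]

end Contraction

/-! ### Maps with values in a tensor product as twisted maps -/

section LineBundle

variable {X : Type*} [TopologicalSpace X] [ChartedSpace ℂ X] [IsManifold 𝓘(ℂ) ω X]
  [CompactSpace X] [T2Space X]
  {F : Type*} [NormedAddCommGroup F] [NormedSpace ℂ F] [FiniteDimensional ℂ F]
  {E : X → Type*} [TopologicalSpace (Bundle.TotalSpace F E)] [∀ x, TopologicalSpace (E x)]
  [∀ x, AddCommGroup (E x)] [∀ x, Module ℂ (E x)]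
  [FiberBundle F E] [VectorBundle ℂ F E] [ContMDiffVectorBundle ω F E 𝓘(ℂ)]
  {F' : Type*} [NormedAddCommGroup F'] [NormedSpace ℂ F'] [FiniteDimensional ℂ F']
  {E' : X → Type*} [TopologicalSpace (Bundle.TotalSpace F' E')] [∀ x, TopologicalSpace (E' x)]
  [∀ x, AddCommGroup (E' x)] [∀ x, Module ℂ (E' x)]
  [FiberBundle F' E'] [VectorBundle ℂ F' E'] [ContMDiffVectorBundle ω F' E' 𝓘(ℂ)]
  {FL : Type*} [NormedAddCommGroup FL] [NormedSpace ℂ FL] [FiniteDimensional ℂ FL]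
  {L : X → Type*} [TopologicalSpace (Bundle.TotalSpace FL L)] [∀ x, TopologicalSpace (L x)]
  [∀ x, AddCommGroup (L x)] [∀ x, Module ℂ (L x)]
  [FiberBundle FL L] [VectorBundle ℂ FL L] [ContMDiffVectorBundle ω FL L 𝓘(ℂ)]
  (hL : Module.finrank ℂ FL = 1)

variable (L) in
/-- The index of the frames of a line bundle. -/
def lineIndex : Fin (whole FL L).rank :=
  ⟨0, (show (whole FL L).rank = 1 from hL) ▸ Nat.one_pos⟩

variable (L) in
/-- A local coordinate on the fibres of a line bundle near `x`. -/
def lineCo (x y : X) : L y →ₗ[ℂ] ℂ := (whole FL L).coframeAt x (lineIndex L hL) y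

variable (L) in
/-- The local frame of a line bundle near `x`. -/
def lineFrame (x y : X) : L y := (whole FL L).frameAt x (lineIndex L hL) y

theorem subsingleton_index (hL : Module.finrank ℂ FL = 1) : Subsingleton (Fin (whole FL L).rank) :=
  Fin.subsingleton_iff_le_one.2 hL.le

theorem eventually_lineCo_smul (x : X) :
    ∀ᶠ y in 𝓝 x, ∀ v : L y, lineCo L hL x y v • lineFrame L hL x y = v := by
  have := subsingleton_index (L := L) hL
  filter_upwards [(whole FL L).exists_subFrame x] with y ⟨f, h1, h2⟩ v
  have h := f.sum_eq (v := v) Submodule.mem_top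
  rw [Fintype.sum_subsingleton _ (lineIndex L hL), h1, h2] at h
  exact h

theorem lineCo_smul (x : X) (v : L x) : lineCo L hL x x v • lineFrame L hL x x = v :=
  (eventually_lineCo_smul hL x).self_of_nhds v

theorem eventually_lineCo_lineFrame (x : X) :
    ∀ᶠ y in 𝓝 x, lineCo L hL x y (lineFrame L hL x y) = 1 := by
  filter_upwards [(whole FL L).eventually_coframeAt x] with y hy
  exact (hy _ _).trans (if_pos rfl)

theorem mapsInto_iff (hL : Module.finrank ℂ FL = 1) (g : ∀ x, E x →ₗ[ℂ] E' x ⊗[ℂ] L x) (S : HolSubbundle F E)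
    (T : HolSubbundle F' E') : MapsInto g S T ↔
      ∀ x, ∀ v ∈ S.fiber x, contract (E' x) (lineCo L hL x x) (g x v) ∈ T.fiber x := by
  simp only [MapsInto, mem_range_rTensor_iff (lineCo_smul hL _)]

theorem HolSec.contract {t : ∀ x, E x ⊗[ℂ] L x} {U : Set X}
    (ht : IsHolTensorSection F FL U t) {l : ∀ x, L x →ₗ[ℂ] ℂ} {x : X} (hl : HolCo FL l x)
    (hx : x ∈ U) : HolSec F (fun y => contract (E y) (l y) (t y)) x := by
  obtain ⟨U', hU', hx', n, a, b, ha, hb, hab⟩ := ht x hx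
  refine (HolSec.sum (I := Finset.univ) fun i _ => HolSec.smul
    (hl.self_of_nhds _ ((hb i).holSec hU' hx')) ((ha i).holSec hU' hx')).congr ?_
  filter_upwards [hU'.mem_nhds hx'] with y hy
  simp [hab y hy]

/-- The twisted map given by a holomorphic map `E → E' ⊗ L`. -/
def TwistedMap.ofTensor {g : ∀ x, E x →ₗ[ℂ] E' x ⊗[ℂ] L x} (hg : IsHolTwistedMap F F' FL g) :
    TwistedMap F E F' E' where
  loc x y := contract (E' y) (lineCo L hL x y) ∘ₗ g y
  hol x := by
    filter_upwards [((whole FL L).holCo_coframeAt x _).eventually] with y hy s hs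
    obtain ⟨U, hU, hUo, hyU⟩ := eventually_nhds_iff.1 hs.eventually
    exact HolSec.contract (hg U s hUo (isHolSection_of_holSec hU)) hy hyU
  norm := (whole FL L).herm (hermitianMetric FL L)
  compat x := by
    have := subsingleton_index (L := L) hL
    filter_upwards [eventually_lineCo_smul (L := L) hL x, eventually_lineCo_lineFrame (L := L) hL x]
      with y h1 h2
    -- Two coordinates on the line `L y` differ by a scalar, read off on the frame vector at `y`; it
    -- is also the transition factor of the norms.
    have h3 : ∀ v, lineCo L hL x y v =
        lineCo L hL x y (lineFrame L hL y y) * lineCo L hL y y v := fun v => by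
      conv_lhs => rw [← lineCo_smul hL y v]
      rw [map_smul, smul_eq_mul, mul_comm]
    refine ⟨lineCo L hL x y (lineFrame L hL y y), fun h0 => ?_, ?_, ?_⟩
    · have := h3 (lineFrame L hL x y)
      rw [h2, h0, zero_mul] at this
      exact one_ne_zero this
    · rw [← LinearMap.smul_comp, ← contract_smul]
      congr 2
      ext v
      rw [h3]
      rfl
    · have h := (hermitianMetric FL L).gramDet_change (y := y)
        (e := (whole FL L).frameAt x) (e' := (whole FL L).frameAt y)
        (A := Matrix.of fun _ _ => lineCo L hL x y (lineFrame L hL y y)) fun j => by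
          rw [Fintype.sum_subsingleton _ (lineIndex L hL),
            Subsingleton.elim j (lineIndex L hL)]
          exact (h1 _).symm
      rw [Matrix.det_eq_elem_of_subsingleton _
        (lineIndex L hL)] at h
      exact h

theorem TwistedMap.degree_norm_ofTensor {g : ∀ x, E x →ₗ[ℂ] E' x ⊗[ℂ] L x}
    (hg : IsHolTwistedMap F F' FL g) :
    (TwistedMap.ofTensor hL hg).norm.degree = (whole FL L).degree := rfl

theorem TwistedMap.maps_ofTensor {g : ∀ x, E x →ₗ[ℂ] E' x ⊗[ℂ] L x}
    (hg : IsHolTwistedMap F F' FL g) (S : HolSubbundle F E) (T : HolSubbundle F' E') :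
    (TwistedMap.ofTensor hL hg).Maps S T ↔ MapsInto g S T := by
  rw [mapsInto_iff hL]
  refine forall_congr' fun x => Submodule.map_le_iff_le_comap

end LineBundle

/-! ### Injective images of subbundles -/

section Image

variable {X : Type*} [TopologicalSpace X] [ChartedSpace ℂ X] [IsManifold 𝓘(ℂ) ω X]
  [CompactSpace X] [T2Space X]
  {F : Type*} [NormedAddCommGroup F] [NormedSpace ℂ F] [FiniteDimensional ℂ F]
  {E : X → Type*} [TopologicalSpace (Bundle.TotalSpace F E)] [∀ x, TopologicalSpace (E x)]
  [∀ x, AddCommGroup (E x)] [∀ x, Module ℂ (E x)]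
  [FiberBundle F E] [VectorBundle ℂ F E] [ContMDiffVectorBundle ω F E 𝓘(ℂ)]
  {F' : Type*} [NormedAddCommGroup F'] [NormedSpace ℂ F'] [FiniteDimensional ℂ F']
  {E' : X → Type*} [TopologicalSpace (Bundle.TotalSpace F' E')] [∀ x, TopologicalSpace (E' x)]
  [∀ x, AddCommGroup (E' x)] [∀ x, Module ℂ (E' x)]
  [FiberBundle F' E'] [VectorBundle ℂ F' E'] [ContMDiffVectorBundle ω F' E' 𝓘(ℂ)]

namespace HolSubbundle

@[simp]
-- For the identity with all three subbundles zero, the degree formula reads `δ = δ + δ`.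
theorem degree_zero : (zero F E).degree = 0 := by
  have hg : IsHolMap F F fun x => (LinearMap.id : E x →ₗ[ℂ] E x) := fun U s _ hs => hs
  have h := (TwistedMap.ofMap hg).degree_eq (S := zero F E) (K := zero F E) (T := zero F E)
    (fun x => by simp [TwistedMap.ofMap]; rfl) (fun x => by simp [TwistedMap.ofMap]) rfl
  simp only [TwistedMap.ofMap, HermLine.degree_one] at h
  linarith

@[simp]
theorem rank_zero : (zero F E).rank = 0 := rfl

/-- The image of a subbundle under a holomorphic map injective on its fibres. -/
theorem exists_image {g : ∀ x, E x →ₗ[ℂ] E' x} (hg : IsHolMap F F' g) (S : HolSubbundle F E)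
    (hinj : ∀ x, S.fiber x ⊓ LinearMap.ker (g x) = ⊥) :
    ∃ T : HolSubbundle F' E', (∀ x, T.fiber x = (S.fiber x).map (g x)) ∧ T.rank = S.rank ∧
      T.degree = S.degree := by
  let T : HolSubbundle F' E' := ofLocal (fun x => (S.fiber x).map (g x)) S.rank fun x =>
    ⟨fun i y => g y (S.frameAt x i y),
      fun i => (hg.holLin x).self_of_nhds _ (S.holSec_frameAt x i), by
      filter_upwards [S.eventually_frameAt x] with y hy
      refine ⟨hy.1.map ?_, ?_⟩
      · rw [hy.2]
        exact disjoint_iff.2 (hinj y)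
      · rw [← hy.2, Submodule.map_span, ← Set.range_comp]
        rfl⟩
  have h := (TwistedMap.ofMap hg).degree_eq (S := S) (K := zero F E) (T := T)
    (fun x => (hinj x).symm) (fun x => le_rfl) (by simp [T, ofLocal])
  simp only [TwistedMap.ofMap, HermLine.degree_one, degree_zero] at h
  exact ⟨T, fun x => rfl, rfl, by linarith⟩

end HolSubbundle

end Image

/-! ### Holomorphic maps to and from a direct sum -/

section Sum

variable {X : Type*} [TopologicalSpace X] [ChartedSpace ℂ X] [IsManifold 𝓘(ℂ) ω X]
  {FV : Type*} [NormedAddCommGroup FV] [NormedSpace ℂ FV] [FiniteDimensional ℂ FV]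
  {V : X → Type*} [TopologicalSpace (Bundle.TotalSpace FV V)] [∀ x, TopologicalSpace (V x)]
  [∀ x, AddCommGroup (V x)] [∀ x, Module ℂ (V x)]
  [FiberBundle FV V] [VectorBundle ℂ FV V] [ContMDiffVectorBundle ω FV V 𝓘(ℂ)]
  {FW : Type*} [NormedAddCommGroup FW] [NormedSpace ℂ FW] [FiniteDimensional ℂ FW]
  {W : X → Type*} [TopologicalSpace (Bundle.TotalSpace FW W)] [∀ x, TopologicalSpace (W x)]
  [∀ x, AddCommGroup (W x)] [∀ x, Module ℂ (W x)]
  [FiberBundle FW W] [VectorBundle ℂ FW W] [ContMDiffVectorBundle ω FW W 𝓘(ℂ)]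

theorem holSec_prod_iff {s : ∀ x, (V ×ᵇ W) x} {x : X} :
    HolSec (FV × FW) s x ↔ HolSec FV (fun y => (s y).1) x ∧ HolSec FW (fun y => (s y).2) x := by
  simp only [HolSec, Bundle.contMDiffAt_section]
  exact contMDiffAt_prod_module_iff _

theorem isHolMap_fst : IsHolMap (FV × FW) FV fun x => LinearMap.fst ℂ (V x) (W x) :=
  fun _ _ hU hs => isHolSection_of_holSec fun _ hx => (holSec_prod_iff.1 (hs.holSec hU hx)).1

theorem isHolMap_snd : IsHolMap (FV × FW) FW fun x => LinearMap.snd ℂ (V x) (W x) :=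
  fun _ _ hU hs => isHolSection_of_holSec fun _ hx => (holSec_prod_iff.1 (hs.holSec hU hx)).2

theorem IsHolMap.prod {F : Type*} [NormedAddCommGroup F] [NormedSpace ℂ F]
    {E : X → Type*} [TopologicalSpace (Bundle.TotalSpace F E)] [∀ x, TopologicalSpace (E x)]
    [∀ x, AddCommGroup (E x)] [∀ x, Module ℂ (E x)] [FiberBundle F E]
    {a : ∀ x, E x →ₗ[ℂ] V x} {b : ∀ x, E x →ₗ[ℂ] W x} (ha : IsHolMap F FV a)
    (hb : IsHolMap F FW b) :
    IsHolMap (E' := V ×ᵇ W) F (FV × FW) fun x => (a x).prod (b x) := fun U s hU hs =>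
  isHolSection_of_holSec fun _ hx => holSec_prod_iff.2
    ⟨(ha U s hU hs).holSec hU hx, (hb U s hU hs).holSec hU hx⟩

end Sum

/-! ### Splitting a subbundle along a projection -/

section Split

variable {X : Type*} [TopologicalSpace X] [ChartedSpace ℂ X] [IsManifold 𝓘(ℂ) ω X]
  [CompactSpace X] [T2Space X]
  {F : Type*} [NormedAddCommGroup F] [NormedSpace ℂ F] [FiniteDimensional ℂ F]
  {E : X → Type*} [TopologicalSpace (Bundle.TotalSpace F E)] [∀ x, TopologicalSpace (E x)]
  [∀ x, AddCommGroup (E x)] [∀ x, Module ℂ (E x)]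
  [FiberBundle F E] [VectorBundle ℂ F E] [ContMDiffVectorBundle ω F E 𝓘(ℂ)]
  {FV : Type*} [NormedAddCommGroup FV] [NormedSpace ℂ FV] [FiniteDimensional ℂ FV]
  {V : X → Type*} [TopologicalSpace (Bundle.TotalSpace FV V)] [∀ x, TopologicalSpace (V x)]
  [∀ x, AddCommGroup (V x)] [∀ x, Module ℂ (V x)]
  [FiberBundle FV V] [VectorBundle ℂ FV V] [ContMDiffVectorBundle ω FV V 𝓘(ℂ)]
  {FW : Type*} [NormedAddCommGroup FW] [NormedSpace ℂ FW] [FiniteDimensional ℂ FW]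
  {W : X → Type*} [TopologicalSpace (Bundle.TotalSpace FW W)] [∀ x, TopologicalSpace (W x)]
  [∀ x, AddCommGroup (W x)] [∀ x, Module ℂ (W x)]
  [FiberBundle FW W] [VectorBundle ℂ FW W] [ContMDiffVectorBundle ω FW W 𝓘(ℂ)]

namespace HolSubbundle

theorem degree_congr {S T : HolSubbundle F E} (h : ∀ x, S.fiber x = T.fiber x)
    (hr : S.rank = T.rank) : S.degree = T.degree := by
  have hg : IsHolMap F F fun x => (LinearMap.id : E x →ₗ[ℂ] E x) := fun U s _ hs => hs
  have h := (TwistedMap.ofMap hg).degree_eq (S := S) (K := zero F E) (T := T)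
    (fun x => by simp [TwistedMap.ofMap]; rfl) (fun x => by simp [TwistedMap.ofMap, h])
    (by simp [hr])
  simpa [TwistedMap.ofMap, HermLine.degree_one] using h

theorem degree_of_rank_eq_zero [Nonempty X] {S : HolSubbundle F E} (h : S.rank = 0) :
    S.degree = 0 := by
  rw [← degree_zero (F := F) (E := E)]
  exact degree_congr (fun x => (fiber_eq_of_rank_le (S := zero F E) bot_le h.le).symm) h

theorem rank_le_whole [Nonempty X] (S : HolSubbundle F E) : S.rank ≤ (whole F E).rank :=
  rank_mono (x := Classical.arbitrary X) le_top

theorem fiber_eq_top {S : HolSubbundle F E} (h : (whole F E).rank ≤ S.rank) (x : X) :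
    S.fiber x = ⊤ := fiber_eq_of_rank_le (T := whole F E) le_top h

theorem degree_of_rank_eq_whole {S : HolSubbundle F E} (h : S.rank = (whole F E).rank) :
    S.degree = (whole F E).degree := degree_congr (fiber_eq_top h.ge) h

/-- The decomposition of a subbundle `T` into its image under `p` and the image under `q` of its
intersection with the kernel of `p`. -/
theorem exists_split [ConnectedSpace X] {p : ∀ x, E x →ₗ[ℂ] V x} {q : ∀ x, E x →ₗ[ℂ] W x}
    (hp : IsHolMap F FV p) (hq : IsHolMap F FW q)
    (hpq : ∀ x, LinearMap.ker (p x) ⊓ LinearMap.ker (q x) = ⊥) (T : HolSubbundle F E) :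
    ∃ (A : HolSubbundle FV V) (B : HolSubbundle FW W), B.rank + A.rank = T.rank ∧
      T.degree ≤ B.degree + A.degree ∧
      (∀ x, ∀ᶠ y in 𝓝[≠] x, A.fiber y = (T.fiber y).map (p y) ∧
        B.fiber y = (T.fiber y ⊓ LinearMap.ker (p y)).map (q y)) ∧
      (B.degree + A.degree ≤ T.degree → B.rank = 0 →
        ∀ x, T.fiber x ⊓ LinearMap.ker (p x) = ⊥) := by
  obtain ⟨K, A, hr, hK, hA, hgen⟩ := (TwistedMap.ofMap hp).exists_ker_image T
  obtain ⟨B, hB, hBr, hBd⟩ := exists_image hq K fun x => by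
    rw [eq_bot_iff, ← hpq x]
    exact inf_le_inf_right _ ((hK x).trans inf_le_right)
  have hgen' : ∀ x, ∀ᶠ y in 𝓝[≠] x,
      T.fiber y ⊓ LinearMap.ker ((TwistedMap.ofMap hp).loc y y) ≤ K.fiber y := fun x =>
    (hgen x).mono fun y hy => hy.1.ge
  have hd := (TwistedMap.ofMap hp).degree_le hK hA hr hgen'
  have hnorm : (TwistedMap.ofMap hp).norm.degree = 0 := HermLine.degree_one
  refine ⟨A, B, by omega, ?_, fun x => ?_, fun h h0 x => ?_⟩
  · rw [hnorm, mul_zero, add_zero] at hd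
    linarith
  · filter_upwards [hgen x] with y hy
    refine ⟨hy.2, ?_⟩
    rw [hB, hy.1]
    rfl
  · have h1 := (TwistedMap.ofMap hp).inf_ker_le_of_degree_le hK hA hr hgen'
      (by rw [hnorm, mul_zero, add_zero]; linarith) x
    have h2 : K.fiber x = ⊥ := by
      have := K.finiteDimensional_fiber x
      rw [← Submodule.finrank_eq_zero, K.finrank_fiber, ← hBr, h0]
    rw [h2] at h1
    exact le_bot_iff.1 h1

/-- The images of a frame of `S` extend to a frame of `V`; the coordinates of `g u` in it are
holomorphic and are the coordinates of `u` in the frame of `S`. Used to see that the map defined by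
a graph is holomorphic. -/
theorem holSec_lift {S : HolSubbundle F E} {g : ∀ x, E x →ₗ[ℂ] V x} (hg : IsHolMap F FV g)
    (hinj : ∀ x, S.fiber x ⊓ LinearMap.ker (g x) = ⊥) {u : ∀ y, E y} {x : X}
    (hu : ∀ y, u y ∈ S.fiber y) (hgu : HolSec FV (fun y => g y (u y)) x) : HolSec F u x := by
  have hv : ∀ i, HolSec FV (fun y => g y (S.frameAt x i y)) x := fun i =>
    (hg.holLin x).self_of_nhds _ (S.holSec_frameAt x i)
  have hli : LinearIndependent ℂ fun i => g x (S.frameAt x i x) := by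
    have h := (S.eventually_frameAt x).self_of_nhds
    refine h.1.map ?_
    rw [h.2]
    exact disjoint_iff.2 (hinj x)
  obtain ⟨m, f, hf⟩ := LocFrame.exists_extension hv hli
  refine (HolSec.sum (I := Finset.univ) fun i _ => HolSec.smul (f.holAt_coeff hgu (Sum.inl i))
    (S.holSec_frameAt x i)).congr ?_
  filter_upwards [S.eventually_frameAt x, f.dual] with y h1 h2
  have h3 := hu y
  rw [← h1.2] at h3
  obtain ⟨c, hc⟩ := (Submodule.mem_span_range_iff_exists_fun ℂ).1 h3
  rw [← hc]
  refine Finset.sum_congr rfl fun i _ => ?_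
  congr 1
  have h4 : ∀ j, g y (S.frameAt x j y) = f.e (Sum.inl j) y := fun j => by rw [hf]
  simp [h4, h2]

end HolSubbundle

/-- The degree formula for the projection to `V`, whose kernel is the copy of `W`. -/
theorem degree_whole_prod :
    (whole (FV × FW) (V ×ᵇ W)).degree = (whole FV V).degree + (whole FW W).degree := by
  have hid : IsHolMap FW FW fun x => (LinearMap.id : W x →ₗ[ℂ] W x) := fun U s _ hs => hs
  have hzero : IsHolMap FW FV fun x => (0 : W x →ₗ[ℂ] V x) := fun U s hU hs =>
    isHolSection_of_holSec fun x _ => HolSec.zero x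
  obtain ⟨K, hK, hKr, hKd⟩ := HolSubbundle.exists_image (hzero.prod hid) (whole FW W) fun x => by
    rw [eq_bot_iff]
    intro w hw
    exact congrArg Prod.snd hw.2
  have h := (TwistedMap.ofMap (isHolMap_fst (FV := FV) (FW := FW) (V := V) (W := W))).degree_eq
    (S := whole (FV × FW) (V ×ᵇ W)) (K := K) (T := whole FV V) (fun x => by
      rw [hK]
      ext ⟨v, w⟩
      simp [whole, TwistedMap.ofMap, eq_comm]) (fun x => le_top) (by
      rw [hKr]
      simp only [whole, Module.finrank_prod]
      omega)
  simp only [TwistedMap.ofMap, HermLine.degree_one] at h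
  linarith

end Split

/-! ### Subobjects and generic injectivity -/

section Subobjects

variable {X : Type*} [TopologicalSpace X] [ChartedSpace ℂ X] [IsManifold 𝓘(ℂ) ω X]
  [CompactSpace X] [T2Space X] [ConnectedSpace X]
  {FV : Type*} [NormedAddCommGroup FV] [NormedSpace ℂ FV] [FiniteDimensional ℂ FV]
  {V : X → Type*} [TopologicalSpace (Bundle.TotalSpace FV V)] [∀ x, TopologicalSpace (V x)]
  [∀ x, AddCommGroup (V x)] [∀ x, Module ℂ (V x)]
  [FiberBundle FV V] [VectorBundle ℂ FV V] [ContMDiffVectorBundle ω FV V 𝓘(ℂ)]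
  {FW : Type*} [NormedAddCommGroup FW] [NormedSpace ℂ FW] [FiniteDimensional ℂ FW]
  {W : X → Type*} [TopologicalSpace (Bundle.TotalSpace FW W)] [∀ x, TopologicalSpace (W x)]
  [∀ x, AddCommGroup (W x)] [∀ x, Module ℂ (W x)]
  [FiberBundle FW W] [VectorBundle ℂ FW W] [ContMDiffVectorBundle ω FW W 𝓘(ℂ)]
  {FL : Type*} [NormedAddCommGroup FL] [NormedSpace ℂ FL] [FiniteDimensional ℂ FL]
  {L : X → Type*} [TopologicalSpace (Bundle.TotalSpace FL L)] [∀ x, TopologicalSpace (L x)]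
  [∀ x, AddCommGroup (L x)] [∀ x, Module ℂ (L x)]
  [FiberBundle FL L] [VectorBundle ℂ FL L] [ContMDiffVectorBundle ω FL L 𝓘(ℂ)]
  {p : ℕ} {α : ℝ}
  {β : ∀ x, W x →ₗ[ℂ] V x ⊗[ℂ] L x} {γ : ∀ x, V x →ₗ[ℂ] W x ⊗[ℂ] L x}

theorem IsAlphaStable.isAlphaSemistable (h : IsAlphaStable FV FW α β γ) :
    IsAlphaSemistable FV FW α β γ := fun V' W' hs => (h V' W' hs).le

/-- Exchanging `V` and `W` shifts all slopes by the same constant when `α` changes sign, which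
reduces the negative range of `α` to the positive one. -/
theorem alphaSlope_swap (V' : HolSubbundle FV V) (W' : HolSubbundle FW W)
    (h : 0 < V'.rank + W'.rank) : alphaSlope (-α) W' V' = alphaSlope α V' W' - α := by
  have h0 : (V'.rank + W'.rank : ℝ) ≠ 0 := by exact_mod_cast h.ne'
  have h1 : (W'.rank + V'.rank : ℝ) ≠ 0 := by rwa [add_comm]
  simp only [alphaSlope]
  field_simp
  ring

theorem IsAlphaSemistable.swap (h : IsAlphaSemistable FV FW α β γ) :
    IsAlphaSemistable FW FV (-α) γ β := by
  rintro W' V' ⟨h1, h2, h3, h4⟩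
  have h5 := h V' W' ⟨h2, h1, by omega, by omega⟩
  rw [alphaSlope_swap V' W' (by omega), alphaSlope_swap (whole FV V) (whole FW W) (by omega)]
  linarith

theorem alphaSlope_whole (hp : 0 < p) (hV : Module.finrank ℂ FV = p)
    (hW : Module.finrank ℂ FW = p) : alphaSlope α (whole FV V) (whole FW W) =
      ((whole FV V).degree + (whole FW W).degree) / (2 * p) + α / 2 := by
  have e1 : (whole FV V).rank = p := hV
  have e2 : (whole FW W).rank = p := hW
  have hp' : (p : ℝ) ≠ 0 := by exact_mod_cast hp.ne'
  simp only [alphaSlope, e1, e2]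
  field_simp
  ring

theorem alphaSlope_le_iff {V' : HolSubbundle FV V} {W' : HolSubbundle FW W} {μ : ℝ}
    (h : 0 < V'.rank + W'.rank) : alphaSlope α V' W' ≤ μ ↔
      V'.degree + W'.degree + α * V'.rank ≤ μ * (V'.rank + W'.rank) := by
  have h0 : (0 : ℝ) < V'.rank + W'.rank := by exact_mod_cast h
  rw [alphaSlope, mul_div_assoc', ← add_div, div_le_iff₀ h0]

/-- In multiplied-out form the inequality is an equality for the zero and the whole subobject, so
properness can be dropped. -/
theorem IsAlphaSemistable.degree_le (hp : 0 < p) (hV : Module.finrank ℂ FV = p)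
    (hW : Module.finrank ℂ FW = p) (h : IsAlphaSemistable FV FW α β γ)
    {V' : HolSubbundle FV V} {W' : HolSubbundle FW W} (hβ : MapsInto β W' V')
    (hγ : MapsInto γ V' W') : V'.degree + W'.degree + α * V'.rank ≤
      (((whole FV V).degree + (whole FW W).degree) / (2 * p) + α / 2) *
        (V'.rank + W'.rank) := by
  have e1 : (whole FV V).rank = p := hV
  have e2 : (whole FW W).rank = p := hW
  have l1 := V'.rank_le_whole
  have l2 := W'.rank_le_whole
  have hp' : (p : ℝ) ≠ 0 := by exact_mod_cast hp.ne'
  rcases Nat.eq_zero_or_pos (V'.rank + W'.rank) with h0 | h0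
  · have r1 : V'.rank = 0 := by omega
    have r2 : W'.rank = 0 := by omega
    rw [HolSubbundle.degree_of_rank_eq_zero r1, HolSubbundle.degree_of_rank_eq_zero r2, r1, r2]
    simp
  rcases lt_or_ge (V'.rank + W'.rank) ((whole FV V).rank + (whole FW W).rank) with h1 | h1
  · rw [← alphaSlope_le_iff h0, ← alphaSlope_whole hp hV hW]
    exact h V' W' ⟨hβ, hγ, h0, h1⟩
  · have r1 : V'.rank = (whole FV V).rank := by omega
    have r2 : W'.rank = (whole FW W).rank := by omega
    rw [HolSubbundle.degree_of_rank_eq_whole r1, HolSubbundle.degree_of_rank_eq_whole r2, r1, r2,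
      e1, e2]
    refine le_of_eq ?_
    field_simp
    ring

theorem IsAlphaStable.rank_eq (hp : 0 < p) (hV : Module.finrank ℂ FV = p)
    (hW : Module.finrank ℂ FW = p) (h : IsAlphaStable FV FW α β γ)
    {V' : HolSubbundle FV V} {W' : HolSubbundle FW W} (hβ : MapsInto β W' V')
    (hγ : MapsInto γ V' W')
    (hd : (((whole FV V).degree + (whole FW W).degree) / (2 * p) + α / 2) *
        (V'.rank + W'.rank) ≤ V'.degree + W'.degree + α * V'.rank) :
    V'.rank + W'.rank = 0 ∨ V'.rank + W'.rank = 2 * p := by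
  have e1 : (whole FV V).rank = p := hV
  have e2 : (whole FW W).rank = p := hW
  have l1 := V'.rank_le_whole
  have l2 := W'.rank_le_whole
  by_contra hc
  push Not at hc
  have h1 := h V' W' ⟨hβ, hγ, by omega, by omega⟩
  have h0 : (0 : ℝ) < V'.rank + W'.rank := by
    have : 0 < V'.rank + W'.rank := by omega
    exact_mod_cast this
  rw [alphaSlope_whole hp hV hW, alphaSlope, mul_div_assoc', ← add_div, div_lt_iff₀ h0] at h1
  exact absurd h1 hd.not_gt

/-- In a range of positive `α`, semistability forces the map `β` to be generically injective. -/
theorem IsAlphaSemistable.rank_le (hp : 0 < p) (hV : Module.finrank ℂ FV = p)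
    (hW : Module.finrank ℂ FW = p) (hL : Module.finrank ℂ FL = 1)
    (h : IsAlphaSemistable FV FW α β γ) (hβ : IsHolTwistedMap FW FV FL β)
    (hm : (whole FW W).slope - (whole FV V).slope < (whole FL L).degree)
    (hα : α < p * ((whole FW W).slope - (whole FV V).slope - (whole FL L).degree) +
      (whole FL L).degree)
    {V' : HolSubbundle FV V} {W' : HolSubbundle FW W} (hW'V' : MapsInto β W' V') :
    W'.rank ≤ V'.rank := by
  obtain ⟨N, I, hr, hN, hI, hgen⟩ := (TwistedMap.ofTensor hL hβ).exists_ker_image (whole FW W)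
  have e1 : (whole FV V).rank = p := hV
  have e2 : (whole FW W).rank = p := hW
  have hd := (TwistedMap.ofTensor hL hβ).degree_le hN hI hr fun x =>
    (hgen x).mono fun y hy => hy.1.ge
  rw [TwistedMap.degree_norm_ofTensor] at hd
  have hloc : ∀ x w, (TwistedMap.ofTensor hL hβ).loc x x w =
    contract (V x) (lineCo L hL x x) (β x w) := fun x w => rfl
  -- Semistability is tested on `(0, N)`, as `β` kills `N`, and on `(I, W)`, as `β` sends `W` into
  -- `I ⊗ L`.
  have s1 := h.degree_le hp hV hW (V' := HolSubbundle.zero FV V) (W' := N)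
    ((mapsInto_iff hL _ _ _).2 fun x v hv => by
      rw [← hloc, show (TwistedMap.ofTensor hL hβ).loc x x v = 0 from (hN x hv).2]
      exact Submodule.zero_mem _)
    ((mapsInto_iff hL _ _ _).2 fun x v hv => by
      rw [(Submodule.mem_bot ℂ).1 hv, map_zero, map_zero]
      exact Submodule.zero_mem _)
  have s2 := h.degree_le hp hV hW (V' := I) (W' := whole FW W)
    ((TwistedMap.maps_ofTensor hL hβ _ _).1 hI)
    ((mapsInto_iff hL _ _ _).2 fun x v hv => Submodule.mem_top)
  have hN0 : N.rank = 0 := by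
    by_contra hn
    have hn1 : (1 : ℝ) ≤ N.rank := by exact_mod_cast Nat.one_le_iff_ne_zero.2 hn
    have hr' : (I.rank : ℝ) = p - N.rank := by
      rw [e2] at hr
      rw [← hr]
      push_cast
      ring
    have hp' : (0 : ℝ) < p := by exact_mod_cast hp
    simp only [HolSubbundle.slope, e1, e2] at hm hα
    simp only [HolSubbundle.degree_zero, HolSubbundle.rank_zero, Nat.cast_zero] at s1
    rw [e2] at s2
    set n : ℝ := (N.rank : ℝ)
    set dV := (whole FV V).degree
    set dW := (whole FW W).degree
    set d := (whole FL L).degree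
    rw [hr'] at s2 hd
    have hm' : dW - dV < p * d := by
      rw [← sub_div, div_lt_iff₀ hp'] at hm
      linarith
    have hα' : α < dW - dV - p * d + d := by
      rw [← sub_div, mul_sub, mul_div_cancel₀ _ hp'.ne'] at hα
      linarith
    have hsum : (((dV + dW) / (2 * p) + α / 2) * (0 + n)) +
        (((dV + dW) / (2 * p) + α / 2) * (p - n + p)) = dV + dW + α * p := by
      field_simp
      ring
    have h1 : dW ≤ dV + α * n + (p - n) * d := by linarith
    have h2 : α * n < (dW - dV - p * d + d) * n := mul_lt_mul_of_pos_right hα' (by linarith)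
    -- With `δ = dW - dV - p d`, negative by `hm'`, the bounds give `δ < δ n`, which is impossible
    -- for `n ≥ 1`.
    nlinarith [mul_nonneg (sub_nonneg.2 hm'.le) (sub_nonneg.2 hn1)]
  obtain ⟨x⟩ : Nonempty X := inferInstance
  -- At a generic point the kernel is the fibre of `N`, so `β` is injective there and ranks can be
  -- compared.
  obtain ⟨y, hy⟩ := (hgen x).exists
  have hker : LinearMap.ker ((TwistedMap.ofTensor hL hβ).loc y y) = ⊥ := by
    have h1 : N.fiber y = ⊥ := by
      have := N.finiteDimensional_fiber y
      rw [← Submodule.finrank_eq_zero, N.finrank_fiber, hN0]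
    rw [← h1, hy.1]
    exact top_inf_eq _ |>.symm
  have hmap := (TwistedMap.maps_ofTensor hL hβ _ _).2 hW'V' y
  have := W'.finiteDimensional_fiber y
  have := V'.finiteDimensional_fiber y
  have hf := finrank_add_eq ((TwistedMap.ofTensor hL hβ).loc y y) (W'.fiber y)
  rw [hker, inf_bot_eq, finrank_bot, zero_add] at hf
  rw [← W'.finrank_fiber y, ← V'.finrank_fiber y, ← hf]
  exact Submodule.finrank_mono hmap

end Subobjects

/-! ### Invariant subbundles of the direct sum -/

section Higgs

variable {X : Type*} [TopologicalSpace X] [ChartedSpace ℂ X] [IsManifold 𝓘(ℂ) ω X]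
  [CompactSpace X] [T2Space X]
  {FV : Type*} [NormedAddCommGroup FV] [NormedSpace ℂ FV] [FiniteDimensional ℂ FV]
  {V : X → Type*} [TopologicalSpace (Bundle.TotalSpace FV V)] [∀ x, TopologicalSpace (V x)]
  [∀ x, AddCommGroup (V x)] [∀ x, Module ℂ (V x)]
  [FiberBundle FV V] [VectorBundle ℂ FV V] [ContMDiffVectorBundle ω FV V 𝓘(ℂ)]
  {FW : Type*} [NormedAddCommGroup FW] [NormedSpace ℂ FW] [FiniteDimensional ℂ FW]
  {W : X → Type*} [TopologicalSpace (Bundle.TotalSpace FW W)] [∀ x, TopologicalSpace (W x)]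
  [∀ x, AddCommGroup (W x)] [∀ x, Module ℂ (W x)]
  [FiberBundle FW W] [VectorBundle ℂ FW W] [ContMDiffVectorBundle ω FW W 𝓘(ℂ)]
  {FL : Type*} [NormedAddCommGroup FL] [NormedSpace ℂ FL] [FiniteDimensional ℂ FL]
  {L : X → Type*} [TopologicalSpace (Bundle.TotalSpace FL L)] [∀ x, TopologicalSpace (L x)]
  [∀ x, AddCommGroup (L x)] [∀ x, Module ℂ (L x)]
  [FiberBundle FL L] [VectorBundle ℂ FL L] [ContMDiffVectorBundle ω FL L 𝓘(ℂ)]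
  {p : ℕ} {α : ℝ} (hL : Module.finrank ℂ FL = 1)
  {β : ∀ x, W x →ₗ[ℂ] V x ⊗[ℂ] L x} {γ : ∀ x, V x →ₗ[ℂ] W x ⊗[ℂ] L x}

theorem contract_higgsField {x : X} (l : L x →ₗ[ℂ] ℂ) (u : (V ×ᵇ W) x) :
    contract ((V ×ᵇ W) x) l (higgsField β γ x u) =
      (contract (V x) l (β x u.2), contract (W x) l (γ x u.1)) := by
  have h : contract ((V ×ᵇ W) x) l (higgsField β γ x u) =
      LinearMap.inl ℂ (V x) (W x) (contract (V x) l (β x u.2)) +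
        LinearMap.inr ℂ (V x) (W x) (contract (W x) l (γ x u.1)) := by
    rw [← contract_rTensor, ← contract_rTensor, ← map_add]
    rfl
  rw [h]
  simp

theorem slope_whole_prod (hV : Module.finrank ℂ FV = p) (hW : Module.finrank ℂ FW = p) :
    (whole (FV × FW) (V ×ᵇ W)).slope =
      ((whole FV V).degree + (whole FW W).degree) / (2 * p) := by
  have h : (whole (FV × FW) (V ×ᵇ W)).rank = p + p := by
    rw [← congrArg₂ (· + ·) hV hW]
    exact Module.finrank_prod
  rw [HolSubbundle.slope, degree_whole_prod, h]
  push_cast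
  ring

theorem isHolMap_iso_comp {T : HolSubbundle (FV × FW) (V ×ᵇ W)}
    {a : ∀ x, V x →ₗ[ℂ] W x} (h1 : ∀ x v, (v, a x v) ∈ T.fiber x)
    (h2 : ∀ x, T.fiber x ⊓ LinearMap.ker (LinearMap.fst ℂ (V x) (W x)) = ⊥) :
    IsHolMap FV FW a := fun _ s hU hs => isHolSection_of_holSec fun _ hx =>
  (holSec_prod_iff.1 (HolSubbundle.holSec_lift (u := fun y => (s y, a y (s y))) isHolMap_fst h2
    (fun y => h1 y _) (hs.holSec hU hx))).2

theorem isHolMap_iso_comp_symm {T : HolSubbundle (FV × FW) (V ×ᵇ W)}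
    {a : ∀ x, W x →ₗ[ℂ] V x} (h1 : ∀ x w, (a x w, w) ∈ T.fiber x)
    (h2 : ∀ x, T.fiber x ⊓ LinearMap.ker (LinearMap.snd ℂ (V x) (W x)) = ⊥) :
    IsHolMap FW FV a := fun _ s hU hs => isHolSection_of_holSec fun _ hx =>
  (holSec_prod_iff.1 (HolSubbundle.holSec_lift (u := fun y => (a y (s y), s y)) isHolMap_snd h2
    (fun y => h1 y _) (hs.holSec hU hx))).1

/-- A subbundle of `V ⊕ W` projecting isomorphically to both summands is the graph of an
isomorphism. -/
theorem exists_iso_of_graph (hV : Module.finrank ℂ FV = p) (hW : Module.finrank ℂ FW = p)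
    {T : HolSubbundle (FV × FW) (V ×ᵇ W)} (hT : T.rank = p)
    (h1 : ∀ x, T.fiber x ⊓ LinearMap.ker (LinearMap.fst ℂ (V x) (W x)) = ⊥)
    (h2 : ∀ x, T.fiber x ⊓ LinearMap.ker (LinearMap.snd ℂ (V x) (W x)) = ⊥) :
    ∃ f : HolIso FV V FW W, ∀ x v, (v, f.equiv x v) ∈ T.fiber x := by
  obtain ⟨A, hA, hAr, -⟩ := HolSubbundle.exists_image isHolMap_fst T h1
  obtain ⟨B, hB, hBr, -⟩ := HolSubbundle.exists_image isHolMap_snd T h2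
  have b1 : ∀ x, Function.Bijective ((LinearMap.fst ℂ (V x) (W x)).domRestrict (T.fiber x)) := by
    refine fun x => ⟨LinearMap.injective_domRestrict_iff.2 (disjoint_iff.2 (h1 x)),
      LinearMap.range_eq_top.1 ?_⟩
    rw [LinearMap.range_domRestrict, ← hA]
    exact HolSubbundle.fiber_eq_top (by rw [hAr, hT]; exact hV.le) x
  have b2 : ∀ x, Function.Bijective ((LinearMap.snd ℂ (V x) (W x)).domRestrict (T.fiber x)) := by
    refine fun x => ⟨LinearMap.injective_domRestrict_iff.2 (disjoint_iff.2 (h2 x)),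
      LinearMap.range_eq_top.1 ?_⟩
    rw [LinearMap.range_domRestrict, ← hB]
    exact HolSubbundle.fiber_eq_top (by rw [hBr, hT]; exact hW.le) x
  let e1 := fun x => LinearEquiv.ofBijective _ (b1 x)
  let e2 := fun x => LinearEquiv.ofBijective _ (b2 x)
  let f : ∀ x, V x ≃ₗ[ℂ] W x := fun x => (e1 x).symm.trans (e2 x)
  have hf : ∀ x v, (v, f x v) ∈ T.fiber x := fun x v => by
    have h : (((e1 x).symm v : T.fiber x) : (V ×ᵇ W) x) = (v, f x v) :=
      Prod.ext ((e1 x).apply_symm_apply v) rfl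
    rw [← h]
    exact ((e1 x).symm v).2
  refine ⟨⟨f, isHolMap_iso_comp (a := fun x => (f x).toLinearMap) hf h1,
    isHolMap_iso_comp_symm (a := fun x => (f x).symm.toLinearMap) (fun x w => ?_) h2⟩, hf⟩
  have h := hf x ((f x).symm w)
  rwa [LinearEquiv.apply_symm_apply] at h

/-- The relation `β f = f⁻¹ γ` in terms of a coordinate on the fibre of the line bundle. -/
theorem comp_eq_iff (f : HolIso FV V FW W) (x : X) :
    β x ∘ₗ (f.equiv x).toLinearMap = (f.equiv x).symm.toLinearMap.rTensor (L x) ∘ₗ γ x ↔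
      ∀ v, contract (W x) (lineCo L hL x x) (γ x v) =
        f.equiv x (contract (V x) (lineCo L hL x x) (β x (f.equiv x v))) := by
  rw [LinearMap.ext_iff]
  refine forall_congr' fun v => ?_
  rw [← (contract_injective (lineCo_smul hL x)).eq_iff, LinearMap.comp_apply, LinearMap.comp_apply,
    contract_rTensor, LinearEquiv.coe_coe, LinearEquiv.coe_coe, LinearEquiv.eq_symm_apply, eq_comm]

/-- An invariant subbundle of `V ⊕ W` and the subobjects given by its projections and its
intersections with the summands. -/
theorem exists_subobjects [ConnectedSpace X] (hL : Module.finrank ℂ FL = 1)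
    (hβ : IsHolTwistedMap FW FV FL β) (hγ : IsHolTwistedMap FV FW FL γ)
    {T : HolSubbundle (FV × FW) (V ×ᵇ W)} (hT : MapsInto (higgsField β γ) T T) :
    ∃ (V₁ V₂ : HolSubbundle FV V) (W₁ W₂ : HolSubbundle FW W),
      MapsInto β W₁ V₁ ∧ MapsInto γ V₁ W₁ ∧ MapsInto β W₂ V₂ ∧ MapsInto γ V₂ W₂ ∧
      W₂.rank + V₁.rank = T.rank ∧ V₂.rank + W₁.rank = T.rank ∧ V₂.rank ≤ V₁.rank ∧
      T.degree ≤ W₂.degree + V₁.degree ∧ T.degree ≤ V₂.degree + W₁.degree ∧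
      (W₂.degree + V₁.degree ≤ T.degree → W₂.rank = 0 →
        ∀ x, T.fiber x ⊓ LinearMap.ker (LinearMap.fst ℂ (V x) (W x)) = ⊥) ∧
      (V₂.degree + W₁.degree ≤ T.degree → V₂.rank = 0 →
        ∀ x, T.fiber x ⊓ LinearMap.ker (LinearMap.snd ℂ (V x) (W x)) = ⊥) := by
  obtain ⟨V₁, W₂, r1, d1, g1, s1⟩ := HolSubbundle.exists_split
    (isHolMap_fst (V := V) (W := W) (FV := FV) (FW := FW)) isHolMap_snd (fun x => by
      rw [eq_bot_iff]
      exact fun u hu => Prod.ext hu.1 hu.2) T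
  obtain ⟨W₁, V₂, r2, d2, g2, s2⟩ := HolSubbundle.exists_split
    (isHolMap_snd (V := V) (W := W) (FV := FV) (FW := FW)) isHolMap_fst (fun x => by
      rw [eq_bot_iff]
      exact fun u hu => Prod.ext hu.2 hu.1) T
  have hinv : ∀ x u, u ∈ T.fiber x → (contract (V x) (lineCo L hL x x) (β x u.2),
      contract (W x) (lineCo L hL x x) (γ x u.1)) ∈ T.fiber x := fun x u hu => by
    rw [← contract_higgsField]
    exact (mapsInto_iff hL _ _ _).1 hT x u hu
  refine ⟨V₁, V₂, W₁, W₂, ?_, ?_, ?_, ?_, r1, r2, ?_, d1, d2, s1, s2⟩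
  -- Invariance is checked at generic points, where the saturations are the actual projections and
  -- intersections.
  · refine (TwistedMap.maps_ofTensor hL hβ _ _).1 (TwistedMap.maps_of_punctured _ _ _ fun x => ?_)
    filter_upwards [g1 x, g2 x] with y h1 h2
    rw [h1.1, h2.1]
    rintro _ ⟨_, ⟨u, hu, rfl⟩, rfl⟩
    exact ⟨_, hinv y u hu, rfl⟩
  · refine (TwistedMap.maps_ofTensor hL hγ _ _).1 (TwistedMap.maps_of_punctured _ _ _ fun x => ?_)
    filter_upwards [g1 x, g2 x] with y h1 h2
    rw [h1.1, h2.1]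
    rintro _ ⟨_, ⟨u, hu, rfl⟩, rfl⟩
    exact ⟨_, hinv y u hu, rfl⟩
  · refine (TwistedMap.maps_ofTensor hL hβ _ _).1 (TwistedMap.maps_of_punctured _ _ _ fun x => ?_)
    filter_upwards [g1 x, g2 x] with y h1 h2
    rw [h1.2, h2.2]
    rintro _ ⟨_, ⟨u, hu, rfl⟩, rfl⟩
    refine ⟨_, ⟨hinv y u hu.1, ?_⟩, rfl⟩
    have h0 : u.1 = 0 := hu.2
    simp [h0]
  · refine (TwistedMap.maps_ofTensor hL hγ _ _).1 (TwistedMap.maps_of_punctured _ _ _ fun x => ?_)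
    filter_upwards [g1 x, g2 x] with y h1 h2
    rw [h1.2, h2.2]
    rintro _ ⟨_, ⟨u, hu, rfl⟩, rfl⟩
    refine ⟨_, ⟨hinv y u hu.1, ?_⟩, rfl⟩
    have h0 : u.2 = 0 := hu.2
    simp [h0]
  · obtain ⟨x⟩ : Nonempty X := inferInstance
    obtain ⟨y, h1, h2⟩ := ((g1 x).and (g2 x)).exists
    refine HolSubbundle.rank_mono (x := y) ?_
    rw [h1.1, h2.2]
    exact Submodule.map_mono inf_le_left

/-- Add the inequalities of the two subobjects. Since `rk V₂ = rk T - rk W₁`, the terms in `α` leave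
`α (rk V₁ - rk W₁)`, which is nonnegative by `hα`. -/
theorem slope_le_of_isAlphaSemistable [ConnectedSpace X] (hp : 0 < p)
    (hV : Module.finrank ℂ FV = p) (hW : Module.finrank ℂ FW = p) (hL : Module.finrank ℂ FL = 1)
    (hβ : IsHolTwistedMap FW FV FL β) (hγ : IsHolTwistedMap FV FW FL γ)
    (h : IsAlphaSemistable FV FW α β γ)
    (hα : ∀ (V' : HolSubbundle FV V) (W' : HolSubbundle FW W), MapsInto β W' V' →
      MapsInto γ V' W' → α * W'.rank ≤ α * V'.rank) :
    IsSemistable (FV × FW) (higgsField β γ) := by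
  intro T hT h0 _
  obtain ⟨V₁, V₂, W₁, W₂, b1, c1, b2, c2, r1, r2, -, d1, d2, -, -⟩ :=
    exists_subobjects hL hβ hγ hT
  have h1 := h.degree_le hp hV hW b1 c1
  have h2 := h.degree_le hp hV hW b2 c2
  have h3 := hα V₁ W₁ b1 c1
  have r1' : (W₂.rank : ℝ) = T.rank - V₁.rank := by
    rw [← r1]
    push_cast
    ring
  have r2' : (V₂.rank : ℝ) = T.rank - W₁.rank := by
    rw [← r2]
    push_cast
    ring
  have h0' : (0 : ℝ) < T.rank := by exact_mod_cast h0
  rw [slope_whole_prod hV hW, HolSubbundle.slope, div_le_iff₀ h0']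
  rw [r1', r2'] at h2
  generalize ((whole FV V).degree + (whole FW W).degree) / (2 * p) = μ at *
  linarith

/-- A subbundle `T` of slope at least that of the whole forces equality everywhere, so each of the
two subobjects has total rank `0` or `2p`. These ranks add up to `2 rk T`, strictly between `0` and
`4p`, and `rk V₂ ≤ rk V₁` shows that `(V₁, W₁)` is the whole one. Equality of degrees then makes `T`
a graph. -/
theorem isStable_or_exists_iso [ConnectedSpace X] (hp : 0 < p)
    (hV : Module.finrank ℂ FV = p) (hW : Module.finrank ℂ FW = p) (hL : Module.finrank ℂ FL = 1)
    (hβ : IsHolTwistedMap FW FV FL β) (hγ : IsHolTwistedMap FV FW FL γ)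
    (h : IsAlphaStable FV FW α β γ)
    (hα : ∀ (V' : HolSubbundle FV V) (W' : HolSubbundle FW W), MapsInto β W' V' →
      MapsInto γ V' W' → α * W'.rank ≤ α * V'.rank) :
    IsStable (FV × FW) (higgsField β γ) ∨ ∃ f : HolIso FV V FW W, ∀ x,
      β x ∘ₗ (f.equiv x).toLinearMap = (f.equiv x).symm.toLinearMap.rTensor (L x) ∘ₗ γ x := by
  rw [or_iff_not_imp_left]
  intro hns
  simp only [IsStable, IsStableOn] at hns
  push Not at hns
  obtain ⟨T, hT, -, h0, hlt, hslope⟩ := hns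
  obtain ⟨V₁, V₂, W₁, W₂, b1, c1, b2, c2, r1, r2, hle, d1, d2, s1, s2⟩ :=
    exists_subobjects hL hβ hγ hT
  have h1 := h.isAlphaSemistable.degree_le hp hV hW b1 c1
  have h2 := h.isAlphaSemistable.degree_le hp hV hW b2 c2
  have h3 := hα V₁ W₁ b1 c1
  have r1' : (W₂.rank : ℝ) = T.rank - V₁.rank := by
    rw [← r1]
    push_cast
    ring
  have r2' : (V₂.rank : ℝ) = T.rank - W₁.rank := by
    rw [← r2]
    push_cast
    ring
  have h0' : (0 : ℝ) < T.rank := by exact_mod_cast h0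
  rw [slope_whole_prod hV hW, HolSubbundle.slope, le_div_iff₀ h0'] at hslope
  have hrk : (whole (FV × FW) (V ×ᵇ W)).rank = p + p := by
    rw [← congrArg₂ (· + ·) hV hW]
    exact Module.finrank_prod
  rw [hrk] at hlt
  have i1 := h.rank_eq hp hV hW b1 c1 (by
    rw [r1', r2'] at h2
    generalize ((whole FV V).degree + (whole FW W).degree) / (2 * p) = μ at *
    linarith)
  have i2 := h.rank_eq hp hV hW b2 c2 (by
    rw [r1', r2']
    rw [r1', r2'] at h2
    generalize ((whole FV V).degree + (whole FW W).degree) / (2 * p) = μ at *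
    linarith)
  have l1 : V₁.rank ≤ p := V₁.rank_le_whole.trans hV.le
  have l2 : W₁.rank ≤ p := W₁.rank_le_whole.trans hW.le
  have k1 : V₁.rank = p := by omega
  have k2 : W₁.rank = p := by omega
  have k3 : V₂.rank = 0 := by omega
  have k4 : W₂.rank = 0 := by omega
  have k5 : T.rank = p := by omega
  have hp' : (p : ℝ) ≠ 0 := by exact_mod_cast hp.ne'
  rw [k5, div_mul_eq_mul_div, mul_div_mul_right _ _ hp'] at hslope
  rw [HolSubbundle.degree_of_rank_eq_zero k3,
    HolSubbundle.degree_of_rank_eq_whole (k2.trans hW.symm), zero_add] at d2 s2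
  rw [HolSubbundle.degree_of_rank_eq_zero k4,
    HolSubbundle.degree_of_rank_eq_whole (k1.trans hV.symm), zero_add] at d1 s1
  have j1 := s1 (by linarith) k4
  have j2 := s2 (by linarith) k3
  obtain ⟨f, hf⟩ := exists_iso_of_graph hV hW k5 j1 j2
  refine ⟨f, fun x => (comp_eq_iff hL f x).2 fun v => ?_⟩
  have m1 := (mapsInto_iff hL _ _ _).1 hT x _ (hf x v)
  rw [contract_higgsField] at m1
  -- The image `(β f v, γ v)` of `(v, f v)` and the graph point over `β f v` both lie in `T` and
  -- have the same first component, hence are equal.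
  have m2 := Submodule.sub_mem _ m1 (hf x (contract (V x) (lineCo L hL x x) (β x (f.equiv x v))))
  have m3 : _ ∈ T.fiber x ⊓ LinearMap.ker (LinearMap.fst ℂ (V x) (W x)) := ⟨m2, sub_self _⟩
  rw [j1 x, Submodule.mem_bot] at m3
  exact sub_eq_zero.1 (congrArg Prod.snd m3)

/-- The isomorphism `-f`. -/
def HolIso.neg (f : HolIso FV V FW W) : HolIso FV V FW W where
  equiv x := (f.equiv x).trans (LinearEquiv.neg ℂ)
  hol U s hU hs := isHolSection_of_holSec fun x hx =>
    (((f.hol U s hU hs).holSec hU hx).const_smul (-1)).congr (Eventually.of_forall fun y => by simp)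
  hol_symm U s hU hs := isHolSection_of_holSec fun x hx =>
    (((f.hol_symm U s hU hs).holSec hU hx).const_smul (-1)).congr
      (Eventually.of_forall fun y => by
        rw [neg_smul, one_smul, ← map_neg]
        rfl)

theorem HolIso.neg_apply (f : HolIso FV V FW W) (x : X) (v : V x) :
    f.neg.equiv x v = -f.equiv x v := rfl

/-- The graph of an isomorphism `f` with `β f = f⁻¹ γ` is a stable Higgs subbundle. -/
theorem exists_graph [ConnectedSpace X] (hp : 0 < p) (hV : Module.finrank ℂ FV = p)
    (hW : Module.finrank ℂ FW = p) (hL : Module.finrank ℂ FL = 1)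
    (h : IsAlphaStable FV FW α β γ) (f : HolIso FV V FW W)
    (hf : ∀ x v, contract (W x) (lineCo L hL x x) (γ x v) =
        f.equiv x (contract (V x) (lineCo L hL x x) (β x (f.equiv x v)))) :
    ∃ S : HolSubbundle (FV × FW) (V ×ᵇ W), (∀ x u, u ∈ S.fiber x ↔ f.equiv x u.1 = u.2) ∧
      S.rank = p ∧ S.slope = (whole (FV × FW) (V ×ᵇ W)).slope ∧
      IsStableOn (higgsField β γ) S ∧
      IsHiggsIsoTo (higgsField β γ) S FV fun x => β x ∘ₗ (f.equiv x).toLinearMap := by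
  have hid : IsHolMap FV FV fun x => (LinearMap.id : V x →ₗ[ℂ] V x) := fun U s _ hs => hs
  have hinj : ∀ x, Function.Injective
      ((LinearMap.id : V x →ₗ[ℂ] V x).prod (f.equiv x).toLinearMap) := fun x a b hab =>
    congrArg Prod.fst hab
  obtain ⟨S, hS, hSr, hSd⟩ := HolSubbundle.exists_image (hid.prod f.hol) (whole FV V) fun x => by
    rw [LinearMap.ker_eq_bot.2 (hinj x), inf_bot_eq]
  obtain ⟨Y, hY, hYr, hYd⟩ := HolSubbundle.exists_image f.hol (whole FV V) fun x => by
    rw [LinearMap.ker_eq_bot.2 (f.equiv x).injective, inf_bot_eq]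
  have hSr' : S.rank = p := hSr.trans hV
  have hdeg : (whole FW W).degree = (whole FV V).degree := by
    rw [← hYd]
    exact (HolSubbundle.degree_of_rank_eq_whole (hYr.trans (hV.trans hW.symm))).symm
  have hmem : ∀ x u, u ∈ S.fiber x ↔ f.equiv x u.1 = u.2 := by
    intro x u
    rw [hS]
    constructor
    · rintro ⟨v, -, rfl⟩
      rfl
    · intro hu
      exact ⟨u.1, Submodule.mem_top, Prod.ext rfl hu⟩
  have hp' : (p : ℝ) ≠ 0 := by exact_mod_cast hp.ne'
  have hslope : S.slope = (whole FV V).degree / p := by rw [HolSubbundle.slope, hSd, hSr']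
  refine ⟨S, hmem, hSr', ?_, ?_, ?_⟩
  · rw [hslope, slope_whole_prod hV hW, hdeg]
    field_simp
    ring
  · intro T hT hTS h0 hlt
    -- Both projections of `T` are injective, so `V'` and `W'` have its rank and degree, and the
    -- `α`-slope of `(V', W')` is `μ(T) + α / 2`.
    obtain ⟨V', hV', hVr, hVd⟩ := HolSubbundle.exists_image isHolMap_fst T fun x => by
      rw [eq_bot_iff]
      rintro u ⟨hu, h1⟩
      have h1' : u.1 = 0 := h1
      have h2 := (hmem x u).1 (hTS x hu)
      rw [h1', map_zero] at h2
      exact Prod.ext h1' h2.symm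
    obtain ⟨W', hW', hWr, hWd⟩ := HolSubbundle.exists_image isHolMap_snd T fun x => by
      rw [eq_bot_iff]
      rintro u ⟨hu, h1⟩
      have h1' : u.2 = 0 := h1
      have h2 := (hmem x u).1 (hTS x hu)
      rw [h1', LinearEquiv.map_eq_zero_iff] at h2
      exact Prod.ext h2 h1'
    have hinv : ∀ x u, u ∈ T.fiber x → (contract (V x) (lineCo L hL x x) (β x u.2),
        contract (W x) (lineCo L hL x x) (γ x u.1)) ∈ T.fiber x := fun x u hu => by
      rw [← contract_higgsField]
      exact (mapsInto_iff hL _ _ _).1 hT x u hu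
    have e1 : (whole FV V).rank = p := hV
    have e2 : (whole FW W).rank = p := hW
    have h1 := h V' W' ⟨(mapsInto_iff hL _ _ _).2 fun x w hw => by
      rw [hW'] at hw
      rw [hV']
      obtain ⟨u, hu, rfl⟩ := hw
      exact ⟨_, hinv x u hu, rfl⟩, (mapsInto_iff hL _ _ _).2 fun x v hv => by
      rw [hV'] at hv
      rw [hW']
      obtain ⟨u, hu, rfl⟩ := hv
      exact ⟨_, hinv x u hu, rfl⟩, by omega, by omega⟩
    have h0' : (0 : ℝ) < T.rank := by exact_mod_cast h0
    rw [alphaSlope_whole hp hV hW, alphaSlope, hVd, hWd, hVr, hWr, hdeg] at h1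
    rw [hslope, HolSubbundle.slope]
    have e3 : (T.degree + T.degree) / (T.rank + T.rank) + α * (T.rank / (T.rank + T.rank)) =
        T.degree / T.rank + α / 2 := by
      field_simp
      ring
    have e4 : ((whole FV V).degree + (whole FV V).degree) / (2 * p) = (whole FV V).degree / p := by
      field_simp
      ring
    rw [e3, e4] at h1
    linarith
  · refine ⟨(mapsInto_iff hL _ _ _).2 fun x u hu => ?_, _, hid.prod f.hol, hinj, fun x => ?_,
      fun x => ?_⟩
    · rw [hmem] at hu ⊢
      rw [contract_higgsField, hf, hu]
    · rw [hS]
      exact (LinearMap.range_eq_map _)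
    · ext1 v
      apply contract_injective (lineCo_smul hL x)
      rw [LinearMap.comp_apply, LinearMap.comp_apply, contract_rTensor, contract_higgsField]
      exact Prod.ext rfl (hf x v)

end Higgs

end Higgs

end

/-! ### The main theorem -/

theorem proposition3p15
    -- `X` is a compact Riemann surface
    {X : Type*} [TopologicalSpace X] [ChartedSpace ℂ X] [IsManifold 𝓘(ℂ) ω X]
    [CompactSpace X] [T2Space X] [ConnectedSpace X]
    -- `V` and `W` are holomorphic vector bundles of rank `p`
    {FV : Type*} [NormedAddCommGroup FV] [NormedSpace ℂ FV] [FiniteDimensional ℂ FV]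
    {V : X → Type*} [TopologicalSpace (Bundle.TotalSpace FV V)] [∀ x, TopologicalSpace (V x)]
    [∀ x, AddCommGroup (V x)] [∀ x, Module ℂ (V x)]
    [FiberBundle FV V] [VectorBundle ℂ FV V] [ContMDiffVectorBundle ω FV V 𝓘(ℂ)]
    {FW : Type*} [NormedAddCommGroup FW] [NormedSpace ℂ FW] [FiniteDimensional ℂ FW]
    {W : X → Type*} [TopologicalSpace (Bundle.TotalSpace FW W)] [∀ x, TopologicalSpace (W x)]
    [∀ x, AddCommGroup (W x)] [∀ x, Module ℂ (W x)]
    [FiberBundle FW W] [VectorBundle ℂ FW W] [ContMDiffVectorBundle ω FW W 𝓘(ℂ)]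
    (p : ℕ) (hp : 0 < p) (hV : Module.finrank ℂ FV = p) (hW : Module.finrank ℂ FW = p)
    -- `L` is a holomorphic line bundle
    {FL : Type*} [NormedAddCommGroup FL] [NormedSpace ℂ FL] [FiniteDimensional ℂ FL]
    {L : X → Type*} [TopologicalSpace (Bundle.TotalSpace FL L)] [∀ x, TopologicalSpace (L x)]
    [∀ x, AddCommGroup (L x)] [∀ x, Module ℂ (L x)]
    [FiberBundle FL L] [VectorBundle ℂ FL L] [ContMDiffVectorBundle ω FL L 𝓘(ℂ)]
    (hL : Module.finrank ℂ FL = 1)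
    -- `β : W → V ⊗ L` and `γ : V → W ⊗ L` are holomorphic
    (β : ∀ x, W x →ₗ[ℂ] V x ⊗[ℂ] L x) (hβ : Higgs.IsHolTwistedMap FW FV FL β)
    (γ : ∀ x, V x →ₗ[ℂ] W x ⊗[ℂ] L x) (hγ : Higgs.IsHolTwistedMap FV FW FL γ)
    (α μV μW d α₀ α₀' : ℝ)
    (hμV : μV = (Higgs.whole FV V).slope) (hμW : μW = (Higgs.whole FW W).slope)
    (hd : d = (Higgs.whole FL L).degree)
    (hα₀ : α₀ = p * (μW - μV - d) + d) (hα₀' : α₀' = p * (μW - μV + d) - d) :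
    -- the comparison of the stability conditions in the given range of `α`
    ((μV - μW > -d ∧ 0 ≤ α ∧ α < α₀) ∨ (μV - μW < d ∧ α₀' < α ∧ α ≤ 0) →
      (Higgs.IsAlphaSemistable FV FW α β γ →
        Higgs.IsSemistable (FV × FW) (Higgs.higgsField β γ)) ∧
      (Higgs.IsAlphaStable FV FW α β γ →
        Higgs.IsStable (FV × FW) (Higgs.higgsField β γ) ∨
        ∃ f : Higgs.HolIso FV V FW W, ∀ x, β x ∘ₗ (f.equiv x).toLinearMap =
          (f.equiv x).symm.toLinearMap.rTensor (L x) ∘ₗ γ x)) ∧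
    -- the exceptional case, for every `α`
    (Higgs.IsAlphaStable FV FW α β γ →
      ∀ f : Higgs.HolIso FV V FW W,
        (∀ x, β x ∘ₗ (f.equiv x).toLinearMap =
          (f.equiv x).symm.toLinearMap.rTensor (L x) ∘ₗ γ x) →
        Higgs.IsPolystable (FV × FW) (Higgs.higgsField β γ) ∧
        ∃ E₁ E₂ : Higgs.HolSubbundle (FV × FW) (V ×ᵇ W),
          (∀ x, IsCompl (E₁.fiber x) (E₂.fiber x)) ∧
          E₁.rank = p ∧ E₂.rank = p ∧
          E₁.slope = (Higgs.whole (FV × FW) (V ×ᵇ W)).slope ∧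
          E₂.slope = (Higgs.whole (FV × FW) (V ×ᵇ W)).slope ∧
          Higgs.IsStableOn (Higgs.higgsField β γ) E₁ ∧
          Higgs.IsStableOn (Higgs.higgsField β γ) E₂ ∧
          Higgs.IsHiggsIsoTo (Higgs.higgsField β γ) E₁ FV
            (fun x => β x ∘ₗ (f.equiv x).toLinearMap) ∧
          Higgs.IsHiggsIsoTo (Higgs.higgsField β γ) E₂ FV
            (fun x => -(β x ∘ₗ (f.equiv x).toLinearMap))) := by
  -- The sign condition on `α (rk V' - rk W')`: in the first range `β` is generically injective, in
  -- the second `γ` is, by exchanging `V` and `W` and the sign of `α`.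
  have hcomp : (μV - μW > -d ∧ 0 ≤ α ∧ α < α₀) ∨ (μV - μW < d ∧ α₀' < α ∧ α ≤ 0) →
      Higgs.IsAlphaSemistable FV FW α β γ →
      ∀ (V' : Higgs.HolSubbundle FV V) (W' : Higgs.HolSubbundle FW W), Higgs.MapsInto β W' V' →
        Higgs.MapsInto γ V' W' → α * W'.rank ≤ α * V'.rank := by
    subst hμV hμW hd hα₀ hα₀'
    rintro (⟨h1, h2, h3⟩ | ⟨h1, h2, h3⟩) h V' W' hb hc
    · refine mul_le_mul_of_nonneg_left ?_ h2
      exact_mod_cast h.rank_le hp hV hW hL hβ (by linarith) h3 hb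
    · refine mul_le_mul_of_nonpos_left ?_ h3
      exact_mod_cast h.swap.rank_le hp hW hV hL hγ h1 (by linarith) hc
  refine ⟨fun hα => ⟨fun h => ?_, fun h => ?_⟩, fun h f hf => ?_⟩
  · exact Higgs.slope_le_of_isAlphaSemistable hp hV hW hL hβ hγ h (hcomp hα h)
  · exact Higgs.isStable_or_exists_iso hp hV hW hL hβ hγ h (hcomp hα h.isAlphaSemistable)
  · have hf' := fun x => (Higgs.comp_eq_iff hL f x).1 (hf x)
    obtain ⟨E₁, hE₁, r₁, s₁, st₁, iso₁⟩ := Higgs.exists_graph hp hV hW hL h f hf'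
    -- The relation is quadratic in `f`, namely `γ = f β f`, so `-f` satisfies it too.
    obtain ⟨E₂, hE₂, r₂, s₂, st₂, iso₂⟩ := Higgs.exists_graph hp hV hW hL h f.neg fun x v => by
      simp only [Higgs.HolIso.neg_apply, map_neg, neg_neg, hf']
    have hcompl : ∀ x, IsCompl (E₁.fiber x) (E₂.fiber x) := fun x => by
      rw [isCompl_iff, Submodule.disjoint_def, codisjoint_iff_le_sup]
      constructor
      · rintro ⟨v, w⟩ h1 h2
        rw [hE₁] at h1
        rw [hE₂, Higgs.HolIso.neg_apply] at h2
        have h3 : w = 0 := by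
          have h4 : (2 : ℂ) • w = 0 := by
            rw [two_smul]
            nth_rw 1 [← show _ = w from h1]
            rw [← show _ = w from h2, add_neg_cancel]
          exact (smul_eq_zero.1 h4).resolve_left two_ne_zero
        rw [h3, LinearEquiv.map_eq_zero_iff] at h1
        exact Prod.ext h1 h3
      · rintro ⟨v, w⟩ -
        -- The vector is half the sum of a point of the graph of `f` and a point of the graph of
        -- `-f`.
        have e : ((v, w) : V x × W x) =
            (2⁻¹ : ℂ) • (v + (f.equiv x).symm w, f.equiv x v + w) +
              (2⁻¹ : ℂ) • (v - (f.equiv x).symm w, w - f.equiv x v) := by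
          ext
          · simp only [Prod.fst_add, Prod.smul_fst]
            module
          · simp only [Prod.snd_add, Prod.smul_snd]
            module
        rw [e]
        refine Submodule.add_mem_sup (Submodule.smul_mem _ _ ((hE₁ x _).2 ?_))
          (Submodule.smul_mem _ _ ((hE₂ x _).2 ?_))
        · simp
        · simp [Higgs.HolIso.neg_apply]
    refine ⟨⟨2, ![E₁, E₂], fun x => ?_, fun i => ?_, fun i j => ?_⟩, E₁, E₂, hcompl, r₁, r₂, s₁, s₂,
      st₁, st₂, iso₁, ?_⟩
    · rw [DirectSum.isInternal_submodule_iff_isCompl (i := 0) (j := 1) _ (by simp)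
        (by ext i; fin_cases i <;> simp)]
      exact hcompl x
    · fin_cases i
      · exact ⟨hp.trans_eq r₁.symm, iso₁.1, st₁⟩
      · exact ⟨hp.trans_eq r₂.symm, iso₂.1, st₂⟩
    · fin_cases i <;> fin_cases j <;> simp [s₁, s₂]
    · convert iso₂ using 2 with x
      ext v
      simp [Higgs.HolIso.neg_apply]
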